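/- Let $\Phi_0$ be a homogeneous Poisson point process on $\mathbb{R}^2$ with intensity $\lambda>0$. In a locally finite counting measure $\mu$ on $\mathbb{R}^2$ (points counted with multiplicity), a point $A$ \emph{follows} a point $B\neq A$ if $B$ is closest, in Euclidean distance, to $A$ among all points of $\mu$ other than $A$; $B$ is then a \emph{leader} of $A$. (Two points at the same location are at distance $0$, so a pair sharing a location follow each other, and a point whose closest location carries several points follows each of them.) The \emph{follower graph} of $\mu$ has the points of $\mu$ as vertices and an edge between $A$ and $B$ whenever one of them follows the other. The \emph{forward set} of $A$ is the set of its leaders of all orders, and the \emph{backward set} of $A$ is the set of its followers of all orders ($A$ itself being included in both). Let $\Phi_1$ be the point process obtained from $\Phi_0$ by moving every point $x$ simultaneously to the midpoint of $x$ and its leader (its nearest neighbour in $\Phi_0$, which almost surely exists and is unique). Thus two mutually nearest points of $\Phi_0$ merge into one location of $\Phi_1$ of multiplicity two. Let $\Phi_1^*$ be the simple point process with the same locations as $\Phi_1$, i.e. $\Phi_1$ regarded as a random subset of $\mathbb{R}^2$. Then, for $\Psi=\Phi_1$ and also for $\Psi=\Phi_1^*$: 1. Almost surely, all connected components of the follower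 graph of $\Psi$ are finite (the Poisson follower model at step $1$ does not percolate). 2. The Palm probability of $\Psi$, $$\mathbb{P}^0_{\Psi}(A)=\frac{1}{\lambda_\Psi}\,\mathbb{E}\Big[\int_{[0,1)^2}\mathbf{1}\{\Psi-x\in A\}\,\Psi(dx)\Big],\qquad \lambda_\Psi=\mathbb{E}\big[\Psi([0,1)^2)\big],$$ is a well-defined probability measure on the space of counting measures, and $\mathbb{P}^0_\Psi$-almost surely there is a point at the origin, and every point at the origin has a finite forward set and a finite backward set. -/

import Mathlib

open MeasureTheory
open scoped ENNReal

noncomputable section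

namespace FollowerModel

/-- The Euclidean plane `ℝ²`, with its Euclidean distance and Lebesgue measure `volume`. -/
abbrev Plane : Type := EuclideanSpace ℝ (Fin 2)

/-- A locally finite counting measure: a countable sum of unit point masses
without accumulation points. Multiplicities are allowed. -/
def IsCountingMeasure (μ : Measure Plane) : Prop :=
  IsLocallyFiniteMeasure μ ∧
    ∃ (ι : Type) (_ : Countable ι) (x : ι → Plane), μ = Measure.sum fun i => Measure.dirac (x i)

/-- `Φ` is a homogeneous Poisson point process on the plane with intensity `lam`, under `P`.
The space of measures carries the σ-algebra generated by the evaluations `μ ↦ μ B`, `B` Borel. -/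
structure IsPoissonProcess {Ω : Type*} [MeasurableSpace Ω] (P : Measure Ω) (lam : ℝ)
    (Φ : Ω → Measure Plane) : Prop where
  measurable : Measurable Φ
  counting : ∀ ω, IsCountingMeasure (Φ ω)
  finite_dim : ∀ (j : ℕ) (B : Fin j → Set Plane) (m : Fin j → ℕ),
    (∀ i, MeasurableSet (B i)) → (∀ i, volume (B i) < ∞) →
    Pairwise (fun i i' => Disjoint (B i) (B i')) →
    P {ω | ∀ i, Φ ω (B i) = (m i : ℝ≥0∞)} =
      ∏ i, ENNReal.ofReal ((lam * volume.real (B i)) ^ m i / (Nat.factorial (m i) : ℝ) *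
        Real.exp (-(lam * volume.real (B i))))

/-- The points (agents) of a counting measure `μ`: a location of multiplicity `k` carries the
`k` agents numbered `0, …, k - 1`. -/
def Agent (μ : Measure Plane) : Type :=
  {p : Plane × ℕ // (p.2 : ℝ≥0∞) < μ {p.1}}

/-- The location of an agent. -/
def Agent.pos {μ : Measure Plane} (a : Agent μ) : Plane := a.1.1

/-- `a` follows `b`: among all agents other than `a`, `b` is a closest one to `a`. Two agents at
the same location are at distance `0`, so a pair of agents that merged follow each other; an agent
whose closest location carries several agents is taken to follow each of them. -/
def Follows {μ : Measure Plane} (a b : Agent μ) : Prop :=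
  b ≠ a ∧ ∀ c : Agent μ, c ≠ a → dist a.pos b.pos ≤ dist a.pos c.pos

/-- The leader of `a` (only relevant when a closest agent exists; `a` itself otherwise). -/
def leader {μ : Measure Plane} (a : Agent μ) : Agent μ :=
  open Classical in if h : ∃ b, Follows a b then h.choose else a

/-- One step of the dynamics: all agents simultaneously move halfway to their leaders. -/
def step (μ : Measure Plane) : Measure Plane :=
  Measure.sum fun a : Agent μ => Measure.dirac (midpoint ℝ a.pos (leader a).pos)

/-- The simple counting measure with the same points as `μ`, i.e. the points of `μ` regarded
as a subset of the plane, each counted once. -/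
def simpleVersion (μ : Measure Plane) : Measure Plane :=
  Measure.sum fun x : {x : Plane // μ {x} ≠ 0} => Measure.dirac x.1

/-- The forward set of `a`: its leaders of all orders (including `a`, of order zero). -/
def forwardSet {μ : Measure Plane} (a : Agent μ) : Set (Agent μ) :=
  {b | Relation.ReflTransGen Follows a b}

/-- The backward set of `a`: its followers of all orders (including `a`, of order zero). -/
def backwardSet {μ : Measure Plane} (a : Agent μ) : Set (Agent μ) :=
  {b | Relation.ReflTransGen Follows b a}

/-- The follower graph of `μ`, as an undirected graph. -/
def followerGraph (μ : Measure Plane) : SimpleGraph (Agent μ) where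
  Adj a b := Follows a b ∨ Follows b a
  symm := ⟨fun _ _ h => h.symm⟩
  loopless := ⟨fun _ h => h.elim (fun h => h.1 rfl) (fun h => h.1 rfl)⟩

/-- The half-open unit square, which has area one. -/
def unitSquare : Set Plane := {x | ∀ i, x i ∈ Set.Ico (0 : ℝ) 1}

/-- The intensity of a stationary point process: the mean number of points in a unit square. -/
def intensity {Ω : Type*} [MeasurableSpace Ω] (P : Measure Ω) (Ψ : Ω → Measure Plane) : ℝ≥0∞ :=
  ∫⁻ ω, Ψ ω unitSquare ∂P

/-- The Palm probability of a stationary point process `Ψ` with finite positive intensity, as a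
law on counting measures: `A ↦ (1 / intensity) * 𝔼 [∫_{unitSquare} 1_A (Ψ - x) Ψ(dx)]`, where
`Ψ - x` is `Ψ` translated so that `x` moves to the origin. -/
def palm {Ω : Type*} [MeasurableSpace Ω] (P : Measure Ω) (Ψ : Ω → Measure Plane) :
    Measure (Measure Plane) :=
  (intensity P Ψ)⁻¹ • P.bind fun ω =>
    ((Ψ ω).restrict unitSquare).map fun x => (Ψ ω).map fun y => y - x

/-- All connected components of the follower graph of `Ψ` are almost surely finite. -/
def DoesNotPercolate {Ω : Type*} [MeasurableSpace Ω] (P : Measure Ω)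
    (Ψ : Ω → Measure Plane) : Prop :=
  ∀ᵐ ω ∂P, ∀ a : Agent (Ψ ω), {b | (followerGraph (Ψ ω)).Reachable a b}.Finite

/-- The Palm law of `Ψ` is a probability measure under which, almost surely, there is a point at
the origin, and (every) point at the origin has finite forward and backward sets. -/
def PalmForwardBackwardFinite {Ω : Type*} [MeasurableSpace Ω] (P : Measure Ω)
    (Ψ : Ω → Measure Plane) : Prop :=
  IsProbabilityMeasure (palm P Ψ) ∧
    ∀ᵐ μ ∂(palm P Ψ), (∃ a : Agent μ, a.pos = 0) ∧
      ∀ a : Agent μ, a.pos = 0 → (forwardSet a).Finite ∧ (backwardSet a).Finite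

end FollowerModel

end

/-!
The proof works with locations rather than agents: an agent is at the location of its leader, or its
leader is at a nearest location (`Follows.linked`), and a location carries finitely many agents. It
therefore suffices that, after one step of the dynamics, the graph that joins every location to its
nearest ones has finite components almost surely (`IsPoissonProcess.ae_finite_linked`). Passing to
the simple version does not change the locations.

Nearest locations are almost surely unique, since no point of a Poisson process lies on a sphere
determined by other points (`IsPoissonProcess.ae_dist_ne`), and a location is nearest to finitely
many others (`finite_nearest`). A graph of this kind has finite components unless it contains an
infinite forward or backward chain (`finite_component`). Along a chain the lengths of the edges are
monotone. So they either converge to some `t`, or eventually exceed any given bound.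

Both cases are excluded by a Peierls argument at a large scale `h`. Call a box of side `40 * h` bad
if one of the squares of side `h` in or around it is empty, or if two midpoints of pairs of points
in or around it are at distance approximately `t`. In a box that is not bad each location of the
next step is within `2 * h` of the two points of which it is the midpoint, so badness controls all
locations in the box while it depends on a bounded window of the Poisson process only. The
probability of an empty square is small if `h` is large. The probability of a resonance at `t` is
small if the tolerance is small, because no two midpoints are at distance exactly `t`. Hence
clusters of bad boxes are finite (`ae_finite_cluster`, `IsPoissonProcess.exists_scale`). A chain
with edge lengths converging to `t` eventually visits bad boxes only
(`IsPoissonProcess.mem_badEvent_of_dist`), and a chain with edges longer than `27 * h` crosses bad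
boxes only, since such edges run through regions with too few locations
(`IsPoissonProcess.reflTransGen_of_far`). Either way the chain stays in one cluster and cannot be
infinite. The limit `t` depends on the realisation, but by compactness of `[0, 27 * h]` finitely
many values of `t` with their tolerances suffice (`IsPoissonProcess.false_of_chain`).

For the Palm law, the dynamics and the Palm map are expressed through an s-finite kernel that sends
every locally finite measure to itself (`selfKernel`), which makes them measurable. Finiteness of
the component of the origin follows from a measurable condition: a union of finitely many small
squares that contains the origin is joined to its complement by no edge (`originIsolated`). The
intensity is finite because points can only move to the unit square from a distance comparable to
that of the nearest points around the square (`IsPoissonProcess.intensity_step_ne_top`), and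
positive because two isolated points in the square may merge there
(`IsPoissonProcess.exists_step_unitSquare_ne_zero`).
-/

noncomputable section

namespace FollowerModel

open Set

/-! ### Discrete measures and the counts of a Poisson process -/

/-- The locations of a measure: the points carrying mass. -/
def atoms (μ : Measure Plane) : Set Plane := {x | μ {x} ≠ 0}

/-- A measure is discrete if it is finite on bounded sets and lives on atoms of mass at least one.
Both conditions are measurable in the measure, and they hold for locally finite counting
measures. -/
structure IsDiscrete (μ : Measure Plane) : Prop where
  ball_lt_top : ∀ n : ℕ, μ (Metric.ball 0 n) < ∞
  ae_one_le : ∀ᵐ x ∂μ, 1 ≤ μ {x}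

lemma mem_atoms {μ : Measure Plane} {x : Plane} : x ∈ atoms μ ↔ μ {x} ≠ 0 := Iff.rfl

lemma isDiscrete_sum_dirac {ι : Type*} [Countable ι] (x : ι → Plane)
    (h : ∀ n : ℕ, (Measure.sum fun i => Measure.dirac (x i)) (Metric.ball 0 n) < ∞) :
    IsDiscrete (Measure.sum fun i => Measure.dirac (x i)) := by
  refine ⟨h, ?_⟩
  rw [Measure.ae_sum_iff]
  intro i
  rw [ae_dirac_eq, Filter.eventually_pure, Measure.sum_apply _ (measurableSet_singleton _)]
  refine le_trans ?_ (ENNReal.le_tsum i)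
  simp

lemma IsCountingMeasure.isDiscrete {μ : Measure Plane} (h : IsCountingMeasure μ) :
    IsDiscrete μ := by
  obtain ⟨h1, ι, _, x, rfl⟩ := h
  refine isDiscrete_sum_dirac x fun n => ?_
  exact (measure_mono Metric.ball_subset_closedBall).trans_lt
    (isCompact_closedBall (0 : Plane) n).measure_lt_top

namespace IsDiscrete
variable {μ : Measure Plane}

lemma measure_lt_top (h : IsDiscrete μ) {B : Set Plane} (hB : Bornology.IsBounded B) :
    μ B < ∞ := by
  obtain ⟨r, hr⟩ := hB.subset_ball 0
  obtain ⟨n, hn⟩ := exists_nat_ge r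
  exact (measure_mono (hr.trans (Metric.ball_subset_ball hn))).trans_lt (h.ball_lt_top n)

lemma one_le (h : IsDiscrete μ) {x : Plane} (hx : x ∈ atoms μ) : 1 ≤ μ {x} := by
  by_contra h'
  exact hx (measure_mono_null (by simpa using h') (ae_iff.1 h.ae_one_le))

lemma ae_mem_atoms (h : IsDiscrete μ) : ∀ᵐ x ∂μ, x ∈ atoms μ := by
  filter_upwards [h.ae_one_le] with x hx
  exact (zero_lt_one.trans_le hx).ne'

lemma exists_atom (h : IsDiscrete μ) {B : Set Plane} (hB : μ B ≠ 0) : ∃ x ∈ B, x ∈ atoms μ := by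
  by_contra! h'
  exact hB (measure_mono_null (fun x hx => h' x hx) (ae_iff.1 h.ae_mem_atoms))

lemma finite_atoms (h : IsDiscrete μ) {B : Set Plane} (hB : Bornology.IsBounded B) :
    (atoms μ ∩ B).Finite := by
  by_contra hinf
  have htop := h.measure_lt_top hB
  obtain ⟨n, hn⟩ := ENNReal.exists_nat_gt htop.ne
  obtain ⟨s, hs, hcard⟩ := (show (atoms μ ∩ B).Infinite from hinf).exists_subset_card_eq n
  have h1 : μ (s : Set Plane) ≤ μ B := measure_mono (hs.trans inter_subset_right)
  rw [← sum_measure_singleton] at h1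
  have h2 : ∑ x ∈ s, (1 : ℝ≥0∞) ≤ ∑ x ∈ s, μ {x} :=
    Finset.sum_le_sum fun x hx => h.one_le (hs hx).1
  simp only [Finset.sum_const, hcard, nsmul_eq_mul, mul_one] at h2
  exact absurd hn (not_lt.2 (h2.trans h1))

lemma countable_atoms (h : IsDiscrete μ) : (atoms μ).Countable := by
  have : atoms μ = ⋃ n : ℕ, atoms μ ∩ Metric.ball 0 n := by
    rw [← inter_iUnion, Metric.iUnion_ball_nat, inter_univ]
  rw [this]
  exact countable_iUnion fun n => (h.finite_atoms Metric.isBounded_ball).countable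

end IsDiscrete

lemma ne_zero_of_mem {μ : Measure Plane} {B : Set Plane} {x : Plane} (hx : x ∈ atoms μ)
    (hB : x ∈ B) : μ B ≠ 0 := fun h => hx (measure_mono_null (by simpa using hB) h)

/-- On sets of finite mass a counting measure takes natural values. -/
lemma IsCountingMeasure.exists_nat {μ : Measure Plane} (h : IsCountingMeasure μ) {B : Set Plane}
    (hB : MeasurableSet B) (hfin : μ B < ∞) : ∃ n : ℕ, μ B = n := by
  obtain ⟨-, ι, _, x, rfl⟩ := h
  rw [Measure.sum_apply _ hB] at hfin ⊢
  simp_rw [Measure.dirac_apply' _ hB] at hfin ⊢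
  have : ∀ i, B.indicator (1 : Plane → ℝ≥0∞) (x i) = (x ⁻¹' B).indicator 1 i := fun i => rfl
  simp_rw [this] at hfin ⊢
  rw [← tsum_subtype] at hfin ⊢
  rcases finite_or_infinite (x ⁻¹' B) with hf | hf
  · have := Fintype.ofFinite (x ⁻¹' B)
    rw [tsum_fintype]
    exact ⟨_, by simp; rfl⟩
  · exact absurd (ENNReal.tsum_const_eq_top_of_ne_zero (α := x ⁻¹' B) one_ne_zero) hfin.ne

/-- The number of points of `Φ` in `B`, as a natural number (zero if there are infinitely many). -/
def cnt {Ω : Type*} (Φ : Ω → Measure Plane) (B : Set Plane) (ω : Ω) : ℕ := ⌊(Φ ω B).toReal⌋₊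

namespace IsPoissonProcess
variable {Ω : Type*} [MeasurableSpace Ω] {P : Measure Ω} {lam : ℝ} {Φ : Ω → Measure Plane}

lemma isDiscrete (h : IsPoissonProcess P lam Φ) (ω : Ω) : IsDiscrete (Φ ω) :=
  (h.counting ω).isDiscrete

lemma coe_cnt (h : IsPoissonProcess P lam Φ) {B : Set Plane} (hB : MeasurableSet B)
    (hb : Bornology.IsBounded B) (ω : Ω) : (cnt Φ B ω : ℝ≥0∞) = Φ ω B := by
  obtain ⟨n, hn⟩ := (h.counting ω).exists_nat hB ((h.isDiscrete ω).measure_lt_top hb)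
  simp [cnt, hn]

lemma measurable_cnt (h : IsPoissonProcess P lam Φ) {B : Set Plane} (hB : MeasurableSet B) :
    Measurable (cnt Φ B) :=
  Nat.measurable_floor.comp (((Measure.measurable_coe hB).comp h.measurable).ennreal_toReal)

/-- The Poisson point probabilities of the number of points in `B`. -/
def pois (lam : ℝ) (B : Set Plane) (m : ℕ) : ℝ≥0∞ :=
  ENNReal.ofReal ((lam * volume.real B) ^ m / (Nat.factorial m : ℝ) *
        Real.exp (-(lam * volume.real B)))

lemma prob_cnt_eq (h : IsPoissonProcess P lam Φ) {ι : Type*} [Fintype ι] (B : ι → Set Plane)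
    (hB : ∀ i, MeasurableSet (B i)) (hb : ∀ i, Bornology.IsBounded (B i))
    (hd : Pairwise (fun i i' => Disjoint (B i) (B i'))) (m : ι → ℕ) :
    P {ω | ∀ i, cnt Φ (B i) ω = m i} = ∏ i, pois lam (B i) (m i) := by
  have e := Fintype.equivFin ι
  have := h.finite_dim (Fintype.card ι) (fun j => B (e.symm j)) (fun j => m (e.symm j))
    (fun j => hB _) (fun j => (hb _).measure_lt_top)
    (fun i j hij => hd (e.symm.injective.ne hij))
  rw [← Equiv.prod_comp e.symm]
  simp only [pois]
  rw [← this]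
  congr 1
  ext ω
  simp only [mem_ofPred_eq]
  rw [← e.symm.forall_congr_right]
  refine forall_congr' fun j => ?_
  rw [← h.coe_cnt (hB _) (hb _)]
  exact Nat.cast_inj.symm

lemma prob_cnt_eq_one (h : IsPoissonProcess P lam Φ) {B : Set Plane}
    (hB : MeasurableSet B) (hb : Bornology.IsBounded B) (m : ℕ) :
    P {ω | cnt Φ B ω = m} = pois lam B m := by
  have := h.prob_cnt_eq (ι := Unit) (fun _ => B) (fun _ => hB) (fun _ => hb)
    (fun i j hij => absurd rfl hij) (fun _ => m)
  simpa using this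

/-- Block independence: the count vectors of disjoint finite families of disjoint bounded sets are
independent. -/
lemma iIndepFun_cnt (h : IsPoissonProcess P lam Φ) [IsProbabilityMeasure P] {S J : Type*}
    [Fintype S] [Fintype J]
    (B : S → J → Set Plane)
    (hB : ∀ z j, MeasurableSet (B z j)) (hb : ∀ z j, Bornology.IsBounded (B z j))
    (hd : Pairwise (fun p q : S × J => Disjoint (B p.1 p.2) (B q.1 q.2))) :
    ProbabilityTheory.iIndepFun (fun z ω (j : J) => cnt Φ (B z j) ω) P := by
  have hm : ∀ z, Measurable (fun ω (j : J) => cnt Φ (B z j) ω) :=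
    fun z => measurable_pi_lambda _ fun j => h.measurable_cnt (hB z j)
  rw [ProbabilityTheory.iIndepFun_iff_map_fun_eq_pi_map fun z => (hm z).aemeasurable]
  refine Measure.ext_of_singleton fun m => ?_
  rw [Measure.pi_singleton, Measure.map_apply (measurable_pi_lambda _ hm)
    (measurableSet_singleton _)]
  have h1 := h.prob_cnt_eq (ι := S × J) (fun p => B p.1 p.2) (fun p => hB _ _) (fun p => hb _ _)
    hd (fun p => m p.1 p.2)
  rw [Fintype.prod_prod_type] at h1
  have h2 : ∀ z, P.map (fun ω (j : J) => cnt Φ (B z j) ω) {m z}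
      = ∏ j, pois lam (B z j) (m z j) := by
    intro z
    rw [Measure.map_apply (hm z) (measurableSet_singleton _)]
    rw [← h.prob_cnt_eq (B z) (hB z) (hb z) (fun j j' hjj => hd (i := (z, j)) (j := (z, j'))
      (by simpa using hjj))]
    congr 1
    ext ω
    simp [funext_iff]
  simp_rw [h2, ← h1]
  congr 1
  ext ω
  simp [funext_iff]

lemma iIndepFun_cnt' (h : IsPoissonProcess P lam Φ) [IsProbabilityMeasure P] {S : Type*}
    [Fintype S] (B : S → Set Plane) (hB : ∀ z, MeasurableSet (B z))
    (hb : ∀ z, Bornology.IsBounded (B z))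
    (hd : Pairwise (fun p q : S => Disjoint (B p) (B q))) :
    ProbabilityTheory.iIndepFun (fun z => cnt Φ (B z)) P := by
  have := h.iIndepFun_cnt (J := Unit) (fun z _ => B z) (fun z _ => hB z) (fun z _ => hb z)
    (fun p q hpq => hd (fun h => hpq (by ext; exact h)))
  exact this.comp (fun _ v => v ()) (fun _ => measurable_pi_apply _)

lemma prob_eq_zero (h : IsPoissonProcess P lam Φ) {B : Set Plane}
    (hB : MeasurableSet B) (hb : Bornology.IsBounded B) :
    P {ω | Φ ω B = 0} = ENNReal.ofReal (Real.exp (-(lam * volume.real B))) := by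
  have := h.prob_cnt_eq_one hB hb 0
  simp only [pois, pow_zero, Nat.factorial_zero, Nat.cast_one, div_one, one_mul] at this
  rw [← this]
  congr 1
  ext ω
  simp [← h.coe_cnt hB hb]

lemma prob_ne_zero_le (h : IsPoissonProcess P lam Φ) [IsProbabilityMeasure P]
    {B : Set Plane} (hB : MeasurableSet B) (hb : Bornology.IsBounded B) :
    P {ω | cnt Φ B ω ≠ 0} ≤ ENNReal.ofReal (lam * volume.real B) := by
  have h1 := h.prob_cnt_eq_one hB hb 0
  have h2 : {ω | cnt Φ B ω ≠ 0} = {ω | cnt Φ B ω = 0}ᶜ := rfl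
  have m0 : MeasurableSet {ω | cnt Φ B ω = 0} := h.measurable_cnt hB (measurableSet_singleton 0)
  rw [h2, prob_compl_eq_one_sub m0, h1]
  simp only [pois, pow_zero, Nat.factorial_zero, Nat.cast_one, div_one, one_mul]
  rw [← ENNReal.ofReal_one, ← ENNReal.ofReal_sub _ (Real.exp_pos _).le]
  refine ENNReal.ofReal_le_ofReal ?_
  have := Real.add_one_le_exp (-(lam * volume.real B))
  linarith

lemma prob_two_le (h : IsPoissonProcess P lam Φ) [IsProbabilityMeasure P] (hlam : 0 ≤ lam)
    {B : Set Plane} (hB : MeasurableSet B) (hb : Bornology.IsBounded B) :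
    P {ω | 2 ≤ cnt Φ B ω} ≤ ENNReal.ofReal ((lam * volume.real B) ^ 2) := by
  have h0 := h.prob_cnt_eq_one hB hb 0
  have h1 := h.prob_cnt_eq_one hB hb 1
  have hx : 0 ≤ lam * volume.real B := mul_nonneg hlam measureReal_nonneg
  have h2 : {ω | 2 ≤ cnt Φ B ω} = ({ω | cnt Φ B ω = 0} ∪ {ω | cnt Φ B ω = 1})ᶜ := by
    ext ω; simp only [mem_ofPred_eq, mem_compl_iff, mem_union]; omega
  have m0 : MeasurableSet {ω | cnt Φ B ω = 0} := h.measurable_cnt hB (measurableSet_singleton 0)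
  have m1 : MeasurableSet {ω | cnt Φ B ω = 1} := h.measurable_cnt hB (measurableSet_singleton 1)
  rw [h2, prob_compl_eq_one_sub (m0.union m1), measure_union _ m1, h0, h1]
  · simp only [pois, pow_zero, Nat.factorial_zero, Nat.cast_one, div_one, one_mul, pow_one,
      Nat.factorial_one]
    rw [← ENNReal.ofReal_one, ← ENNReal.ofReal_add (Real.exp_pos _).le (by positivity),
      ← ENNReal.ofReal_sub _ (by positivity)]
    refine ENNReal.ofReal_le_ofReal ?_
    have := Real.add_one_le_exp (-(lam * volume.real B))
    nlinarith
  · exact disjoint_left.2 fun ω (h1 : _ = 0) (h2 : _ = 1) => by omega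

lemma lintegral_eq (h : IsPoissonProcess P lam Φ) (hlam : 0 ≤ lam)
    {B : Set Plane} (hB : MeasurableSet B) (hb : Bornology.IsBounded B) :
    ∫⁻ ω, cnt Φ B ω ∂P = ENNReal.ofReal (lam * volume.real B) := by
  have hx : 0 ≤ lam * volume.real B := mul_nonneg hlam measureReal_nonneg
  rw [← lintegral_map (f := fun n : ℕ => (n : ℝ≥0∞)) (measurable_of_countable _)
    (h.measurable_cnt hB), lintegral_countable']
  have h1 : ∀ m, P.map (cnt Φ B) {m} = pois lam B m := fun m => by
    rw [Measure.map_apply (h.measurable_cnt hB) (measurableSet_singleton _)]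
    exact h.prob_cnt_eq_one hB hb m
  simp_rw [h1, pois]
  set x := lam * volume.real B
  have h2 : ∀ m : ℕ, (m : ℝ≥0∞) * ENNReal.ofReal (x ^ m / (Nat.factorial m : ℝ) * Real.exp (-x))
      = ENNReal.ofReal (m * (x ^ m / (Nat.factorial m : ℝ) * Real.exp (-x))) := fun m => by
    rw [ENNReal.ofReal_mul (p := (m : ℝ)) (by positivity), ENNReal.ofReal_natCast]
  simp_rw [h2]
  have h3 : HasSum (fun m : ℕ => (m : ℝ) * (x ^ m / (Nat.factorial m : ℝ) * Real.exp (-x))) x := by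
    rw [← hasSum_nat_add_iff' 1]
    have := (NormedSpace.expSeries_div_hasSum_exp (𝔸 := ℝ) x).mul_left (x * Real.exp (-x))
    have e1 : x * Real.exp (-x) * NormedSpace.exp x = x - ∑ i ∈ Finset.range 1,
        (i : ℝ) * (x ^ i / (Nat.factorial i : ℝ) * Real.exp (-x)) := by
      rw [← Real.exp_eq_exp_ℝ, mul_assoc, ← Real.exp_add]; simp
    rw [e1] at this
    have e2 : (fun m : ℕ => ((m + 1 : ℕ) : ℝ) *
        (x ^ (m + 1) / (Nat.factorial (m + 1) : ℝ) * Real.exp (-x))) =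
        fun m : ℕ => x * Real.exp (-x) * (x ^ m / (Nat.factorial m : ℝ)) := by
      funext m
      rw [Nat.factorial_succ]
      push_cast
      field_simp
      ring
    rw [e2]
    exact this
  rw [← ENNReal.ofReal_tsum_of_nonneg (fun m => by positivity) h3.summable, h3.tsum_eq]

end IsPoissonProcess

/-! ### Grid squares and null relations between Poisson points -/

lemma abs_sub_le_dist (x y : Plane) (i : Fin 2) : |x i - y i| ≤ dist x y := by
  rw [dist_eq_norm]
  exact PiLp.norm_apply_le (x - y) i

lemma dist_le_add_abs (x y : Plane) : dist x y ≤ |x 0 - y 0| + |x 1 - y 1| := by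
  rw [EuclideanSpace.dist_eq, Real.sqrt_le_left (by positivity)]
  simp only [Fin.sum_univ_two, Real.dist_eq]
  nlinarith [abs_nonneg (x 0 - y 0), abs_nonneg (x 1 - y 1)]

/-- The index of the grid square of side `s` containing `x`. -/
def idx (s : ℝ) (x : Plane) : Fin 2 → ℤ := fun i => ⌊x i / s⌋

/-- The grid square of side `s` with index `k`. -/
def cell (s : ℝ) (k : Fin 2 → ℤ) : Set Plane := {x | idx s x = k}

lemma mem_cell {s : ℝ} {k : Fin 2 → ℤ} {x : Plane} : x ∈ cell s k ↔ idx s x = k := Iff.rfl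

lemma mem_cell_iff {s : ℝ} (hs : 0 < s) {k : Fin 2 → ℤ} {x : Plane} :
    x ∈ cell s k ↔ ∀ i, s * k i ≤ x i ∧ x i < s * (k i + 1) := by
  rw [mem_cell, funext_iff]
  refine forall_congr' fun i => ?_
  rw [idx, Int.floor_eq_iff, le_div_iff₀ hs, div_lt_iff₀ hs, mul_comm s, mul_comm s]

lemma measurable_idx (s : ℝ) : Measurable (idx s) := by
  unfold idx
  refine measurable_pi_lambda _ fun i => Int.measurable_floor.comp ?_
  exact ((EuclideanSpace.proj (𝕜 := ℝ) i).continuous.measurable).div_const s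

lemma measurableSet_cell (s : ℝ) (k : Fin 2 → ℤ) : MeasurableSet (cell s k) :=
  measurable_idx s (measurableSet_singleton k)

lemma disjoint_cell {s : ℝ} {k l : Fin 2 → ℤ} (h : k ≠ l) : Disjoint (cell s k) (cell s l) :=
  disjoint_left.2 fun _ hk hl => h (hk.symm.trans hl)

lemma dist_le_of_mem_cell {s : ℝ} (hs : 0 < s) {k : Fin 2 → ℤ} {x y : Plane} (hx : x ∈ cell s k)
    (hy : y ∈ cell s k) : dist x y ≤ 2 * s := by
  rw [mem_cell_iff hs] at hx hy
  refine (dist_le_add_abs x y).trans ?_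
  have h : ∀ i, |x i - y i| ≤ s := fun i => by
    rw [abs_le]; constructor <;> nlinarith [hx i, hy i]
  linarith [h 0, h 1]

lemma isBounded_cell {s : ℝ} (hs : 0 < s) (k : Fin 2 → ℤ) : Bornology.IsBounded (cell s k) :=
  Metric.isBounded_iff.2 ⟨2 * s, fun _ hx _ hy => dist_le_of_mem_cell hs hx hy⟩

lemma volume_real_cell {s : ℝ} (hs : 0 < s) (k : Fin 2 → ℤ) : volume.real (cell s k) = s ^ 2 := by
  have h1 : cell s k = (WithLp.ofLp : Plane → Fin 2 → ℝ) ⁻¹'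
      (Set.univ.pi fun i => Ico (s * k i) (s * (k i + 1))) := by
    ext x
    rw [mem_cell_iff hs]
    simp
  rw [measureReal_def, h1, (PiLp.volume_preserving_ofLp (Fin 2)).measure_preimage
    (MeasurableSet.univ_pi fun i => measurableSet_Ico).nullMeasurableSet, volume_pi_pi]
  simp only [Real.volume_Ico, Fin.prod_univ_two]
  rw [← ENNReal.ofReal_mul (by nlinarith), ENNReal.toReal_ofReal]
  · ring
  · ring_nf; positivity

lemma idx_eq_of_mul {s : ℝ} {l : ℕ} (x : Plane) (i : Fin 2) :
    idx (s * l) x i = idx s x i / l := by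
  simp only [idx]
  rw [← div_div, Int.floor_div_natCast]

lemma exists_idx_ne {ι : Type*} [Finite ι] {f : ι → Plane} (hf : Function.Injective f) (c : ℝ)
    (hc : 0 < c) : ∀ᶠ n : ℕ in Filter.atTop, Function.Injective fun i => idx (c / n) (f i) := by
  have h : ∀ i j : ι, i ≠ j → ∀ᶠ n : ℕ in Filter.atTop, idx (c / n) (f i) ≠ idx (c / n) (f j) := by
    intro i j hij
    have hd : 0 < dist (f i) (f j) := dist_pos.2 (hf.ne hij)
    have ht : Filter.Tendsto (fun n : ℕ => 2 * (c / n)) Filter.atTop (nhds (2 * 0)) :=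
      (tendsto_const_div_atTop_nhds_zero_nat c).const_mul 2
    rw [mul_zero] at ht
    filter_upwards [ht.eventually_lt_const hd, Filter.eventually_gt_atTop 0] with n hn hn0 h
    have := dist_le_of_mem_cell (s := c / n) (by positivity) (x := f i) (y := f j) h rfl
    linarith
  have h2 : ∀ᶠ n : ℕ in Filter.atTop, ∀ i j : ι, i ≠ j → idx (c / n) (f i) ≠ idx (c / n) (f j) := by
    simp only [Filter.eventually_all]
    exact h
  filter_upwards [h2] with n hn i j hij
  by_contra h
  exact hn i j h hij

namespace IsPoissonProcess
variable {Ω : Type*} [MeasurableSpace Ω] {P : Measure Ω} {lam : ℝ} {Φ : Ω → Measure Plane}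

lemma prob_forall_ne_zero_le (h : IsPoissonProcess P lam Φ) [IsProbabilityMeasure P] {S : Type*}
    [Fintype S] (B : S → Set Plane) (hB : ∀ z, MeasurableSet (B z))
    (hb : ∀ z, Bornology.IsBounded (B z))
    (hd : Pairwise (fun p q : S => Disjoint (B p) (B q))) :
    P {ω | ∀ z, cnt Φ (B z) ω ≠ 0} ≤ ∏ z, ENNReal.ofReal (lam * volume.real (B z)) := by
  have h1 := (h.iIndepFun_cnt' B hB hb hd).measure_inter_preimage_eq_mul Finset.univ
    (sets := fun _ => {0}ᶜ) (fun _ _ => (measurableSet_singleton 0).compl)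
  have h2 : {ω | ∀ z, cnt Φ (B z) ω ≠ 0} = ⋂ i ∈ Finset.univ, cnt Φ (B i) ⁻¹' {0}ᶜ := by
    ext ω; simp
  rw [h2, h1]
  exact Finset.prod_le_prod' fun z _ => h.prob_ne_zero_le (hB z) (hb z)

/-- Distinct points of a Poisson process almost surely avoid a given Lebesgue-null relation: a null
set is covered by boxes of arbitrarily small total volume, and by independence the process has a
point in every side of a box with probability at most a constant times its volume. -/
lemma ae_notMem_of_null (h : IsPoissonProcess P lam Φ) [IsProbabilityMeasure P] (hlam : 0 < lam)
    {ι : Type*} [Fintype ι] {N : Set (ι → Plane)} (hN : volume N = 0) :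
    ∀ᵐ ω ∂P, ∀ f : ι → Plane, Function.Injective f → (∀ i, f i ∈ atoms (Φ ω)) → f ∉ N := by
  have key : ∀ Q : ι → Set Plane, (∀ i, MeasurableSet (Q i)) → (∀ i, Bornology.IsBounded (Q i)) →
      Pairwise (fun p q : ι => Disjoint (Q p) (Q q)) →
      ∀ᵐ ω ∂P, ∀ f : ι → Plane, (∀ i, f i ∈ Q i) → (∀ i, f i ∈ atoms (Φ ω)) → f ∉ N := by
    intro Q hQ hQb hQd
    set C : ℝ≥0∞ := ENNReal.ofReal lam ^ Fintype.card ι with hC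
    have hC0 : C ≠ 0 := by simp [hC, hlam]
    have hCt : C ≠ ∞ := by simp [hC]
    rw [ae_iff]
    by_contra hne
    have hpi : OuterMeasure.pi (fun _ : ι => (volume : Measure Plane).toOuterMeasure) N = 0 := by
      refine le_antisymm ?_ zero_le
      rw [← hN, volume_pi, Measure.pi_def]
      exact le_toMeasure_apply _ _ _
    rw [OuterMeasure.pi, OuterMeasure.boundedBy_apply] at hpi
    set p := P {a | ¬∀ f : ι → Plane, (∀ i, f i ∈ Q i) → (∀ i, f i ∈ atoms (Φ a)) → f ∉ N} with hp
    have hlt : (0 : ℝ≥0∞) < p / C := ENNReal.div_pos hne hCt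
    rw [← hpi, iInf_lt_iff] at hlt
    obtain ⟨t, ht⟩ := hlt
    rw [iInf_lt_iff] at ht
    obtain ⟨hNt, ht⟩ := ht
    have hle : p ≤ ∑' n, C * ⨆ (_ : (t n).Nonempty),
        piPremeasure (fun _ : ι => (volume : Measure Plane).toOuterMeasure) (t n) := by
      have hsub : {a | ¬∀ f : ι → Plane, (∀ i, f i ∈ Q i) → (∀ i, f i ∈ atoms (Φ a)) → f ∉ N} ⊆
          ⋃ n, {ω | (t n).Nonempty ∧ ∀ i, cnt Φ (Q i ∩ toMeasurable volume
            (Function.eval i '' t n)) ω ≠ 0} := by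
        intro ω hω
        simp only [mem_ofPred_eq, not_forall, not_not] at hω
        obtain ⟨f, hfQ, hfa, hfN⟩ := hω
        obtain ⟨n, hn⟩ := mem_iUnion.1 (hNt hfN)
        refine mem_iUnion.2 ⟨n, ⟨f, hn⟩, fun i h0 => ?_⟩
        have hB := (hQ i).inter (measurableSet_toMeasurable volume (Function.eval i '' t n))
        have := h.coe_cnt hB ((hQb i).subset inter_subset_left) ω
        rw [h0, Nat.cast_zero] at this
        have hmem : f i ∈ Q i ∩ toMeasurable volume (Function.eval i '' t n) :=
          ⟨hfQ i, subset_toMeasurable _ _ (mem_image_of_mem _ hn)⟩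
        exact ne_zero_of_mem (hfa i) hmem this.symm
      refine (measure_mono hsub).trans ((measure_iUnion_le _).trans
        (ENNReal.tsum_le_tsum fun n => ?_))
      by_cases hne : (t n).Nonempty
      · simp only [hne, true_and, iSup_pos]
        refine (h.prob_forall_ne_zero_le _ (fun i => (hQ i).inter (measurableSet_toMeasurable _ _))
          (fun i => (hQb i).subset inter_subset_left)
          (fun i j hij => (hQd hij).mono inter_subset_left inter_subset_left)).trans ?_
        rw [hC, piPremeasure, ← Finset.card_univ, ← Finset.prod_const, ← Finset.prod_mul_distrib]
        refine Finset.prod_le_prod' fun i _ => ?_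
        rw [ENNReal.ofReal_mul hlam.le]
        gcongr
        refine ENNReal.ofReal_toReal_le.trans ((measure_mono inter_subset_right).trans ?_)
        rw [measure_toMeasurable]
        rfl
      · simp [hne]
    rw [ENNReal.tsum_mul_left] at hle
    have := (ENNReal.lt_div_iff_mul_lt (Or.inl hC0) (Or.inl hCt)).1 ht
    rw [mul_comm] at this
    exact absurd hle (not_le.2 this)
  have key2 : ∀ (n : ℕ) (K : ι → Fin 2 → ℤ), Function.Injective K → ∀ᵐ ω ∂P, 0 < n →
      ∀ f : ι → Plane, (∀ i, f i ∈ cell (1 / n) (K i)) → (∀ i, f i ∈ atoms (Φ ω)) → f ∉ N := by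
    intro n K hK
    rcases Nat.eq_zero_or_pos n with rfl | hn
    · simp
    have hn' : (0 : ℝ) < 1 / n := by positivity
    filter_upwards [key (fun i => cell (1 / n) (K i)) (fun i => measurableSet_cell _ _)
      (fun i => isBounded_cell hn' _) (fun i j hij => disjoint_cell (hK.ne hij))] with ω hω _
    using hω
  simp_rw [← Filter.eventually_imp_distrib_left] at key2
  have key3 := ae_all_iff.2 fun n => ae_all_iff.2 (key2 n)
  filter_upwards [key3] with ω hω f hf hfa
  obtain ⟨n, hn, hn0⟩ := ((exists_idx_ne hf 1 one_pos).and (Filter.eventually_gt_atTop 0)).exists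
  exact hω n _ hn hn0 f (fun i => rfl) hfa

/-- Almost surely no point of the process lies on a sphere determined by other points of it. -/
lemma ae_dist_ne (h : IsPoissonProcess P lam Φ) [IsProbabilityMeasure P] (hlam : 0 < lam)
    {m : ℕ} {c : (Fin m → Plane) → Plane} {r : (Fin m → Plane) → ℝ} (hc : Measurable c)
    (hr : Measurable r) :
    ∀ᵐ ω ∂P, ∀ p ∈ atoms (Φ ω), ∀ q : Fin m → Plane, (∀ i, q i ∈ atoms (Φ ω)) → (∀ i, q i ≠ p) →
      dist p (c q) ≠ r q := by
  -- The points `q i` may coincide; the pattern of coincidences is a map `σ`.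
  have key : ∀ (k : ℕ) (σ : Fin m → Fin k), ∀ᵐ ω ∂P, ∀ g : Fin (k + 1) → Plane,
      Function.Injective g → (∀ i, g i ∈ atoms (Φ ω)) →
      g ∉ {g | dist (g 0) (c fun i => g (σ i).succ) = r fun i => g (σ i).succ} := by
    intro k σ
    refine h.ae_notMem_of_null hlam ?_
    have e := volume_preserving_piFinSuccAbove (fun _ : Fin (k + 1) => Plane) 0
    have h1 : MeasurableSet {a : Plane × (Fin k → Plane) |
        dist a.1 (c fun i => a.2 (σ i)) = r fun i => a.2 (σ i)} := by
      have hm : Measurable fun a : Plane × (Fin k → Plane) =>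
          (fun i => a.2 (σ i) : Fin m → Plane) :=
        measurable_pi_lambda _ fun i => (measurable_pi_apply _).comp measurable_snd
      exact measurableSet_eq_fun (measurable_fst.dist (hc.comp hm)) (hr.comp hm)
    have h2 : {g : Fin (k + 1) → Plane | dist (g 0) (c fun i => g (σ i).succ)
        = r fun i => g (σ i).succ} = (MeasurableEquiv.piFinSuccAbove (fun _ => Plane) 0) ⁻¹'
        {a : Plane × (Fin k → Plane) | dist a.1 (c fun i => a.2 (σ i)) = r fun i => a.2 (σ i)} := by
      ext g
      simp [MeasurableEquiv.piFinSuccAbove, Fin.tail]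
    rw [h2, e.measure_preimage h1.nullMeasurableSet, Measure.volume_eq_prod,
      Measure.prod_apply_symm h1]
    refine (lintegral_congr fun g => ?_).trans lintegral_zero
    exact Measure.addHaar_sphere volume (c fun i => g (σ i)) (r fun i => g (σ i))
  filter_upwards [ae_all_iff.2 fun k => ae_all_iff.2 (key k)] with ω hω p hp q hq hqp
  obtain ⟨k, ⟨e⟩⟩ := Finite.exists_equiv_fin (range q)
  have hσ := hω k (fun i => e ⟨q i, mem_range_self i⟩) (Fin.cons p fun j => (e.symm j).1) ?_ ?_
  · simpa using hσ
  · rw [Fin.cons_injective_iff]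
    refine ⟨?_, fun a b hab => e.symm.injective (Subtype.ext hab)⟩
    rintro ⟨j, hj⟩
    obtain ⟨i, hi⟩ := (e.symm j).2
    exact hqp i (hi.trans hj)
  · intro i
    refine Fin.cases hp (fun j => ?_) i
    obtain ⟨i, hi⟩ := (e.symm j).2
    simpa [← hi] using hq i

end IsPoissonProcess

/-! ### Simplicity and distinctness of distances in a Poisson process -/

/-- The indices of the `l ^ 2` squares of side `s` that make up square `k` of side `s * l`. -/
def fine (l : ℕ) (k : Fin 2 → ℤ) : Finset (Fin 2 → ℤ) :=
  Finset.Icc (fun i => l * k i) (fun i => l * k i + (l - 1))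

lemma mem_fine {l : ℕ} (hl : 0 < l) {k j : Fin 2 → ℤ} : j ∈ fine l k ↔ ∀ i, j i / l = k i := by
  have hl' : (0 : ℤ) < l := by exact_mod_cast hl
  simp only [fine, Finset.mem_Icc, Pi.le_def, ← forall_and]
  refine forall_congr' fun i => ?_
  rw [Int.ediv_eq_iff_of_pos hl']
  constructor
  · rintro ⟨h1, h2⟩; constructor <;> nlinarith
  · rintro ⟨h1, h2⟩; constructor <;> nlinarith

lemma card_fine (l : ℕ) (k : Fin 2 → ℤ) : (fine l k).card = l ^ 2 := by
  rw [fine, Pi.card_Icc]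
  simp only [Int.card_Icc, Fin.prod_univ_two]
  have : ∀ a : ℤ, (a + (l - 1) + 1 - a).toNat = l := fun a => by omega
  rw [this, this, sq]

lemma idx_mem_fine {s : ℝ} {l : ℕ} (hl : 0 < l) (x : Plane) :
    idx s x ∈ fine l (idx (s * l) x) :=
  (mem_fine hl).2 fun i => (idx_eq_of_mul x i).symm

/-- The unordered pairs `{x, x'}` and `{y, y'}` differ. -/
def PairNe {α : Type*} (x x' y y' : α) : Prop := ¬(x = y ∧ x' = y') ∧ ¬(x = y' ∧ x' = y)

/-- Of two distinct pairs of distinct elements, one has an element outside the other. -/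
lemma PairNe.exists_notMem {α : Type*} {x x' y y' : α} (h : PairNe x x' y y') (hx : x ≠ x') :
    (x ≠ y ∧ x ≠ y') ∨ (x' ≠ y ∧ x' ≠ y') := by
  unfold PairNe at h
  grind

namespace IsPoissonProcess
variable {Ω : Type*} [MeasurableSpace Ω] {P : Measure Ω} {lam : ℝ} {Φ : Ω → Measure Plane}

/-- A Poisson process has no multiple points. -/
lemma ae_simple (h : IsPoissonProcess P lam Φ) [IsProbabilityMeasure P] (hlam : 0 < lam) :
    ∀ᵐ ω ∂P, ∀ x, Φ ω {x} ≤ 1 := by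
  have key : ∀ k : Fin 2 → ℤ, ∀ᵐ ω ∂P, ∀ x ∈ cell 1 k, Φ ω {x} ≤ 1 := by
    intro k
    rw [ae_iff]
    have hle : ∀ n : ℕ, 0 < n → P {ω | ¬∀ x ∈ cell 1 k, Φ ω {x} ≤ 1} ≤
        ENNReal.ofReal (lam ^ 2 / n ^ 2) := by
      intro n hn
      have hn' : (0 : ℝ) < 1 / n := by positivity
      have hn0 : (n : ℝ) ≠ 0 := by positivity
      have hsub : {ω | ¬∀ x ∈ cell 1 k, Φ ω {x} ≤ 1} ⊆
          ⋃ j ∈ fine n k, {ω | 2 ≤ cnt Φ (cell (1 / n) j) ω} := by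
        intro ω hω
        simp only [mem_ofPred_eq, not_forall, not_le] at hω
        obtain ⟨x, hx, h1⟩ := hω
        have hxf := idx_mem_fine (s := 1 / n) hn x
        rw [one_div_mul_cancel hn0, mem_cell.1 hx] at hxf
        refine mem_iUnion₂.2 ⟨_, hxf, ?_⟩
        have h2 := h1.trans_le (measure_mono (μ := Φ ω) (t := cell (1 / n) (idx (1 / n) x))
          (singleton_subset_iff.2 rfl))
        rw [← h.coe_cnt (measurableSet_cell _ _) (isBounded_cell hn' _)] at h2
        have : 1 < cnt Φ (cell (1 / n) (idx (1 / n) x)) ω := by exact_mod_cast h2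
        exact this
      refine (measure_mono hsub).trans ((measure_biUnion_finset_le _ _).trans ?_)
      refine (Finset.sum_le_sum fun j _ => h.prob_two_le hlam.le (measurableSet_cell _ _)
        (isBounded_cell hn' _)).trans ?_
      simp only [volume_real_cell hn', Finset.sum_const, card_fine]
      rw [← ENNReal.ofReal_nsmul]
      refine ENNReal.ofReal_le_ofReal (le_of_eq ?_)
      simp only [nsmul_eq_mul]
      push_cast
      field_simp
    have ht : Filter.Tendsto (fun n : ℕ => ENNReal.ofReal (lam ^ 2 / n ^ 2)) Filter.atTop
        (nhds 0) := by
      rw [← ENNReal.ofReal_zero]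
      refine ENNReal.tendsto_ofReal ?_
      have := (tendsto_const_div_atTop_nhds_zero_nat lam).pow 2
      simpa [div_pow] using this
    refine le_antisymm (ge_of_tendsto ht ?_) zero_le
    filter_upwards [Filter.eventually_gt_atTop 0] with n hn using hle n hn
  filter_upwards [ae_all_iff.2 key] with ω hω x using hω _ x rfl

lemma ae_exists_cell_ne_zero (h : IsPoissonProcess P lam Φ) (hlam : 0 < lam) (k : Fin 2 → ℤ) :
    ∀ᵐ ω ∂P, ∃ n : ℕ, 0 < n ∧ Φ ω (cell n k) ≠ 0 := by
  rw [ae_iff]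
  have ht : Filter.Tendsto (fun n : ℕ => ENNReal.ofReal (Real.exp (-(lam * (n : ℝ) ^ 2))))
      Filter.atTop (nhds 0) := by
    rw [← ENNReal.ofReal_zero]
    refine ENNReal.tendsto_ofReal (Real.tendsto_exp_neg_atTop_nhds_zero.comp ?_)
    exact ((Filter.tendsto_pow_atTop two_ne_zero).comp tendsto_natCast_atTop_atTop).const_mul_atTop
      hlam
  refine le_antisymm (ge_of_tendsto ht ?_) zero_le
  filter_upwards [Filter.eventually_gt_atTop 0] with n hn
  have hn' : (0 : ℝ) < n := by positivity
  rw [← volume_real_cell hn' k, ← h.prob_eq_zero (measurableSet_cell _ k) (isBounded_cell hn' k)]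
  refine measure_mono fun ω hω => ?_
  simp only [mem_ofPred_eq, not_exists, not_and, not_not] at hω
  exact hω n hn

lemma ae_exists_atoms (h : IsPoissonProcess P lam Φ) (hlam : 0 < lam) :
    ∀ᵐ ω ∂P, ∃ x ∈ atoms (Φ ω), ∃ y ∈ atoms (Φ ω), x ≠ y := by
  filter_upwards [h.ae_exists_cell_ne_zero hlam 0, h.ae_exists_cell_ne_zero hlam (-1)] with ω h1 h2
  obtain ⟨n, hn, hn0⟩ := h1
  obtain ⟨m, hm, hm0⟩ := h2
  obtain ⟨x, hx, hxa⟩ := (h.isDiscrete ω).exists_atom hn0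
  obtain ⟨y, hy, hya⟩ := (h.isDiscrete ω).exists_atom hm0
  refine ⟨x, hxa, y, hya, ?_⟩
  rintro rfl
  have e1 := (mem_cell_iff (by positivity)).1 hx 0
  have e2 := (mem_cell_iff (by positivity)).1 hy 0
  simp at e1 e2
  linarith

lemma ae_dist_ne_dist (h : IsPoissonProcess P lam Φ) [IsProbabilityMeasure P] (hlam : 0 < lam) :
    ∀ᵐ ω ∂P, ∀ x ∈ atoms (Φ ω), ∀ y ∈ atoms (Φ ω), ∀ z ∈ atoms (Φ ω), y ≠ x → y ≠ z →
      dist x y ≠ dist x z := by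
  filter_upwards [h.ae_dist_ne hlam (m := 2) (c := fun q => q 0) (r := fun q => dist (q 0) (q 1))
    (by fun_prop) (by fun_prop)] with ω hω x hx y hy z hz hyx hyz
  have := hω y hy ![x, z] (by simp [Fin.forall_fin_two, hx, hz])
    (by simp [Fin.forall_fin_two, hyx.symm, hyz.symm])
  simpa [dist_comm] using this

/-- For a fixed `t`, almost surely no two distinct pairs of points have midpoints at distance
exactly `t`. -/
lemma ae_norm_ne (h : IsPoissonProcess P lam Φ) [IsProbabilityMeasure P] (hlam : 0 < lam) (t : ℝ) :
    ∀ᵐ ω ∂P, ∀ x ∈ atoms (Φ ω), ∀ x' ∈ atoms (Φ ω), ∀ y ∈ atoms (Φ ω), ∀ y' ∈ atoms (Φ ω),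
      x ≠ x' → PairNe x x' y y' → ‖x + x' - y - y'‖ ≠ t := by
  filter_upwards [h.ae_dist_ne hlam (m := 3) (c := fun q => q 1 + q 2 - q 0) (r := fun _ => t)
    (by fun_prop) (by fun_prop)] with ω hω
  have key : ∀ x ∈ atoms (Φ ω), ∀ x' ∈ atoms (Φ ω), ∀ y ∈ atoms (Φ ω), ∀ y' ∈ atoms (Φ ω),
      x ≠ x' → x ≠ y → x ≠ y' → ‖x + x' - y - y'‖ ≠ t := by
    intro x hx x' hx' y hy y' hy' h1 h2 h3
    have := hω x hx ![x', y, y'] (by simp [Fin.forall_fin_succ, hx', hy, hy'])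
      (by simp [Fin.forall_fin_succ, h1.symm, h2.symm, h3.symm])
    rw [dist_eq_norm] at this
    convert this using 2
    congr 1
    simp
    abel
  intro x hx x' hx' y hy y' hy' hxx hp
  rcases hp.exists_notMem hxx with h1 | h1
  · exact key x hx x' hx' y hy y' hy' hxx h1.1 h1.2
  · rw [add_comm x x']
    exact key x' hx' x hx y hy y' hy' hxx.symm h1.1 h1.2

/-- Almost surely, the midpoint of a pair of points is never equidistant from the midpoints of two
other pairs. -/
lemma ae_norm_ne_norm (h : IsPoissonProcess P lam Φ) [IsProbabilityMeasure P] (hlam : 0 < lam) :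
    ∀ᵐ ω ∂P, ∀ x ∈ atoms (Φ ω), ∀ x' ∈ atoms (Φ ω), ∀ y ∈ atoms (Φ ω), ∀ y' ∈ atoms (Φ ω),
      ∀ z ∈ atoms (Φ ω), ∀ z' ∈ atoms (Φ ω), x ≠ x' → y ≠ y' → PairNe y y' z z' →
        ‖x + x' - y - y'‖ ≠ ‖x + x' - z - z'‖ := by
  filter_upwards [h.ae_dist_ne hlam (m := 5) (c := fun q => q 0 + q 1 - q 2)
      (r := fun q => ‖q 0 + q 1 - q 3 - q 4‖) (by fun_prop) (by fun_prop),
    h.ae_dist_ne hlam (m := 4) (c := fun q => q 2 + q 3 - q 0)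
      (r := fun q => ‖q 0 - q 1‖) (by fun_prop) (by fun_prop)] with ω h5 h4
  -- `y` lies in neither `{x, x'}` nor `{z, z'}`
  have k5 : ∀ x ∈ atoms (Φ ω), ∀ x' ∈ atoms (Φ ω), ∀ y ∈ atoms (Φ ω), ∀ y' ∈ atoms (Φ ω),
      ∀ z ∈ atoms (Φ ω), ∀ z' ∈ atoms (Φ ω), y ≠ y' → y ≠ z → y ≠ z' → y ≠ x → y ≠ x' →
        ‖x + x' - y - y'‖ ≠ ‖x + x' - z - z'‖ := by
    intro x hx x' hx' y hy y' hy' z hz z' hz' e1 e2 e3 e4 e5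
    have := h5 y hy ![x, x', y', z, z'] (by simp [Fin.forall_fin_succ, *])
      (by simp [Fin.forall_fin_succ, e1.symm, e2.symm, e3.symm, e4.symm, e5.symm])
    rw [dist_comm, dist_eq_norm] at this
    rw [sub_right_comm]
    exact this
  -- `y = x` is not in `{z, z'}`
  have k4 : ∀ x' ∈ atoms (Φ ω), ∀ y ∈ atoms (Φ ω), ∀ y' ∈ atoms (Φ ω),
      ∀ z ∈ atoms (Φ ω), ∀ z' ∈ atoms (Φ ω), y ≠ y' → y ≠ z → y ≠ z' → y ≠ x' →
        ‖y + x' - y - y'‖ ≠ ‖y + x' - z - z'‖ := by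
    intro x' hx' y hy y' hy' z hz z' hz' e1 e2 e3 e5
    have := h4 y hy ![x', y', z, z'] (by simp [Fin.forall_fin_succ, *])
      (by simp [Fin.forall_fin_succ, e1.symm, e2.symm, e3.symm, e5.symm])
    rw [dist_eq_norm] at this
    rw [show y + x' - y - y' = x' - y' by abel, show y + x' - z - z' = y - (z + z' - x') by abel]
    exact this.symm
  have k : ∀ x ∈ atoms (Φ ω), ∀ x' ∈ atoms (Φ ω), ∀ y ∈ atoms (Φ ω), ∀ y' ∈ atoms (Φ ω),
      ∀ z ∈ atoms (Φ ω), ∀ z' ∈ atoms (Φ ω), x ≠ x' → y ≠ y' → y ≠ z → y ≠ z' →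
        ‖x + x' - y - y'‖ ≠ ‖x + x' - z - z'‖ := by
    intro x hx x' hx' y hy y' hy' z hz z' hz' e0 e1 e2 e3
    by_cases e4 : y = x
    · subst e4
      exact k4 x' hx' y hy y' hy' z hz z' hz' e1 e2 e3 e0
    by_cases e5 : y = x'
    · subst e5
      rw [add_comm x y]
      exact k4 x hx y hy y' hy' z hz z' hz' e1 e2 e3 e4
    exact k5 x hx x' hx' y hy y' hy' z hz z' hz' e1 e2 e3 e4 e5
  intro x hx x' hx' y hy y' hy' z hz z' hz' hxx hyy hp
  rcases hp.exists_notMem hyy with h1 | h1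
  · exact k x hx x' hx' y hy y' hy' z hz z' hz' hxx hyy h1.1 h1.2
  · rw [sub_right_comm]
    exact k x hx x' hx' y' hy' y hy z hz z' hz' hxx hyy.symm h1.1 h1.2

end IsPoissonProcess

/-! ### Chains in directed graphs and clusters of bad sites -/

/-- König's lemma for directed graphs with finite out-degrees. Following only edges that lead one
generation further away from `a` keeps the chain from visiting a vertex twice. -/
lemma exists_injective_chain {α : Type*} {r : α → α → Prop} (hfin : ∀ a, {b | r a b}.Finite) {a : α}
    (hinf : {b | Relation.ReflTransGen r a b}.Infinite) :
    ∃ c : ℕ → α, c 0 = a ∧ Function.Injective c ∧ ∀ n, r (c n) (c (n + 1)) := by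
  let S : ℕ → Set α := fun n => Nat.rec {a} (fun _ T => {b | ∃ x ∈ T, r x b}) n
  have hS : ∀ n b, b ∈ S (n + 1) ↔ ∃ x ∈ S n, r x b := fun n b => Iff.rfl
  let L : α → ℕ := fun b => sInf {n | b ∈ S n}
  let r' : α → α → Prop := fun x y => r x y ∧ L y = L x + 1
  have hmem : ∀ b, Relation.ReflTransGen r a b → ∃ n, b ∈ S n := by
    intro b hb
    induction hb with
    | refl => exact ⟨0, rfl⟩
    | tail _ h ih =>
      obtain ⟨n, hn⟩ := ih
      exact ⟨n + 1, (hS _ _).2 ⟨_, hn, h⟩⟩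
  have hlev : ∀ n b, b ∈ S n → L b = n → Relation.ReflTransGen r' a b := by
    intro n
    induction n with
    | zero => intro b hb _; rw [show b = a from hb]
    | succ n ih =>
      intro b hb hL
      obtain ⟨x, hx, hr⟩ := (hS _ _).1 hb
      have h1 : L x ≤ n := Nat.sInf_le hx
      have h2 : x ∈ S (L x) := Nat.sInf_mem (s := {n | x ∈ S n}) ⟨n, hx⟩
      have h3 : L b ≤ L x + 1 := Nat.sInf_le ((hS _ _).2 ⟨x, h2, hr⟩)
      have h4 : L x = n := by omega
      exact (ih x hx h4).tail ⟨hr, by omega⟩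
  have hinf' : {b | Relation.ReflTransGen r' a b}.Infinite := by
    refine hinf.mono fun b hb => ?_
    have h2 : b ∈ S (L b) := Nat.sInf_mem (s := {n | b ∈ S n}) (hmem b hb)
    exact hlev _ b h2 rfl
  have hstep : ∀ c : {c // {b | Relation.ReflTransGen r' c b}.Infinite},
      ∃ c' : {c // {b | Relation.ReflTransGen r' c b}.Infinite}, r' c.1 c'.1 := by
    rintro ⟨c, hc⟩
    by_contra! hno
    refine hc (((finite_singleton c).union (((hfin c).subset
      (fun b (hb : r' c b) => hb.1)).biUnion (t := fun c' => {b | Relation.ReflTransGen r' c' b})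
      fun c' hc' => ?_)).subset ?_)
    · by_contra hi
      exact hno ⟨c', hi⟩ hc'
    · intro b hb
      rcases Relation.ReflTransGen.cases_head hb with rfl | ⟨c', h1, h2⟩
      · exact Or.inl rfl
      · exact Or.inr (mem_biUnion (show c' ∈ {b | r' c b} from h1) h2)
  choose next hnext using hstep
  let c : ℕ → {c // {b | Relation.ReflTransGen r' c b}.Infinite} :=
    fun n => Nat.rec ⟨a, hinf'⟩ (fun _ x => next x) n
  have hc : ∀ n, r' (c n).1 (c (n + 1)).1 := fun n => hnext (c n)
  refine ⟨fun n => (c n).1, rfl, ?_, fun n => (hc n).1⟩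
  have hmono : StrictMono fun n => L (c n).1 :=
    strictMono_nat_of_lt_succ fun n => by rw [(hc n).2]; exact Nat.lt_succ_self _
  exact fun m n hmn => hmono.injective (congrArg L hmn)

/-- A graph given by a partial function (every vertex has at most one out-neighbour) with finite
in-degrees, and with no infinite chain in either direction, has finite components: a component
consists of the backward sets of the finitely many vertices on a forward orbit. -/
lemma finite_component {α : Type*} {r : α → α → Prop} (huniq : ∀ a b b', r a b → r a b' → b = b')
    (hback : ∀ b, {a | r a b}.Finite)
    (hf : ¬∃ c : ℕ → α, Function.Injective c ∧ ∀ n, r (c n) (c (n + 1)))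
    (hb : ¬∃ c : ℕ → α, Function.Injective c ∧ ∀ n, r (c (n + 1)) (c n)) (a : α) :
    {b | Relation.ReflTransGen (fun x y => r x y ∨ r y x) a b}.Finite := by
  have hfwd : {b | Relation.ReflTransGen r a b}.Finite := by
    by_contra hi
    obtain ⟨c, -, hc⟩ := exists_injective_chain (fun x => Set.Subsingleton.finite
      fun b hb b' hb' => huniq x b b' hb hb') hi
    exact hf ⟨c, hc⟩
  have hbwd : ∀ c, {b | Relation.ReflTransGen r b c}.Finite := by
    intro c
    by_contra hi
    have : {b | Relation.ReflTransGen (Function.swap r) c b}.Infinite := by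
      intro hfin
      simp only [Relation.reflTransGen_swap] at hfin
      exact hi hfin
    obtain ⟨c, -, hc⟩ := exists_injective_chain (r := Function.swap r) hback this
    exact hb ⟨c, hc⟩
  refine (hfwd.biUnion (t := fun c => {b | Relation.ReflTransGen r b c})
    fun c _ => hbwd c).subset fun b hab => ?_
  induction hab with
  | refl => exact mem_iUnion₂.2 ⟨a, .refl, .refl⟩
  | @tail b b' _ h ih =>
    obtain ⟨c, hc, hbc⟩ := mem_iUnion₂.1 ih
    rcases h with h | h
    · rcases Relation.ReflTransGen.cases_head hbc with rfl | ⟨d, h1, h2⟩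
      · exact mem_iUnion₂.2 ⟨b', .tail hc h, .refl⟩
      · rw [huniq b d b' h1 h] at h2
        exact mem_iUnion₂.2 ⟨c, hc, h2⟩
    · exact mem_iUnion₂.2 ⟨c, hc, .head h hbc⟩

/-- A step of length at most one (in the sup norm) between bad sites of the lattice. -/
def BadStep (b : (Fin 2 → ℤ) → Prop) (z z' : Fin 2 → ℤ) : Prop :=
  b z ∧ b z' ∧ ∀ i, |z' i - z i| ≤ 1

lemma finite_badStep (b : (Fin 2 → ℤ) → Prop) (z : Fin 2 → ℤ) : {z' | BadStep b z z'}.Finite := by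
  refine (Set.finite_Icc (z - 1) (z + 1)).subset fun z' hz' => ?_
  constructor <;> intro i <;> have := abs_le.1 (hz'.2.2 i) <;> simp <;> linarith

/-- The lattice paths of length `n` from `z`, as lists of sites with the last site first. -/
def latticePaths (z : Fin 2 → ℤ) : ℕ → Finset (List (Fin 2 → ℤ))
  | 0 => {[z]}
  | n + 1 => (latticePaths z n).biUnion fun L =>
      (Finset.Icc (-1 : Fin 2 → ℤ) 1).image fun d => (L.headI + d) :: L

lemma card_latticePaths (z : Fin 2 → ℤ) (n : ℕ) : (latticePaths z n).card ≤ 9 ^ n := by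
  induction n with
  | zero => simp [latticePaths]
  | succ n ih =>
    rw [latticePaths, pow_succ]
    refine (Finset.card_biUnion_le_card_mul _ _ 9 fun L _ => ?_).trans (Nat.mul_le_mul_right 9 ih)
    refine Finset.card_image_le.trans ?_
    rw [Pi.card_Icc]
    simp

lemma length_of_mem_latticePaths {z : Fin 2 → ℤ} {n : ℕ} {L : List (Fin 2 → ℤ)}
    (h : L ∈ latticePaths z n) : L.length = n + 1 := by
  induction n generalizing L with
  | zero => simp only [latticePaths, Finset.mem_singleton] at h; simp [h]
  | succ n ih =>
    simp only [latticePaths, Finset.mem_biUnion, Finset.mem_image] at h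
    obtain ⟨L', hL', d, -, rfl⟩ := h
    simp [ih hL']

lemma exists_latticePath {c : ℕ → Fin 2 → ℤ} (hc : Function.Injective c)
    (h : ∀ n i, |c (n + 1) i - c n i| ≤ 1) (n : ℕ) :
    ∃ L ∈ latticePaths (c 0) n, L.headI = c n ∧ L.Nodup ∧ ∀ z ∈ L, ∃ m ≤ n, z = c m := by
  induction n with
  | zero => exact ⟨[c 0], by simp [latticePaths], rfl, by simp, by simp⟩
  | succ n ih =>
    obtain ⟨L, hL, hh, hn, hm⟩ := ih
    refine ⟨c (n + 1) :: L, ?_, rfl, ?_, ?_⟩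
    · simp only [latticePaths, Finset.mem_biUnion, Finset.mem_image]
      refine ⟨L, hL, c (n + 1) - c n, ?_, by rw [hh, add_sub_cancel]⟩
      rw [Finset.mem_Icc]
      constructor <;> intro i <;> have := abs_le.1 (h n i) <;> simp <;> linarith
    · refine List.nodup_cons.2 ⟨fun hmem => ?_, hn⟩
      obtain ⟨m, hm', e⟩ := hm _ hmem
      have := hc e
      omega
    · intro z hz
      rcases List.mem_cons.1 hz with rfl | hz
      · exact ⟨n + 1, le_rfl, rfl⟩
      · obtain ⟨m, h1, h2⟩ := hm z hz
        exact ⟨m, by omega, h2⟩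

/-- **Peierls argument.** If sites congruent modulo `3` are bad independently, with small
probability, then almost surely all clusters of bad sites are finite. There are at most `9 ^ n`
paths of length `n`, and at least a ninth of the sites of a path are congruent modulo `3`. -/
lemma ae_finite_cluster {Ω : Type*} [MeasurableSpace Ω] {P : Measure Ω}
    (bad : (Fin 2 → ℤ) → Set Ω) (p : ℝ≥0∞) (hp : 9 ^ 9 * p ≤ 1 / 2)
    (h : ∀ S : Finset (Fin 2 → ℤ), (∀ z ∈ S, ∀ z' ∈ S, ∀ i, (3 : ℤ) ∣ z i - z' i) →
      P (⋂ z ∈ S, bad z) ≤ p ^ S.card) :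
    ∀ᵐ ω ∂P, ∀ z, {z' | Relation.ReflTransGen (BadStep fun z => ω ∈ bad z) z z'}.Finite := by
  have hp1 : p ≤ 1 := by
    calc p = 1 * p := (one_mul p).symm
      _ ≤ 9 ^ 9 * p := by gcongr; norm_num
      _ ≤ 1 / 2 := hp
      _ ≤ 1 := by simp
  rw [ae_all_iff]
  intro z
  rw [ae_iff]
  have hpath : ∀ (k : ℕ), ∀ L ∈ latticePaths z (9 * k), L.Nodup →
      P (⋂ z ∈ L.toFinset, bad z) ≤ p ^ k := by
    intro k L hL hn
    have hcard : (Finset.univ : Finset (Fin 2 → ZMod 3)).card * k < L.toFinset.card := by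
      rw [List.toFinset_card_of_nodup hn, length_of_mem_latticePaths hL]
      simp
    obtain ⟨y, -, hy⟩ := Finset.exists_lt_card_fiber_of_mul_lt_card_of_maps_to
      (f := fun (z : Fin 2 → ℤ) i => (z i : ZMod 3)) (fun z _ => Finset.mem_univ _) hcard
    set S := {x ∈ L.toFinset | (fun i => ((x i : ℤ) : ZMod 3)) = y} with hS
    have hsub : (⋂ z ∈ L.toFinset, bad z) ⊆ ⋂ z ∈ S, bad z :=
      biInter_subset_biInter_left fun z hz => (Finset.mem_filter.1 hz).1
    refine (measure_mono hsub).trans ((h S fun z hz z' hz' i => ?_).trans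
      (pow_le_pow_right_of_le_one' hp1 hy.le))
    have e := (Finset.mem_filter.1 hz).2.trans (Finset.mem_filter.1 hz').2.symm
    have := congrFun e i
    exact (ZMod.intCast_eq_intCast_iff_dvd_sub _ _ 3).1 this.symm
  have hle : ∀ k : ℕ, P {ω | ¬{z' | Relation.ReflTransGen
      (BadStep fun z => ω ∈ bad z) z z'}.Finite} ≤ (1 / 2) ^ k := by
    intro k
    have hsub : {ω | ¬{z' | Relation.ReflTransGen (BadStep fun z => ω ∈ bad z) z z'}.Finite} ⊆
        ⋃ L ∈ (latticePaths z (9 * k)).filter List.Nodup, ⋂ z ∈ L.toFinset, bad z := by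
      intro ω hω
      obtain ⟨c, rfl, hc, hb⟩ := exists_injective_chain (finite_badStep _) hω
      obtain ⟨L, hL, -, hn, hm⟩ := exists_latticePath hc (fun n => (hb n).2.2) (9 * k)
      refine mem_iUnion₂.2 ⟨L, Finset.mem_filter.2 ⟨hL, hn⟩, mem_iInter₂.2 fun z hz => ?_⟩
      obtain ⟨m, -, rfl⟩ := hm z (List.mem_toFinset.1 hz)
      exact (hb m).1
    refine (measure_mono hsub).trans ((measure_biUnion_finset_le _ _).trans ?_)
    refine (Finset.sum_le_sum fun L hL => hpath k L (Finset.mem_filter.1 hL).1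
      (Finset.mem_filter.1 hL).2).trans ?_
    rw [Finset.sum_const, nsmul_eq_mul]
    calc ((Finset.filter List.Nodup (latticePaths z (9 * k))).card : ℝ≥0∞) * p ^ k
        ≤ (9 ^ (9 * k) : ℕ) * p ^ k := by
          gcongr
          exact (Finset.card_filter_le _ _).trans (card_latticePaths _ _)
      _ = (9 ^ 9 * p) ^ k := by push_cast; rw [pow_mul, mul_pow]
      _ ≤ (1 / 2) ^ k := by gcongr
  refine le_antisymm (ge_of_tendsto' (ENNReal.tendsto_pow_atTop_nhds_zero_of_lt_one ?_) hle)
    zero_le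
  simp

/-! ### Bad boxes -/

/-- The lower left corner of the grid square `cell s k`. -/
def corner (s : ℝ) (k : Fin 2 → ℤ) : Plane := WithLp.toLp 2 fun i => s * k i

lemma norm_sub_corner_le {s : ℝ} (hs : 0 < s) {k : Fin 2 → ℤ} {x : Plane} (hx : x ∈ cell s k) :
    ‖x - corner s k‖ ≤ 2 * s := by
  rw [← dist_eq_norm]
  refine dist_le_of_mem_cell hs hx ((mem_cell_iff hs).2 fun i => ?_)
  simp only [corner]
  constructor <;> nlinarith

lemma norm_add_sub_corner_le {s : ℝ} (hs : 0 < s) {w j₁ j₂ j₃ j₄ : Fin 2 → ℤ} {x₁ x₂ x₃ x₄ : Plane}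
    (h₁ : x₁ ∈ cell s (w + j₁)) (h₂ : x₂ ∈ cell s (w + j₂)) (h₃ : x₃ ∈ cell s (w + j₃))
    (h₄ : x₄ ∈ cell s (w + j₄)) :
    |‖x₁ + x₂ - x₃ - x₄‖ - ‖corner s j₁ + corner s j₂ - corner s j₃ - corner s j₄‖| ≤ 8 * s := by
  refine (abs_norm_sub_norm_le _ _).trans ?_
  have hadd : ∀ j, corner s (w + j) = corner s w + corner s j := fun j => by
    ext i; simp [corner]; ring
  have e : x₁ + x₂ - x₃ - x₄ - (corner s j₁ + corner s j₂ - corner s j₃ - corner s j₄) =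
      ((x₁ - corner s (w + j₁)) + (x₂ - corner s (w + j₂))) -
        ((x₃ - corner s (w + j₃)) + (x₄ - corner s (w + j₄))) := by
    simp only [hadd]; abel
  rw [e]
  have a₁ := norm_sub_corner_le hs h₁
  have a₂ := norm_sub_corner_le hs h₂
  have a₃ := norm_sub_corner_le hs h₃
  have a₄ := norm_sub_corner_le hs h₄
  refine (norm_sub_le _ _).trans ?_
  have b₁ := norm_add_le (x₁ - corner s (w + j₁)) (x₂ - corner s (w + j₂))
  have b₂ := norm_add_le (x₃ - corner s (w + j₃)) (x₄ - corner s (w + j₄))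
  linarith

/-- The relative indices of the fine squares in the window of a box. Lengths are measured in
coarse squares, which have side `h`: a box has side `40`, and its window consists of the box and its
eight neighbours. A coarse square is divided into `l ^ 2` fine squares. -/
def window (l : ℕ) : Finset (Fin 2 → ℤ) :=
  Finset.Icc (fun _ => -(40 * (l : ℤ))) (fun _ => 80 * (l : ℤ) - 1)

lemma mem_window {l : ℕ} {j : Fin 2 → ℤ} :
    j ∈ window l ↔ ∀ i, -(40 * (l : ℤ)) ≤ j i ∧ j i ≤ 80 * (l : ℤ) - 1 := by
  simp only [window, Finset.mem_Icc, Pi.le_def, forall_and]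

/-- The fine square with relative index `j` in the window of the box `z`. -/
def fineCell (h : ℝ) (l : ℕ) (z j : Fin 2 → ℤ) : Set Plane :=
  cell (h / l) ((fun i => 40 * (l : ℤ) * z i) + j)

lemma measurableSet_fineCell (h : ℝ) (l : ℕ) (z j : Fin 2 → ℤ) : MeasurableSet (fineCell h l z j) :=
  measurableSet_cell _ _

lemma isBounded_fineCell {h : ℝ} (hh : 0 < h) {l : ℕ} (hl : 0 < l) (z j : Fin 2 → ℤ) :
    Bornology.IsBounded (fineCell h l z j) :=
  isBounded_cell (by positivity) _

/-- The numbers of points in the fine squares of the window of the box `z`. -/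
def windowCount {Ω : Type*} (Φ : Ω → Measure Plane) (h : ℝ) (l : ℕ) (z : Fin 2 → ℤ) (ω : Ω)
    (j : window l) : ℕ := cnt Φ (fineCell h l z j) ω

lemma exists_coarseWindow : ∃ W : Finset (Fin 2 → ℤ),
    (∀ c, c ∈ W ↔ ∀ i, -40 ≤ c i ∧ c i ≤ 79) ∧ W.card = 14400 := by
  refine ⟨window 1, fun c => ?_, ?_⟩
  · rw [mem_window]
    norm_num
  · rw [window, Pi.card_Icc]
    simp

/-- Every coarse square of the window contains a point. -/
def IsRich (l : ℕ) (v : window l → ℕ) : Prop :=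
  ∀ c : Fin 2 → ℤ, (∀ i, -40 ≤ c i ∧ c i ≤ 79) → ∃ j : window l, (∀ i, j.1 i / l = c i) ∧ v j ≠ 0

/-- Up to the resolution of the fine grid, the window contains two pairs of points whose midpoints
are at distance `τ / 2`. Two points in one fine square also count as a resonance, so that otherwise
points correspond to occupied fine squares. The tolerance exceeds the error `8 * (h / l)` made by
replacing points by corners of fine squares. -/
def IsResonant (h τ : ℝ) (l : ℕ) (v : window l → ℕ) : Prop :=
  (∃ j, 2 ≤ v j) ∨ ∃ j₁ j₂ j₃ j₄ : window l, v j₁ ≠ 0 ∧ v j₂ ≠ 0 ∧ v j₃ ≠ 0 ∧ v j₄ ≠ 0 ∧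
    j₁ ≠ j₂ ∧ j₃ ≠ j₄ ∧ PairNe j₁ j₂ j₃ j₄ ∧
    |‖corner (h / l) j₁ + corner (h / l) j₂ - corner (h / l) j₃ - corner (h / l) j₄‖ - τ|
      < 12 * (h / l)

/-- The event that the box `z` is bad: its window has an empty coarse square, or a resonance. -/
def badEvent {Ω : Type*} (Φ : Ω → Measure Plane) (h τ : ℝ) (l : ℕ) (z : Fin 2 → ℤ) : Set Ω :=
  {ω | ¬IsRich l (windowCount Φ h l z ω) ∨ IsResonant h τ l (windowCount Φ h l z ω)}

lemma idx_fine_mem_window {h : ℝ} {l : ℕ} (hl : 0 < l) {z : Fin 2 → ℤ} {x : Plane}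
    (hx : ∀ i, 40 * z i - 40 ≤ idx h x i ∧ idx h x i ≤ 40 * z i + 79) :
    (fun i => idx (h / l) x i - 40 * (l : ℤ) * z i) ∈ window l := by
  have hl' : (0 : ℤ) < l := by exact_mod_cast hl
  have hl0 : (l : ℝ) ≠ 0 := by positivity
  rw [mem_window]
  intro i
  have e : idx h x i = idx (h / l) x i / l := by
    rw [← idx_eq_of_mul, div_mul_cancel₀ _ hl0]
  have h1 := (Int.ediv_eq_iff_of_pos hl').1 e.symm
  have := hx i
  constructor <;> nlinarith

namespace IsPoissonProcess
variable {Ω : Type*} [MeasurableSpace Ω] {P : Measure Ω} {lam : ℝ} {Φ : Ω → Measure Plane}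

lemma measurable_windowCount (hΦ : IsPoissonProcess P lam Φ) (h : ℝ) (l : ℕ) (z : Fin 2 → ℤ) :
    Measurable (windowCount Φ h l z) :=
  measurable_pi_lambda _ fun _ => hΦ.measurable_cnt (measurableSet_cell _ _)

/-- Stationarity along the lattice of boxes. -/
lemma map_windowCount_eq (hΦ : IsPoissonProcess P lam Φ) {h : ℝ} (hh : 0 < h) {l : ℕ} (hl : 0 < l)
    (z z' : Fin 2 → ℤ) : P.map (windowCount Φ h l z) = P.map (windowCount Φ h l z') := by
  have hs : 0 < h / l := by positivity
  have key : ∀ z m, P.map (windowCount Φ h l z) {m} = ∏ j, ENNReal.ofReal ((lam * (h / l) ^ 2) ^ m j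
      / (Nat.factorial (m j) : ℝ) * Real.exp (-(lam * (h / l) ^ 2))) := by
    intro z m
    rw [Measure.map_apply (hΦ.measurable_windowCount h l z) (measurableSet_singleton m)]
    have := hΦ.prob_cnt_eq (ι := window l) (fun j => fineCell h l z j)
      (fun j => measurableSet_cell _ _) (fun j => isBounded_cell hs _)
      (fun j j' hj => disjoint_cell fun e => hj (Subtype.ext (add_left_cancel e))) m
    simp only [pois, fineCell, volume_real_cell hs] at this
    rw [← this]
    congr 1
    ext ω
    simp [windowCount, funext_iff, fineCell]
  exact Measure.ext_of_singleton fun m => by rw [key, key]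

/-- Boxes whose indices are congruent modulo `3` have disjoint windows, and are therefore bad
independently. -/
lemma prob_iInter_badEvent (hΦ : IsPoissonProcess P lam Φ) [IsProbabilityMeasure P] {h : ℝ}
    (hh : 0 < h) (τ : ℝ) {l : ℕ} (hl : 0 < l) (S : Finset (Fin 2 → ℤ))
    (hS : ∀ z ∈ S, ∀ z' ∈ S, ∀ i, (3 : ℤ) ∣ z i - z' i) :
    P (⋂ z ∈ S, badEvent Φ h τ l z) = P (badEvent Φ h τ l 0) ^ S.card := by
  have hs : 0 < h / l := by positivity
  have hl' : (0 : ℤ) < l := by exact_mod_cast hl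
  have hT : MeasurableSet {v | ¬IsRich l v ∨ IsResonant h τ l v} :=
    (Set.to_countable _).measurableSet
  have h1 := (hΦ.iIndepFun_cnt (S := S) (J := window l) (fun z j => fineCell h l z j)
    (fun z j => measurableSet_cell _ _) (fun z j => isBounded_cell hs _)
    (fun p q hpq => disjoint_cell fun e => hpq ?_)).measure_inter_preimage_eq_mul Finset.univ
    (sets := fun _ => {v | ¬IsRich l v ∨ IsResonant h τ l v}) (fun _ _ => hT)
  · have h2 : (⋂ z ∈ S, badEvent Φ h τ l z) = ⋂ z ∈ (Finset.univ : Finset S),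
        (fun ω (j : window l) => cnt Φ (fineCell h l z j) ω) ⁻¹'
          {v | ¬IsRich l v ∨ IsResonant h τ l v} := by
      ext ω
      simp only [badEvent, mem_iInter, Finset.mem_univ, forall_true_left, Subtype.forall]
      rfl
    rw [h2, h1]
    have h3 : ∀ z, P (badEvent Φ h τ l z) = P (badEvent Φ h τ l 0) := by
      intro z
      have := congrArg (fun μ => μ {v | ¬IsRich l v ∨ IsResonant h τ l v})
        (hΦ.map_windowCount_eq hh hl z 0)
      simp only [Measure.map_apply (hΦ.measurable_windowCount h l _) hT] at this
      exact this
    refine (Finset.prod_congr rfl fun z _ => h3 z.1).trans ?_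
    simp
  · obtain ⟨⟨z, hz⟩, ⟨j, hj⟩⟩ := p
    obtain ⟨⟨z', hz'⟩, ⟨j', hj'⟩⟩ := q
    rw [mem_window] at hj hj'
    have hzz : z = z' := by
      funext i
      obtain ⟨q, hq⟩ := hS z hz z' hz' i
      have e1 := congrFun e i
      simp only [Pi.add_apply] at e1
      have a1 := hj i
      have a2 := hj' i
      have e2 : 120 * (l : ℤ) * q = j' i - j i := by
        have : z i = z' i + 3 * q := by linarith
        rw [this] at e1
        linarith
      have e3 : q = 0 := by
        by_contra hq0
        rcases lt_or_gt_of_ne hq0 with h | h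
        · have : q ≤ -1 := by omega
          nlinarith
        · have : 1 ≤ q := by omega
          nlinarith
      rw [e3] at hq
      linarith
    subst hzz
    simpa using e

lemma prob_not_isRich_le (hΦ : IsPoissonProcess P lam Φ) {h : ℝ}
    (hh : 0 < h) {l : ℕ} (hl : 0 < l) :
    P {ω | ¬IsRich l (windowCount Φ h l 0 ω)} ≤
      14400 * ENNReal.ofReal (Real.exp (-(lam * h ^ 2))) := by
  have hs : 0 < h / l := by positivity
  have hl' : (0 : ℤ) < l := by exact_mod_cast hl
  have hl0 : (l : ℝ) ≠ 0 := by positivity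
  obtain ⟨W, hW, hcard⟩ := exists_coarseWindow
  have hsub : {ω | ¬IsRich l (windowCount Φ h l 0 ω)} ⊆
      ⋃ c ∈ W, {ω | Φ ω (cell h c) = 0} := by
    intro ω hω
    simp only [mem_ofPred_eq, IsRich, not_forall, not_exists, not_and, not_not] at hω
    obtain ⟨c, hc, hj⟩ := hω
    rw [mem_iUnion₂]
    refine ⟨c, (hW c).2 hc, ?_⟩
    by_contra hne
    obtain ⟨x, hx, hxa⟩ := (hΦ.isDiscrete ω).exists_atom hne
    have hxc : idx h x = c := hx
    have hw := idx_fine_mem_window (h := h) hl (z := 0) (x := x) fun i => by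
      have h1 := hc i
      simp only [Pi.zero_apply, hxc]
      constructor <;> linarith
    have hf := idx_mem_fine (s := h / l) hl x
    rw [div_mul_cancel₀ _ hl0, hxc, mem_fine hl] at hf
    have h0 := hj ⟨_, hw⟩ (by simpa using hf)
    have := hΦ.coe_cnt (B := fineCell h l 0 fun i => idx (h / l) x i - 40 * (l : ℤ) * (0 : ℤ))
      (measurableSet_cell _ _) (isBounded_cell hs _) ω
    rw [windowCount] at h0
    simp only [Pi.zero_apply] at h0
    rw [h0, Nat.cast_zero] at this
    refine ne_zero_of_mem hxa ?_ this.symm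
    rw [fineCell, mem_cell]
    funext i
    simp
  refine (measure_mono hsub).trans ((measure_biUnion_finset_le _ _).trans ?_)
  simp_rw [hΦ.prob_eq_zero (measurableSet_cell _ _) (isBounded_cell hh _), volume_real_cell hh]
  rw [Finset.sum_const, hcard, nsmul_eq_mul]
  exact le_of_eq (by norm_num)

/-- Almost surely no midpoints are at distance exactly `τ / 2`; as the window holds finitely many
points, a fine enough grid sees no resonance. -/
lemma ae_eventually_not_isResonant (hΦ : IsPoissonProcess P lam Φ) [IsProbabilityMeasure P]
    (hlam : 0 < lam) {h : ℝ} (hh : 0 < h) (τ : ℝ) :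
    ∀ᵐ ω ∂P, ∀ᶠ l : ℕ in Filter.atTop, ¬IsResonant h τ l (windowCount Φ h l 0 ω) := by
  filter_upwards [hΦ.ae_norm_ne hlam τ, hΦ.ae_simple hlam] with ω hω hsimple
  have hfin := (hΦ.isDiscrete ω).finite_atoms (Metric.isBounded_closedBall (x := (0 : Plane))
    (r := 200 * h))
  set A := atoms (Φ ω) ∩ Metric.closedBall 0 (200 * h) with hA
  have : Finite A := hfin
  have ht : Filter.Tendsto (fun n : ℕ => 20 * (h / n)) Filter.atTop (nhds 0) := by
    have := (tendsto_const_div_atTop_nhds_zero_nat h).const_mul 20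
    rwa [mul_zero] at this
  have h1 : ∀ᶠ l : ℕ in Filter.atTop, ∀ x x' y y' : A, x ≠ x' → PairNe x x' y y' →
      20 * (h / l) < |‖x.1 + x' - y - y'‖ - τ| := by
    simp only [Filter.eventually_all]
    intro x x' y y' hxx hp
    refine ht.eventually_lt_const (abs_pos.2 (sub_ne_zero.2 ?_))
    refine hω x x.2.1 x' x'.2.1 y y.2.1 y' y'.2.1 (fun e => hxx (Subtype.ext e)) ?_
    exact ⟨fun e => hp.1 ⟨Subtype.ext e.1, Subtype.ext e.2⟩,
      fun e => hp.2 ⟨Subtype.ext e.1, Subtype.ext e.2⟩⟩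
  filter_upwards [h1, exists_idx_ne (f := fun x : A => x.1) Subtype.val_injective h hh,
    Filter.eventually_gt_atTop 0] with l hl1 hl2 hl
  have hs : 0 < h / l := by positivity
  have hl0 : (l : ℝ) ≠ 0 := by positivity
  have hz : ((fun i => 40 * (l : ℤ) * (0 : Fin 2 → ℤ) i) : Fin 2 → ℤ) = 0 := by
    funext i; simp
  have hcell : ∀ j : window l, ∀ x ∈ fineCell h l 0 j,
      x ∈ Metric.closedBall (0 : Plane) (200 * h) := by
    intro j x hx
    have hj := mem_window.1 j.2
    rw [fineCell, hz, zero_add, mem_cell_iff hs] at hx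
    have hb : ∀ i, |x i| ≤ 80 * h := fun i => by
      have h1 : -(40 * (l : ℝ)) ≤ (j.1 i : ℝ) := by exact_mod_cast (hj i).1
      have h2 : (j.1 i : ℝ) ≤ 80 * l - 1 := by exact_mod_cast (hj i).2
      have h3 : h / l * l = h := div_mul_cancel₀ _ hl0
      rw [abs_le]
      constructor <;> nlinarith [hx i]
    rw [Metric.mem_closedBall]
    refine (dist_le_add_abs x 0).trans ?_
    have := hb 0
    have := hb 1
    simp
    linarith
  have hatom : ∀ j : window l, windowCount Φ h l 0 ω j ≠ 0 → ∃ x : A, x.1 ∈ fineCell h l 0 j := by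
    intro j hj
    have hne : Φ ω (fineCell h l 0 j) ≠ 0 := by
      rw [← hΦ.coe_cnt (measurableSet_fineCell _ _ _ _) (isBounded_fineCell hh hl _ _)]
      exact_mod_cast hj
    obtain ⟨x, hx, hxa⟩ := (hΦ.isDiscrete ω).exists_atom hne
    exact ⟨⟨x, hxa, hcell j x hx⟩, hx⟩
  rintro (⟨j, hj⟩ | ⟨j₁, j₂, j₃, j₄, v₁, v₂, v₃, v₄, n₁₂, n₃₄, hp, hlt⟩)
  · obtain ⟨x, hx⟩ := hatom j (by omega)
    have h1 : Φ ω (fineCell h l 0 j) ≤ Φ ω {x.1} := by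
      rw [← measure_sdiff_null (s := fineCell h l 0 j) (t := fineCell h l 0 j \ {x.1})]
      · exact measure_mono fun y hy => by_contra fun hne => hy.2 ⟨hy.1, hne⟩
      · by_contra hne
        obtain ⟨y, hy, hya⟩ := (hΦ.isDiscrete ω).exists_atom hne
        have := hl2 (a₁ := ⟨y, hya, hcell j y hy.1⟩) (a₂ := x) ((mem_cell.1 hy.1).trans
          (mem_cell.1 hx).symm)
        exact hy.2 (congrArg Subtype.val this)
    have h2 := h1.trans (hsimple x)
    rw [← hΦ.coe_cnt (measurableSet_fineCell _ _ _ _) (isBounded_fineCell hh hl _ _)] at h2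
    have h3 : cnt Φ (fineCell h l 0 j) ω ≤ 1 := by exact_mod_cast h2
    have h4 : 2 ≤ cnt Φ (fineCell h l 0 j) ω := hj
    omega
  · obtain ⟨x₁, h₁⟩ := hatom j₁ v₁
    obtain ⟨x₂, h₂⟩ := hatom j₂ v₂
    obtain ⟨x₃, h₃⟩ := hatom j₃ v₃
    obtain ⟨x₄, h₄⟩ := hatom j₄ v₄
    have hne : ∀ {j j' : window l} {x x' : A}, x.1 ∈ fineCell h l 0 j → x'.1 ∈ fineCell h l 0 j' →
        x = x' → j = j' := by
      rintro j j' x _ hx hx' rfl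
      exact Subtype.ext (add_left_cancel ((mem_cell.1 hx).symm.trans (mem_cell.1 hx')))
    have hb := hl1 x₁ x₂ x₃ x₄ (fun e => n₁₂ (hne h₁ h₂ e))
      ⟨fun e => hp.1 ⟨hne h₁ h₃ e.1, hne h₂ h₄ e.2⟩, fun e => hp.2 ⟨hne h₁ h₄ e.1, hne h₂ h₃ e.2⟩⟩
    have hc := norm_add_sub_corner_le hs h₁ h₂ h₃ h₄
    rw [abs_le] at hc
    rw [abs_lt] at hlt
    rw [lt_abs] at hb
    rcases hb with hb | hb <;> linarith [hc.1, hc.2, hlt.1, hlt.2]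

/-- There is a scale `h` such that, for every `τ`, the clusters of bad boxes are almost surely
finite once the fine grid is fine enough: a large `h` makes empty coarse squares unlikely, and then
a large `l` makes resonances unlikely. -/
lemma exists_scale (hΦ : IsPoissonProcess P lam Φ) [IsProbabilityMeasure P] (hlam : 0 < lam) :
    ∃ h : ℝ, 0 < h ∧ ∀ τ : ℝ, ∃ l : ℕ, 0 < l ∧ ∀ᵐ ω ∂P, ∀ z,
      {z' | Relation.ReflTransGen (BadStep fun z => ω ∈ badEvent Φ h τ l z) z z'}.Finite := by
  set p : ℝ≥0∞ := (2 * 9 ^ 9)⁻¹ with hp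
  have hp0 : 0 < p / 2 := by
    rw [hp]; exact ENNReal.div_pos (ENNReal.inv_ne_zero.2 (by finiteness)) (by simp)
  have h1 : Filter.Tendsto (fun h : ℝ => 14400 * ENNReal.ofReal (Real.exp (-(lam * h ^ 2))))
      Filter.atTop (nhds 0) := by
    have := ENNReal.Tendsto.const_mul (a := 14400) (ENNReal.tendsto_ofReal
      (Real.tendsto_exp_neg_atTop_nhds_zero.comp
        ((Filter.tendsto_pow_atTop (α := ℝ) two_ne_zero).const_mul_atTop hlam)))
        (Or.inr (by finiteness))
    simpa using this
  obtain ⟨h, hrich, hh⟩ := ((h1.eventually_lt_const hp0).and (Filter.eventually_gt_atTop 0)).exists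
  refine ⟨h, hh, fun τ => ?_⟩
  have hm : ∀ l, MeasurableSet {ω | IsResonant h τ l (windowCount Φ h l 0 ω)} := fun l =>
    hΦ.measurable_windowCount h l 0 (Set.to_countable {v | IsResonant h τ l v}).measurableSet
  have h2 : Filter.Tendsto (fun l : ℕ => P {ω | IsResonant h τ l (windowCount Φ h l 0 ω)})
      Filter.atTop (nhds (P ∅)) := by
    refine tendsto_measure_of_ae_tendsto_indicator_of_isFiniteMeasure Filter.atTop
      MeasurableSet.empty hm ?_
    filter_upwards [hΦ.ae_eventually_not_isResonant hlam hh τ] with ω hω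
    filter_upwards [hω] with l hl
    simpa using hl
  rw [measure_empty] at h2
  obtain ⟨l, hres, hl⟩ := ((h2.eventually_lt_const hp0).and (Filter.eventually_gt_atTop 0)).exists
  refine ⟨l, hl, ae_finite_cluster _ p ?_ fun S hS => ?_⟩
  · rw [hp, ENNReal.mul_inv (by simp) (by simp), mul_comm (2 : ℝ≥0∞)⁻¹, ← mul_assoc,
      ENNReal.mul_inv_cancel (by simp) (by finiteness)]
    simp
  · rw [hΦ.prob_iInter_badEvent hh τ hl S hS]
    gcongr
    calc P (badEvent Φ h τ l 0) ≤ P {ω | ¬IsRich l (windowCount Φ h l 0 ω)} +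
          P {ω | IsResonant h τ l (windowCount Φ h l 0 ω)} := measure_union_le _ _
      _ ≤ p / 2 + p / 2 := add_le_add ((hΦ.prob_not_isRich_le hh hl).trans hrich.le) hres.le
      _ = p := ENNReal.add_halves p

end IsPoissonProcess

/-! ### Nearest locations and one step of the dynamics -/

/-- `y` is a location of `μ` closest to the location `x` among the locations other than `x`. -/
structure Nearest (μ : Measure Plane) (x y : Plane) : Prop where
  left_mem : x ∈ atoms μ
  right_mem : y ∈ atoms μ
  ne : x ≠ y
  dist_le : ∀ w ∈ atoms μ, w ≠ x → dist x y ≤ dist x w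

lemma IsDiscrete.exists_nearest {μ : Measure Plane} (h : IsDiscrete μ) {x y : Plane}
    (hx : x ∈ atoms μ) (hy : y ∈ atoms μ) (hxy : x ≠ y) : ∃ w, Nearest μ x w := by
  have hfin := (h.finite_atoms (Metric.isBounded_closedBall (x := x) (r := dist x y))).subset
    (sdiff_subset (t := {x}))
  have hy' : y ∈ (atoms μ ∩ Metric.closedBall x (dist x y)) \ {x} :=
    ⟨⟨hy, by simp [dist_comm]⟩, fun e => hxy (Eq.symm e)⟩
  obtain ⟨w, ⟨⟨hw, hwb⟩, hwx⟩, hmin⟩ := Set.exists_min_image _ (dist x) hfin ⟨y, hy'⟩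
  refine ⟨w, hx, hw, fun e => hwx (Eq.symm e), fun v hv hvx => ?_⟩
  by_cases hvb : v ∈ Metric.closedBall x (dist x y)
  · exact hmin v ⟨⟨hv, hvb⟩, hvx⟩
  · rw [Metric.mem_closedBall, dist_comm, not_le] at hvb
    exact (hmin y hy').trans hvb.le

/-- Only finitely many locations have a given location as a nearest one: as seen from it, any two
of them span an angle of at least `60` degrees. -/
lemma finite_nearest (μ : Measure Plane) (b : Plane) : {a | Nearest μ a b}.Finite := by
  by_contra hinf
  obtain ⟨u, hu_eq⟩ : ∃ u : Plane → Plane, ∀ a, u a = ‖a - b‖⁻¹ • (a - b) := ⟨_, fun _ => rfl⟩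
  have hu : ∀ a, Nearest μ a b → u a ∈ Metric.sphere (0 : Plane) 1 := fun a ha => by
    simp [hu_eq, norm_smul, sub_ne_zero.2 ha.ne]
  -- The directions in which the locations are seen from `b` are at distance at least one.
  have hsep : ∀ a a', Nearest μ a b → Nearest μ a' b → a ≠ a' → ‖a - b‖ ≤ ‖a' - b‖ →
      1 ≤ dist (u a') (u a) := by
    intro a a' ha ha' hne hle
    have hpos : 0 < ‖a - b‖ := norm_pos_iff.2 (sub_ne_zero.2 ha.ne)
    have hpos' : 0 < ‖a' - b‖ := norm_pos_iff.2 (sub_ne_zero.2 ha'.ne)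
    have h1 := ha'.dist_le a ha.left_mem hne
    rw [dist_eq_norm, dist_eq_norm] at h1
    have h2 : a' - a = (‖a' - b‖ - ‖a - b‖) • u a' + ‖a - b‖ • (u a' - u a) := by
      have e : ‖a - b‖ • u a = a - b := by
        rw [hu_eq, smul_smul, mul_inv_cancel₀ hpos.ne', one_smul]
      have e' : ‖a' - b‖ • u a' = a' - b := by
        rw [hu_eq, smul_smul, mul_inv_cancel₀ hpos'.ne', one_smul]
      rw [sub_smul, smul_sub, e, e']
      abel
    have h3 : ‖a' - a‖ ≤ (‖a' - b‖ - ‖a - b‖) + ‖a - b‖ * ‖u a' - u a‖ := by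
      rw [h2]
      refine (norm_add_le _ _).trans ?_
      rw [norm_smul, norm_smul, mem_sphere_zero_iff_norm.1 (hu a' ha'), Real.norm_of_nonneg
        (sub_nonneg.2 hle), norm_norm, mul_one]
    rw [dist_eq_norm]
    by_contra! hlt
    nlinarith
  have hsep' : ∀ a a', Nearest μ a b → Nearest μ a' b → a ≠ a' → 1 ≤ dist (u a') (u a) := by
    intro a a' ha ha' hne
    rcases le_total ‖a - b‖ ‖a' - b‖ with h | h
    · exact hsep a a' ha ha' hne h
    · rw [dist_comm]; exact hsep a' a ha' ha hne.symm h
  obtain ⟨t, ht, hcov⟩ := Metric.totallyBounded_iff.1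
    (isCompact_sphere (0 : Plane) 1).totallyBounded (1 / 2) (by norm_num)
  -- Two of infinitely many unit vectors share a ball of radius `1 / 2`.
  choose! y hyt hy using fun a (ha : Nearest μ a b) => mem_iUnion₂.1 (hcov (hu a ha))
  obtain ⟨a, ha, a', ha', hne, he⟩ := Set.Infinite.exists_ne_map_eq_of_mapsTo
    (show {a | Nearest μ a b}.Infinite from hinf) (fun a ha => hyt a ha) ht
  have h1 := hy a ha
  have h2 := hy a' ha'
  rw [Metric.mem_ball] at h1 h2
  have h3 := dist_triangle_right (u a') (u a) (y a')
  have h4 := hsep' a a' ha ha' hne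
  rw [he] at h1
  linarith

/-- No location is closer than `x` to the midpoint of `x` and its nearest location. -/
lemma Nearest.dist_midpoint_le {μ : Measure Plane} {x y p : Plane} (h : Nearest μ x y)
    (hp : p ∈ atoms μ) : dist x (midpoint ℝ x y) ≤ dist p (midpoint ℝ x y) := by
  by_contra! hlt
  have hne : p ≠ x := by rintro rfl; exact lt_irrefl _ hlt
  have h1 := h.dist_le p hp hne
  have h2 := dist_triangle_right x p (midpoint ℝ x y)
  have h3 : dist x (midpoint ℝ x y) = 2⁻¹ * dist x y := by
    rw [dist_left_midpoint]; simp
  linarith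

/-- The properties of a realisation of the Poisson process that make one step of the dynamics well
behaved: the points are simple, there are at least two of them, and nearest neighbours are
unique. -/
structure IsGeneric (μ : Measure Plane) : Prop where
  isDiscrete : IsDiscrete μ
  simple : ∀ x, μ {x} ≤ 1
  exists_ne : ∃ x ∈ atoms μ, ∃ y ∈ atoms μ, x ≠ y
  dist_ne : ∀ x ∈ atoms μ, ∀ y ∈ atoms μ, ∀ z ∈ atoms μ, y ≠ x → y ≠ z → dist x y ≠ dist x z

lemma Agent.pos_mem {μ : Measure Plane} (a : Agent μ) : a.pos ∈ atoms μ :=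
  (zero_le.trans_lt a.2).ne'

/-- The agent with number zero at a given location. -/
def Agent.mk {μ : Measure Plane} {x : Plane} (hx : x ∈ atoms μ) : Agent μ :=
  ⟨(x, 0), by simpa using pos_iff_ne_zero.2 hx⟩

lemma tsum_atoms_eq {μ : Measure Plane} (h : IsDiscrete μ) (f : Plane → ℝ≥0∞) :
    ∫⁻ x, f x ∂μ = ∑' x : atoms μ, f x * μ {x.1} := by
  rw [← lintegral_countable f h.countable_atoms, Measure.restrict_eq_self_of_ae_mem h.ae_mem_atoms]

namespace IsGeneric
variable {μ : Measure Plane}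

lemma measure_eq_one (h : IsGeneric μ) {x : Plane} (hx : x ∈ atoms μ) : μ {x} = 1 :=
  le_antisymm (h.simple x) (h.isDiscrete.one_le hx)

lemma pos_injective (h : IsGeneric μ) : Function.Injective (Agent.pos (μ := μ)) := by
  have h0 : ∀ a : Agent μ, a.1.2 = 0 := fun a => by
    have h1 : (a.1.2 : ℝ≥0∞) < 1 := a.2.trans_le (h.simple _)
    have h2 : a.1.2 < 1 := by exact_mod_cast h1
    omega
  intro a b hab
  exact Subtype.ext (Prod.ext hab ((h0 a).trans (h0 b).symm))

lemma exists_nearest (h : IsGeneric μ) {x : Plane} (hx : x ∈ atoms μ) : ∃ y, Nearest μ x y := by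
  obtain ⟨y, hy, z, hz, hyz⟩ := h.exists_ne
  by_cases hxy : x = y
  · exact h.isDiscrete.exists_nearest hx hz (hxy ▸ hyz)
  · exact h.isDiscrete.exists_nearest hx hy hxy

lemma nearest_unique (h : IsGeneric μ) {x y z : Plane} (hy : Nearest μ x y) (hz : Nearest μ x z) :
    y = z := by
  by_contra hne
  exact h.dist_ne x hy.left_mem y hy.right_mem z hz.right_mem hy.ne.symm hne
    (le_antisymm (hy.dist_le z hz.right_mem hz.ne.symm) (hz.dist_le y hy.right_mem hy.ne.symm))

lemma nearest_of_follows (h : IsGeneric μ) {a b : Agent μ} (hab : Follows a b) :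
    Nearest μ a.pos b.pos :=
  ⟨a.pos_mem, b.pos_mem, fun e => hab.1 (h.pos_injective e).symm, fun _ hw hwa =>
    hab.2 (Agent.mk hw) fun e => hwa (congrArg Agent.pos e)⟩

lemma nearest_leader (h : IsGeneric μ) (a : Agent μ) : Nearest μ a.pos (leader a).pos := by
  obtain ⟨y, hy⟩ := h.exists_nearest a.pos_mem
  have hex : ∃ b, Follows a b := by
    refine ⟨Agent.mk hy.right_mem, fun e => hy.ne (congrArg Agent.pos e).symm, fun c hc => ?_⟩
    exact hy.dist_le _ c.pos_mem fun e => hc (h.pos_injective e)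
  rw [leader, dif_pos hex]
  exact h.nearest_of_follows hex.choose_spec

/-- The agents of a simple measure are its locations. -/
def agentEquiv (h : IsGeneric μ) : Agent μ ≃ atoms μ where
  toFun a := ⟨a.pos, a.pos_mem⟩
  invFun x := Agent.mk x.2
  left_inv _ := h.pos_injective rfl
  right_inv _ := rfl

lemma countable_agent (h : IsGeneric μ) : Countable (Agent μ) :=
  have := h.isDiscrete.countable_atoms.to_subtype
  h.agentEquiv.injective.countable

lemma tsum_agent_eq (h : IsGeneric μ) (f : Plane → ℝ≥0∞) :
    ∑' a : Agent μ, f a.pos = ∫⁻ x, f x ∂μ := by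
  rw [tsum_atoms_eq h.isDiscrete, ← h.agentEquiv.tsum_eq]
  refine tsum_congr fun a => ?_
  rw [h.measure_eq_one (h.agentEquiv a).2, mul_one]
  rfl

lemma step_apply (μ : Measure Plane) {B : Set Plane} (hB : MeasurableSet B) : step μ B =
    ∑' a : Agent μ, B.indicator 1 (midpoint ℝ a.pos (leader a).pos) := by
  rw [step, Measure.sum_apply _ hB]
  simp_rw [Measure.dirac_apply' _ hB]

/-- If only points of `B'` move into `B`, then `B` contains after the step at most as many points as
`B'` before it. -/
lemma step_le (h : IsGeneric μ) {B B' : Set Plane} (hB : MeasurableSet B) (hB' : MeasurableSet B')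
    (hBB : ∀ x y, Nearest μ x y → midpoint ℝ x y ∈ B → x ∈ B') : step μ B ≤ μ B' := by
  rw [step_apply _ hB, ← lintegral_indicator_one hB', ← h.tsum_agent_eq]
  refine ENNReal.tsum_le_tsum fun a => ?_
  by_cases hm : midpoint ℝ a.pos (leader a).pos ∈ B
  · rw [indicator_of_mem hm, indicator_of_mem (hBB _ _ (h.nearest_leader a) hm)]
    rfl
  · rw [indicator_of_notMem hm]
    exact zero_le

lemma mem_atoms_step (h : IsGeneric μ) {m : Plane} :
    m ∈ atoms (step μ) ↔ ∃ x y, Nearest μ x y ∧ m = midpoint ℝ x y := by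
  rw [mem_atoms, step_apply _ (measurableSet_singleton m), ne_eq, ENNReal.tsum_eq_zero, not_forall]
  simp only [indicator_apply_eq_zero, mem_singleton_iff, Pi.one_apply, one_ne_zero, imp_false,
    not_not]
  constructor
  · rintro ⟨a, ha⟩
    exact ⟨_, _, h.nearest_leader a, ha.symm⟩
  · rintro ⟨x, y, hxy, rfl⟩
    refine ⟨Agent.mk hxy.left_mem, ?_⟩
    have e := h.nearest_unique hxy (h.nearest_leader (Agent.mk hxy.left_mem))
    exact congrArg (midpoint ℝ x) e.symm

/-- A point that moves into a ball around the origin is not further from its new position than any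
fixed point `p` of the process, so that the ball receives finitely many points. -/
lemma isDiscrete_step (h : IsGeneric μ) : IsDiscrete (step μ) := by
  have := h.countable_agent
  refine isDiscrete_sum_dirac _ fun n => ?_
  obtain ⟨p, hp, -⟩ := h.exists_ne
  refine (h.step_le Metric.isOpen_ball.measurableSet Metric.isOpen_ball.measurableSet
    (B' := Metric.ball 0 (dist p 0 + 2 * n)) fun x y hxy hm => ?_).trans_lt
    (h.isDiscrete.measure_lt_top Metric.isBounded_ball)
  rw [Metric.mem_ball] at hm ⊢
  have h1 := hxy.dist_midpoint_le hp
  have h2 := dist_triangle x (midpoint ℝ x y) 0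
  have h3 := dist_triangle_right p (midpoint ℝ x y) 0
  linarith

end IsGeneric

/-! ### Edges between locations of the next step -/

lemma abs_idx_sub_le {s : ℝ} (hs : 0 < s) {p q : Plane} {i : Fin 2} {c : ℕ}
    (h : |p i - q i| ≤ c * s) : |idx s p i - idx s q i| ≤ c := by
  rw [abs_le] at h
  have h1 : p i / s ≤ q i / s + c := by
    rw [div_add' _ _ _ hs.ne']; gcongr; linarith
  have h2 : q i / s ≤ p i / s + c := by
    rw [div_add' _ _ _ hs.ne']; gcongr; linarith
  simp only [idx]
  have e1 := Int.floor_mono h1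
  have e2 := Int.floor_mono h2
  rw [Int.floor_add_natCast] at e1 e2
  rw [abs_le]
  constructor <;> linarith

lemma abs_idx_sub_le_of_dist {s : ℝ} (hs : 0 < s) {p q : Plane} {c : ℕ}
    (h : dist p q ≤ c * s) (i : Fin 2) : |idx s p i - idx s q i| ≤ c :=
  abs_idx_sub_le hs ((abs_sub_le_dist p q i).trans h)

/-- The index of the box containing `p`; boxes are squares of side `40 * h`. -/
def box (h : ℝ) (p : Plane) : Fin 2 → ℤ := idx (h * (40 : ℕ)) p

lemma idx_box (h : ℝ) (p : Plane) (i : Fin 2) :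
    40 * box h p i ≤ idx h p i ∧ idx h p i ≤ 40 * box h p i + 39 := by
  have := idx_eq_of_mul (s := h) (l := 40) p i
  rw [box, this]
  push_cast
  omega

namespace IsPoissonProcess
variable {Ω : Type*} [MeasurableSpace Ω] {P : Measure Ω} {lam : ℝ} {Φ : Ω → Measure Plane} {ω : Ω}
  {h τ : ℝ} {l : ℕ}

lemma exists_atom_of_isRich (hΦ : IsPoissonProcess P lam Φ) (hh : 0 < h) (hl : 0 < l)
    {z : Fin 2 → ℤ} (hz : IsRich l (windowCount Φ h l z ω)) {c : Fin 2 → ℤ}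
    (hc : ∀ i, 40 * z i - 40 ≤ c i ∧ c i ≤ 40 * z i + 79) : ∃ x ∈ atoms (Φ ω), idx h x = c := by
  have hl' : (0 : ℤ) < l := by exact_mod_cast hl
  have hl0 : (l : ℝ) ≠ 0 := by positivity
  obtain ⟨j, hj, hne⟩ := hz (fun i => c i - 40 * z i) fun i => by
    have := hc i
    constructor <;> linarith
  have h0 : Φ ω (fineCell h l z j) ≠ 0 := by
    rw [← hΦ.coe_cnt (measurableSet_fineCell _ _ _ _) (isBounded_fineCell hh hl _ _)]
    exact_mod_cast hne
  obtain ⟨x, hx, hxa⟩ := (hΦ.isDiscrete ω).exists_atom h0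
  refine ⟨x, hxa, ?_⟩
  funext i
  have e := idx_eq_of_mul (s := h / l) (l := l) x i
  rw [div_mul_cancel₀ _ hl0, mem_cell.1 hx] at e
  rw [e, Pi.add_apply, mul_comm (40 : ℤ), mul_assoc, Int.mul_add_ediv_left _ _ hl'.ne', hj i]
  ring

/-- In a window in which every coarse square contains a point, a location of the next step is
within distance `2 * h` of the two points whose midpoint it is. -/
lemma dist_le_of_isRich (hΦ : IsPoissonProcess P lam Φ) (hh : 0 < h) (hl : 0 < l)
    {z : Fin 2 → ℤ} (hz : IsRich l (windowCount Φ h l z ω)) {x y : Plane}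
    (hxy : Nearest (Φ ω) x y)
    (hc : ∀ i, 40 * z i - 40 ≤ idx h (midpoint ℝ x y) i ∧
      idx h (midpoint ℝ x y) i ≤ 40 * z i + 79) :
    dist x (midpoint ℝ x y) ≤ 2 * h ∧ dist y (midpoint ℝ x y) ≤ 2 * h := by
  obtain ⟨p, hp, hpc⟩ := hΦ.exists_atom_of_isRich hh hl hz hc
  have h1 := hxy.dist_midpoint_le hp
  have h2 := dist_le_of_mem_cell hh (x := p) (y := midpoint ℝ x y) hpc rfl
  refine ⟨h1.trans h2, ?_⟩
  rw [dist_right_midpoint, ← dist_left_midpoint]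
  exact h1.trans h2

/-- Two locations of the next step whose distance is close to `τ / 2` lie in bad boxes: otherwise
the four points of which they are midpoints lie in the window, and cause a resonance. -/
lemma mem_badEvent_of_dist (hΦ : IsPoissonProcess P lam Φ) (hg : IsGeneric (Φ ω)) (hh : 0 < h)
    (hl : 0 < l) {u v : Plane} (hu : u ∈ atoms (step (Φ ω))) (hv : v ∈ atoms (step (Φ ω)))
    (huv : u ≠ v) (hd : |dist u v - τ / 2| < h / l) (hd' : dist u v ≤ 30 * h) :
    ω ∈ badEvent Φ h τ l (box h u) := by
  have hs : 0 < h / l := by positivity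
  by_contra hbad
  simp only [badEvent, mem_ofPred_eq, not_or, not_not] at hbad
  obtain ⟨hrich, hres⟩ := hbad
  obtain ⟨x₁, x₂, h12, rfl⟩ := hg.mem_atoms_step.1 hu
  obtain ⟨x₃, x₄, h34, rfl⟩ := hg.mem_atoms_step.1 hv
  set u := midpoint ℝ x₁ x₂ with hu_def
  set v := midpoint ℝ x₃ x₄ with hv_def
  have hui := idx_box h u
  have hvi := abs_idx_sub_le_of_dist hh (c := 30) (by push_cast; exact hd')
  obtain ⟨b1, b2⟩ := hΦ.dist_le_of_isRich hh hl hrich h12 fun i => by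
    have := hui i
    constructor <;> linarith
  obtain ⟨b3, b4⟩ := hΦ.dist_le_of_isRich hh hl hrich h34 fun i => by
    have := hui i
    have := abs_le.1 (hvi i)
    push_cast at this
    constructor <;> linarith
  have hw : ∀ x m : Plane, dist x m ≤ 2 * h → (∀ i, |idx h u i - idx h m i| ≤ 30) →
      (fun i => idx (h / l) x i - 40 * (l : ℤ) * box h u i) ∈ window l := by
    intro x m hxm hm
    refine idx_fine_mem_window hl fun i => ?_
    have a1 := abs_le.1 (abs_idx_sub_le_of_dist hh (c := 2) (by push_cast; exact hxm) i)
    have a2 := abs_le.1 (hm i)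
    have a3 := hui i
    push_cast at a1
    constructor <;> linarith
  have hmem : ∀ x : Plane, x ∈ fineCell h l (box h u)
      fun i => idx (h / l) x i - 40 * (l : ℤ) * box h u i := by
    intro x
    rw [fineCell, mem_cell]
    funext i
    simp
  let J : ∀ x m : Plane, dist x m ≤ 2 * h → (∀ i, |idx h u i - idx h m i| ≤ 30) → window l :=
    fun x m h1 h2 => ⟨_, hw x m h1 h2⟩
  have hu0 : ∀ i, |idx h u i - idx h u i| ≤ 30 := fun i => by simp
  have hvi' : ∀ i, |idx h u i - idx h v i| ≤ 30 := hvi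
  have hcount : ∀ x m h1 h2, x ∈ atoms (Φ ω) →
      windowCount Φ h l (box h u) ω (J x m h1 h2) ≠ 0 := by
    intro x m h1 h2 hx
    have := hΦ.coe_cnt (measurableSet_fineCell h l (box h u) (J x m h1 h2))
      (isBounded_fineCell hh hl _ _) ω
    intro h0
    rw [show cnt Φ (fineCell h l (box h u) (J x m h1 h2)) ω = 0 from h0, Nat.cast_zero] at this
    exact ne_zero_of_mem hx (hmem x) this.symm
  -- Since no fine square contains two points, distinct points are in distinct fine squares.
  have hJ : ∀ x m h1 h2 x' m' h1' h2', x ∈ atoms (Φ ω) → x' ∈ atoms (Φ ω) →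
      J x m h1 h2 = J x' m' h1' h2' → x = x' := by
    intro x m h1 h2 x' m' h1' h2' hx hx' he
    by_contra hne
    refine hres (Or.inl ⟨J x m h1 h2, ?_⟩)
    have e1 := hΦ.coe_cnt (measurableSet_fineCell h l (box h u) (J x m h1 h2))
      (isBounded_fineCell hh hl _ _) ω
    have e2 : Φ ω ({x, x'} : Set Plane) ≤ Φ ω (fineCell h l (box h u) (J x m h1 h2)) := by
      refine measure_mono (insert_subset (hmem x) (singleton_subset_iff.2 ?_))
      rw [he]
      exact hmem x'
    rw [insert_eq, measure_union (by simpa using hne) (measurableSet_singleton _),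
      hg.measure_eq_one hx, hg.measure_eq_one hx', ← e1, one_add_one_eq_two] at e2
    have e3 : 2 ≤ cnt Φ (fineCell h l (box h u) (J x m h1 h2)) ω := by exact_mod_cast e2
    exact e3
  have i13 := hJ x₁ u b1 hu0 x₃ v b3 hvi' h12.left_mem h34.left_mem
  have i24 := hJ x₂ u b2 hu0 x₄ v b4 hvi' h12.right_mem h34.right_mem
  have i14 := hJ x₁ u b1 hu0 x₄ v b4 hvi' h12.left_mem h34.right_mem
  have i23 := hJ x₂ u b2 hu0 x₃ v b3 hvi' h12.right_mem h34.left_mem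
  refine hres (Or.inr ⟨J x₁ u b1 hu0, J x₂ u b2 hu0, J x₃ v b3 hvi', J x₄ v b4 hvi',
    hcount x₁ u b1 hu0 h12.left_mem, hcount x₂ u b2 hu0 h12.right_mem,
    hcount x₃ v b3 hvi' h34.left_mem, hcount x₄ v b4 hvi' h34.right_mem,
    fun e => h12.ne (hJ x₁ u b1 hu0 x₂ u b2 hu0 h12.left_mem h12.right_mem e),
    fun e => h34.ne (hJ x₃ v b3 hvi' x₄ v b4 hvi' h34.left_mem h34.right_mem e), ⟨?_, ?_⟩, ?_⟩)
  · rintro ⟨e1, e2⟩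
    exact huv (by rw [hu_def, hv_def, i13 e1, i24 e2])
  · rintro ⟨e1, e2⟩
    exact huv (by rw [hu_def, hv_def, i14 e1, i23 e2, midpoint_comm])
  · have hc := norm_add_sub_corner_le hs (hmem x₁) (hmem x₂) (hmem x₃) (hmem x₄)
    have e : dist u v = ‖x₁ + x₂ - x₃ - x₄‖ / 2 := by
      rw [dist_eq_norm, hu_def, hv_def, midpoint_eq_smul_add, midpoint_eq_smul_add, ← smul_sub,
        norm_smul, sub_sub]
      simp
      ring
    rw [e] at hd
    rw [abs_lt] at hd ⊢
    rw [abs_le] at hc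
    constructor <;> linarith [hd.1, hd.2, hc.1, hc.2]

/-- Around a point of a box whose window is full there are two locations of the next step. -/
lemma exists_two_of_isRich (hΦ : IsPoissonProcess P lam Φ) (hg : IsGeneric (Φ ω)) (hh : 0 < h)
    (hl : 0 < l) {p : Plane} (hz : IsRich l (windowCount Φ h l (box h p) ω)) :
    ∃ u ∈ atoms (step (Φ ω)), ∃ v ∈ atoms (step (Φ ω)), u ≠ v ∧ dist p u ≤ 13 * h ∧
      dist p v ≤ 13 * h := by
  have hp := idx_box h p
  have key : ∀ k : ℤ, 0 ≤ k → k ≤ 30 → ∃ m ∈ atoms (step (Φ ω)), ∃ x : Plane,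
      (idx h x 0 = idx h p 0 + k ∧ idx h x 1 = idx h p 1) ∧ dist x m ≤ 2 * h := by
    intro k hk hk'
    obtain ⟨x, hx, hxc⟩ := hΦ.exists_atom_of_isRich hh hl hz (c := ![idx h p 0 + k, idx h p 1]) (by
      have h0 := hp 0
      have h1 := hp 1
      simp only [Fin.forall_fin_two, Matrix.cons_val_zero, Matrix.cons_val_one]
      refine ⟨⟨?_, ?_⟩, ?_, ?_⟩ <;> linarith)
    obtain ⟨x', hx', hxc'⟩ := hΦ.exists_atom_of_isRich hh hl hz
      (c := ![idx h p 0 + k + 1, idx h p 1]) (by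
      have h0 := hp 0
      have h1 := hp 1
      simp only [Fin.forall_fin_two, Matrix.cons_val_zero, Matrix.cons_val_one]
      refine ⟨⟨?_, ?_⟩, ?_, ?_⟩ <;> linarith)
    obtain ⟨y, hy⟩ := hg.exists_nearest hx
    have e0 : idx h x 0 = idx h p 0 + k := by rw [hxc]; rfl
    have e1 : idx h x 1 = idx h p 1 := by rw [hxc]; rfl
    have e0' : idx h x' 0 = idx h p 0 + k + 1 := by rw [hxc']; rfl
    have e1' : idx h x' 1 = idx h p 1 := by rw [hxc']; rfl
    refine ⟨midpoint ℝ x y, hg.mem_atoms_step.2 ⟨x, y, hy, rfl⟩, x, ⟨e0, e1⟩, ?_⟩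
    have c := (mem_cell_iff hh (k := idx h x) (x := x)).1 rfl
    have c' := (mem_cell_iff hh (k := idx h x') (x := x')).1 rfl
    have c0 := c 0
    have c1 := c 1
    have c0' := c' 0
    have c1' := c' 1
    rw [e0] at c0
    rw [e1] at c1
    rw [e0'] at c0'
    rw [e1'] at c1'
    push_cast at c0 c0'
    have hne : x' ≠ x := by
      rintro rfl
      rw [e0'] at e0
      linarith
    have d1 := hy.dist_le x' hx' hne
    have d2 := dist_le_add_abs x x'
    have d3 : |x 0 - x' 0| ≤ 2 * h := by rw [abs_le]; constructor <;> linarith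
    have d4 : |x 1 - x' 1| ≤ h := by rw [abs_le]; constructor <;> linarith
    rw [dist_left_midpoint]
    simp only [Real.norm_ofNat]
    linarith
  -- Locations found nine coarse squares apart are distinct, since each is within `2 * h` of a
  -- point of its coarse square.
  obtain ⟨u, hu, x, ⟨e0, e1⟩, hxu⟩ := key 0 le_rfl (by norm_num)
  obtain ⟨v, hv, y, ⟨f0, f1⟩, hyv⟩ := key 9 (by norm_num) (by norm_num)
  have cp := (mem_cell_iff hh (k := idx h p) (x := p)).1 rfl
  have cx := (mem_cell_iff hh (k := idx h x) (x := x)).1 rfl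
  have cy := (mem_cell_iff hh (k := idx h y) (x := y)).1 rfl
  have cp0 := cp 0
  have cp1 := cp 1
  have cx0 := cx 0
  have cx1 := cx 1
  have cy0 := cy 0
  have cy1 := cy 1
  rw [e0] at cx0
  rw [e1] at cx1
  rw [f0] at cy0
  rw [f1] at cy1
  push_cast at cx0 cy0
  refine ⟨u, hu, v, hv, ?_, ?_, ?_⟩
  · rintro rfl
    have d1 := dist_triangle_right x y u
    have d2 := (neg_abs_le (x 0 - y 0)).trans' (neg_le_neg (abs_sub_le_dist x y 0))
    linarith
  · have d2 := dist_le_add_abs p x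
    have d3 : |p 0 - x 0| ≤ h := by rw [abs_le]; constructor <;> linarith
    have d4 : |p 1 - x 1| ≤ h := by rw [abs_le]; constructor <;> linarith
    linarith [dist_triangle p x u]
  · have d2 := dist_le_add_abs p y
    have d3 : |p 0 - y 0| ≤ 10 * h := by rw [abs_le]; constructor <;> linarith
    have d4 : |p 1 - y 1| ≤ h := by rw [abs_le]; constructor <;> linarith
    linarith [dist_triangle p y v]

lemma box_sub_le (hh : 0 < h) {p q : Plane} (hpq : dist p q ≤ 40 * h) (i : Fin 2) :
    |box h p i - box h q i| ≤ 1 := by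
  have := abs_idx_sub_le_of_dist (s := h * (40 : ℕ)) (by positivity) (p := p) (q := q) (c := 1)
    (by push_cast; linarith) i
  exact_mod_cast this

/-- A long edge of the graph of nearest locations from `b` to `c` crosses bad boxes only, if `c` is
far from all other locations. A box that is not bad has two locations within `13 * h` of each of its
points `p`; if `p` is on the edge, then the balls around `b` and `c` that contain no other
locations leave room for at most one of them. -/
lemma reflTransGen_of_far (hΦ : IsPoissonProcess P lam Φ) (hg : IsGeneric (Φ ω)) (hh : 0 < h)
    (hl : 0 < l) {b c : Plane} (hbc : Nearest (step (Φ ω)) b c)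
    (hc : ∀ w ∈ atoms (step (Φ ω)), w ≠ c → 27 * h < dist c w) :
    Relation.ReflTransGen (BadStep fun z => ω ∈ badEvent Φ h τ l z) (box h b) (box h c) := by
  have hbad : ∀ t : ℝ, 0 ≤ t → t ≤ 1 → ω ∈ badEvent Φ h τ l (box h (AffineMap.lineMap b c t)) := by
    intro t ht0 ht1
    by_contra hbad
    simp only [badEvent, mem_ofPred_eq, not_or, not_not] at hbad
    set p : Plane := AffineMap.lineMap b c t with hp
    obtain ⟨u, hu, v, hv, huv, hpu, hpv⟩ := hΦ.exists_two_of_isRich hg hh hl hbad.1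
    have d1 : dist p b = t * dist b c := by
      rw [hp, dist_lineMap_left, Real.norm_of_nonneg ht0]
    have d2 : dist p c = (1 - t) * dist b c := by
      rw [hp, dist_lineMap_right, Real.norm_of_nonneg (by linarith)]
    rcases le_total ((1 - t) * dist b c) (27 / 2 * h) with h1 | h1
    · have key : ∀ w ∈ atoms (step (Φ ω)), dist p w ≤ 13 * h → w = c := by
        intro w hw hpw
        by_contra hne
        have := hc w hw hne
        linarith [dist_triangle_left c w p]
      exact huv ((key u hu hpu).trans (key v hv hpv).symm)
    · have key : ∀ w ∈ atoms (step (Φ ω)), dist p w ≤ 13 * h → w = b := by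
        intro w hw hpw
        by_contra hne
        have := hbc.dist_le w hw hne
        linarith [dist_triangle_left b w p]
      exact huv ((key u hu hpu).trans (key v hv hpv).symm)
  obtain ⟨n, hn⟩ := exists_nat_gt (dist b c / (40 * h))
  have hn0 : (0 : ℝ) < n := (by positivity : 0 ≤ dist b c / (40 * h)).trans_lt hn
  rw [div_lt_iff₀ (by positivity)] at hn
  have hreach : ∀ k : ℕ, k ≤ n → Relation.ReflTransGen (BadStep fun z => ω ∈ badEvent Φ h τ l z)
      (box h b) (box h (AffineMap.lineMap b c ((k : ℝ) / n))) := by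
    intro k
    induction k with
    | zero => intro _; simp; exact .refl
    | succ k ih =>
      intro hk
      have hk' : ((k + 1 : ℕ) : ℝ) ≤ n := by exact_mod_cast hk
      have hk'' : (k : ℝ) ≤ n := by push_cast at hk'; linarith
      refine (ih (by omega)).tail ⟨hbad _ (by positivity) ((div_le_one hn0).2 hk''),
        hbad _ (by positivity) ((div_le_one hn0).2 hk'), box_sub_le hh ?_⟩
      rw [dist_lineMap_lineMap, Real.dist_eq, ← sub_div]
      push_cast
      rw [add_sub_cancel_left, abs_of_nonneg (by positivity), div_mul_eq_mul_div, one_mul,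
        div_le_iff₀ hn0]
      linarith
  have := hreach n le_rfl
  rwa [div_self hn0.ne', AffineMap.lineMap_apply_one] at this

end IsPoissonProcess

/-- Infinitely many locations do not fit into the boxes of a finite cluster. -/
lemma false_of_reachable {Ω : Type*} {Φ : Ω → Measure Plane} {ω : Ω} {h τ : ℝ} {l : ℕ}
    (hg : IsGeneric (Φ ω)) (hh : 0 < h)
    (hfin : ∀ z, {z' | Relation.ReflTransGen
      (BadStep fun z => ω ∈ badEvent Φ h τ l z) z z'}.Finite)
    {c : ℕ → Plane} (hc : Function.Injective c) (hmem : ∀ n, c n ∈ atoms (step (Φ ω)))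
    (hr : ∀ n, Relation.ReflTransGen (BadStep fun z => ω ∈ badEvent Φ h τ l z)
      (box h (c n)) (box h (c (n + 1)))) : False := by
  have hr' : ∀ n, Relation.ReflTransGen (BadStep fun z => ω ∈ badEvent Φ h τ l z)
      (box h (c 0)) (box h (c n)) := by
    intro n
    induction n with
    | zero => exact .refl
    | succ n ih => exact ih.trans (hr n)
  have hs : 0 < h * (40 : ℕ) := by positivity
  have hb : Bornology.IsBounded (⋃ z ∈ {z' | Relation.ReflTransGen
      (BadStep fun z => ω ∈ badEvent Φ h τ l z) (box h (c 0)) z'}, cell (h * (40 : ℕ)) z) :=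
    (Bornology.isBounded_biUnion (hfin _)).2 fun z _ => isBounded_cell hs z
  refine Set.infinite_range_of_injective hc ((hg.isDiscrete_step.finite_atoms hb).subset ?_)
  rintro _ ⟨n, rfl⟩
  exact ⟨hmem n, mem_iUnion₂.2 ⟨_, hr' n, rfl⟩⟩

/-- A monotone or antitone sequence of nonnegative numbers eventually stays in one of finitely many
intervals that cover `[0, T]`, or above `T`. -/
lemma eventually_mem_or_lt {e : ℕ → ℝ} (h0 : ∀ n, 0 ≤ e n) (he : Monotone e ∨ Antitone e) {T : ℝ}
    {F : Finset ℝ} {r : ℝ → ℝ} (hF : Icc 0 T ⊆ ⋃ t ∈ F, Metric.ball t (r t)) :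
    (∃ t ∈ F, ∀ᶠ n in Filter.atTop, |e n - t| < r t) ∨ ∀ᶠ n in Filter.atTop, T < e n := by
  have hlim : Filter.Tendsto e Filter.atTop Filter.atTop ∨
      ∃ L, Filter.Tendsto e Filter.atTop (nhds L) := by
    rcases he with he | he
    · exact tendsto_atTop_of_monotone he
    · rcases tendsto_atTop_of_antitone he with h | h
      · obtain ⟨n, hn⟩ := (h.eventually_lt_atBot 0).exists
        exact absurd (h0 n) (not_le.2 hn)
      · exact Or.inr h
  rcases hlim with h | ⟨L, hL⟩
  · exact Or.inr (h.eventually_gt_atTop T)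
  · rcases lt_or_ge T L with h | h
    · exact Or.inr (hL.eventually_const_lt h)
    · obtain ⟨t, ht, hLt⟩ := mem_iUnion₂.1 (hF ⟨ge_of_tendsto' hL h0, h⟩)
      refine Or.inl ⟨t, ht, ?_⟩
      filter_upwards [hL.eventually (Metric.isOpen_ball.mem_nhds hLt)] with n hn
      exact hn

/-! ### Finiteness of the components of locations -/

lemma BadStep.stdSymm (b : (Fin 2 → ℤ) → Prop) : Std.Symm (BadStep b) :=
  ⟨fun _ _ h => ⟨h.2.1, h.1, fun i => by rw [abs_sub_comm]; exact h.2.2 i⟩⟩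

namespace IsPoissonProcess
variable {Ω : Type*} [MeasurableSpace Ω] {P : Measure Ω} {lam : ℝ} {Φ : Ω → Measure Plane}

lemma ae_isGeneric (hΦ : IsPoissonProcess P lam Φ) [IsProbabilityMeasure P] (hlam : 0 < lam) :
    ∀ᵐ ω ∂P, IsGeneric (Φ ω) := by
  filter_upwards [hΦ.ae_simple hlam, hΦ.ae_exists_atoms hlam, hΦ.ae_dist_ne_dist hlam]
    with ω h1 h2 h3
  exact ⟨hΦ.isDiscrete ω, h1, h2, h3⟩

/-- Nearest locations after one step are unique: the distances between midpoints of pairs of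
points of a Poisson process are distinct, up to the obvious coincidences. -/
lemma ae_nearest_step_unique (hΦ : IsPoissonProcess P lam Φ) [IsProbabilityMeasure P]
    (hlam : 0 < lam) : ∀ᵐ ω ∂P, ∀ u v w, Nearest (step (Φ ω)) u v → Nearest (step (Φ ω)) u w →
      v = w := by
  filter_upwards [hΦ.ae_isGeneric hlam, hΦ.ae_norm_ne_norm hlam] with ω hg hω u v w huv huw
  have hd : dist u v = dist u w :=
    le_antisymm (huv.dist_le w huw.right_mem huw.ne.symm)
      (huw.dist_le v huv.right_mem huv.ne.symm)
  obtain ⟨x, x', hx, hu⟩ := hg.mem_atoms_step.1 huv.left_mem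
  obtain ⟨y, y', hy, hv⟩ := hg.mem_atoms_step.1 huv.right_mem
  obtain ⟨z, z', hz, hw⟩ := hg.mem_atoms_step.1 huw.right_mem
  have e : ∀ a b c d : Plane, dist (midpoint ℝ a b) (midpoint ℝ c d) = ‖a + b - c - d‖ / 2 := by
    intro a b c d
    rw [dist_eq_norm, midpoint_eq_smul_add, midpoint_eq_smul_add, ← smul_sub, norm_smul, sub_sub]
    simp
    ring
  rw [hu, hv, hw, e, e, div_left_inj' two_ne_zero] at hd
  have hp : ¬PairNe y y' z z' := fun hp => hω x hx.left_mem x' hx.right_mem y hy.left_mem y'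
    hy.right_mem z hz.left_mem z' hz.right_mem hx.ne hy.ne hp hd
  unfold PairNe at hp
  rw [← not_or, not_not] at hp
  rcases hp with ⟨rfl, rfl⟩ | ⟨rfl, rfl⟩
  · rw [hv, hw]
  · rw [hv, hw, midpoint_comm]

/-- An infinite chain of edges with monotone or antitone lengths would produce an infinite cluster
of bad boxes: either the lengths converge, and eventually they all lie in one of the short
intervals to which the bad boxes are tuned, or they are eventually large, and the edges cross
empty regions. -/
lemma false_of_chain (hΦ : IsPoissonProcess P lam Φ) {h : ℝ} (hh : 0 < h) {l : ℝ → ℕ}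
    (hl : ∀ t, 0 < l t) {F : Finset ℝ}
    (hFT : ∀ t ∈ F, t ≤ 27 * h) (hF : Icc 0 (27 * h) ⊆ ⋃ t ∈ F, Metric.ball t (h / l t))
    {ω : Ω} (hg : IsGeneric (Φ ω))
    (hfin : ∀ t ∈ insert 0 F, ∀ z, {z' | Relation.ReflTransGen
      (BadStep fun z => ω ∈ badEvent Φ h (2 * t) (l t) z) z z'}.Finite)
    {c : ℕ → Plane} (hc : Function.Injective c) (hmem : ∀ n, c n ∈ atoms (step (Φ ω)))
    (hmono : Monotone (fun n => dist (c n) (c (n + 1))) ∨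
      Antitone fun n => dist (c n) (c (n + 1)))
    (hfar : ∀ n, (∀ m ≥ n, 27 * h < dist (c m) (c (m + 1))) → Relation.ReflTransGen
      (BadStep fun z => ω ∈ badEvent Φ h 0 (l 0) z) (box h (c (n + 1))) (box h (c (n + 2)))) :
    False := by
  have hshift : ∀ N, Function.Injective fun n => c (n + N) := fun N =>
    hc.comp (add_left_injective N)
  rcases eventually_mem_or_lt (fun n => dist_nonneg) hmono hF with ⟨t, ht, hev⟩ | hev
  · obtain ⟨N, hN⟩ := Filter.eventually_atTop.1 hev
    have hT : ∀ n ≥ N, dist (c n) (c (n + 1)) ≤ 30 * h := fun n hn => by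
      have h1 := (abs_lt.1 (hN n hn)).2
      have h2 : h / l t ≤ h := div_le_self hh.le (by exact_mod_cast hl t)
      linarith [hFT t ht]
    have hbad : ∀ n ≥ N, ω ∈ badEvent Φ h (2 * t) (l t) (box h (c n)) := fun n hn =>
      hΦ.mem_badEvent_of_dist hg hh (hl t) (hmem n) (hmem (n + 1))
        (fun e => absurd (hc e) (by omega)) (by
          rw [mul_div_cancel_left₀ _ two_ne_zero]; exact hN n hn) (hT n hn)
    refine false_of_reachable hg hh (hfin t (Finset.mem_insert_of_mem ht)) (hshift N)
      (fun n => hmem _) fun n => ?_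
    refine .single ⟨hbad _ (by omega), hbad _ (by omega), box_sub_le hh ?_⟩
    have := hT (n + N) (by omega)
    rw [dist_comm, add_right_comm]
    linarith
  · obtain ⟨N, hN⟩ := Filter.eventually_atTop.1 hev
    have hfin0 := hfin 0 (Finset.mem_insert_self _ _)
    rw [mul_zero] at hfin0
    refine false_of_reachable hg hh hfin0 (hshift (N + 1)) (fun n => hmem _) fun n => ?_
    have := hfar (n + N) fun m hm => hN m (by omega)
    convert this using 3 <;> omega

end IsPoissonProcess

/-- The relation of being linked by an edge between nearest locations, in either direction. -/
def Linked (μ : Measure Plane) (x y : Plane) : Prop := Nearest μ x y ∨ Nearest μ y x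

/-- After one step, the nearest-location graph has no infinite connected component. -/
lemma IsPoissonProcess.ae_finite_linked {Ω : Type*} [MeasurableSpace Ω] {P : Measure Ω} {lam : ℝ}
    {Φ : Ω → Measure Plane} (hΦ : IsPoissonProcess P lam Φ)
    [IsProbabilityMeasure P] (hlam : 0 < lam) :
    ∀ᵐ ω ∂P, ∀ u, {v | Relation.ReflTransGen (Linked (step (Φ ω))) u v}.Finite := by
  obtain ⟨h, hh, hscale⟩ := hΦ.exists_scale hlam
  choose l hl hfin using fun t => hscale (2 * t)
  obtain ⟨F, hFT, hF⟩ := (isCompact_Icc (a := (0 : ℝ)) (b := 27 * h)).elim_nhds_subcover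
    (fun t => Metric.ball t (h / l t)) fun t _ => Metric.ball_mem_nhds _
      (div_pos hh (by exact_mod_cast hl t))
  have hfin' : ∀ᵐ ω ∂P, ∀ t ∈ insert 0 F, ∀ z, {z' | Relation.ReflTransGen
      (BadStep fun z => ω ∈ badEvent Φ h (2 * t) (l t) z) z z'}.Finite :=
    (Finset.eventually_all _).2 fun t _ => hfin t
  filter_upwards [hΦ.ae_isGeneric hlam, hΦ.ae_nearest_step_unique hlam, hfin'] with ω hg hu hω
  -- Edge lengths decrease along a forward chain and increase along a backward chain.
  refine finite_component hu (finite_nearest _) ?_ ?_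
  · rintro ⟨c, hc, hr⟩
    refine hΦ.false_of_chain hh hl (fun t ht => (hFT t ht).2) hF hg hω hc
      (fun n => (hr n).left_mem) (Or.inr ?_) fun n hn => ?_
    · refine antitone_nat_of_succ_le fun n => ?_
      rw [dist_comm (c n)]
      exact (hr (n + 1)).dist_le _ (hr n).left_mem fun e => absurd (hc e) (by omega)
    · exact hΦ.reflTransGen_of_far hg hh (hl 0) (hr (n + 1)) fun w hw hne =>
        (hn (n + 2) (by omega)).trans_le ((hr (n + 2)).dist_le w hw hne)
  · rintro ⟨c, hc, hr⟩
    refine hΦ.false_of_chain hh hl (fun t ht => (hFT t ht).2) hF hg hω hc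
      (fun n => (hr n).right_mem) (Or.inl ?_) fun n hn => ?_
    · refine monotone_nat_of_le_succ fun n => ?_
      rw [dist_comm (c n)]
      exact (hr n).dist_le _ (hr (n + 1)).left_mem fun e => absurd (hc e) (by omega)
    · have := BadStep.stdSymm fun z => ω ∈ badEvent Φ h 0 (l 0) z
      refine Std.Symm.symm _ _
        (hΦ.reflTransGen_of_far hg hh (hl 0) (hr (n + 1)) fun w hw hne =>
          (hn n le_rfl).trans_le ?_)
      rw [dist_comm]
      exact (hr n).dist_le w hw hne

/-! ### From locations to agents -/

/-- The connected components of the graph that joins every location to its nearest ones are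
finite. -/
def HasFiniteComponents (μ : Measure Plane) : Prop :=
  ∀ u, {v | Relation.ReflTransGen (Linked μ) u v}.Finite

lemma linked_congr {μ ν : Measure Plane} (h : atoms μ = atoms ν) : Linked μ = Linked ν := by
  have : ∀ x y, Nearest μ x y ↔ Nearest ν x y := fun x y =>
    ⟨fun ⟨h1, h2, h3, h4⟩ => ⟨h ▸ h1, h ▸ h2, h3, h ▸ h4⟩,
      fun ⟨h1, h2, h3, h4⟩ => ⟨h ▸ h1, h ▸ h2, h3, h ▸ h4⟩⟩
  funext x y
  simp only [Linked, this]

/-- An agent is either at the location of its leader or has it as a nearest location. -/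
lemma Follows.linked {μ : Measure Plane} {a b : Agent μ} (h : Follows a b) :
    Relation.ReflTransGen (Linked μ) a.pos b.pos := by
  by_cases he : a.pos = b.pos
  · rw [he]
  · exact .single (Or.inl ⟨a.pos_mem, b.pos_mem, he, fun w hw hwa =>
      h.2 (Agent.mk hw) fun e => hwa (congrArg Agent.pos e)⟩)

lemma Follows.linked_symm {μ : Measure Plane} {a b : Agent μ} (h : Follows a b) :
    Relation.ReflTransGen (Linked μ) b.pos a.pos := by
  by_cases he : a.pos = b.pos
  · rw [he]
  · exact .single (Or.inr ⟨a.pos_mem, b.pos_mem, he, fun w hw hwa =>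
      h.2 (Agent.mk hw) fun e => hwa (congrArg Agent.pos e)⟩)

namespace IsDiscrete
variable {μ : Measure Plane}

/-- A location has finite mass, and hence carries finitely many agents. -/
lemma finite_agents (h : IsDiscrete μ) {S : Set Plane} (hS : S.Finite) :
    {a : Agent μ | a.pos ∈ S}.Finite := by
  refine Set.Finite.preimage' hS fun x _ => ?_
  obtain ⟨n, hn⟩ := ENNReal.exists_nat_gt (h.measure_lt_top (B := {x})
    Bornology.isBounded_singleton).ne
  refine Set.Finite.of_finite_image (f := fun a : Agent μ => a.1.2)
    ((Set.finite_Iio n).subset ?_) ?_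
  · rintro _ ⟨a, ha, rfl⟩
    have h1 : (a.1.2 : ℝ≥0∞) < μ {x} := by
      have := a.2
      rwa [show a.1.1 = x from ha] at this
    exact_mod_cast h1.trans hn
  · intro a ha b hb hab
    exact Subtype.ext (Prod.ext ((show a.1.1 = x from ha).trans (show b.1.1 = x from hb).symm) hab)

lemma finite_reachable (h : IsDiscrete μ) {a : Agent μ}
    (hf : {v | Relation.ReflTransGen (Linked μ) a.pos v}.Finite) :
    {b | (followerGraph μ).Reachable a b}.Finite := by
  refine (h.finite_agents hf).subset fun b hb => ?_
  rw [mem_ofPred_eq, SimpleGraph.reachable_iff_reflTransGen] at hb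
  show Relation.ReflTransGen (Linked μ) a.pos b.pos
  induction hb with
  | refl => exact .refl
  | tail _ hbc ih => exact ih.trans (hbc.elim Follows.linked Follows.linked_symm)

lemma finite_forwardSet (h : IsDiscrete μ) {a : Agent μ}
    (hf : {v | Relation.ReflTransGen (Linked μ) a.pos v}.Finite) : (forwardSet a).Finite := by
  refine (h.finite_reachable hf).subset fun b hb => ?_
  rw [mem_ofPred_eq, SimpleGraph.reachable_iff_reflTransGen]
  exact Relation.ReflTransGen.mono (fun _ _ => Or.inl) _ _ hb

lemma finite_backwardSet (h : IsDiscrete μ) {a : Agent μ}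
    (hf : {v | Relation.ReflTransGen (Linked μ) a.pos v}.Finite) : (backwardSet a).Finite := by
  refine (h.finite_reachable hf).subset fun b hb => ?_
  rw [mem_ofPred_eq, SimpleGraph.reachable_iff_reflTransGen]
  exact Relation.ReflTransGen.mono (fun _ _ => Or.inr) _ _ hb.swap

lemma simpleVersion_eq_withDensity (h : IsDiscrete μ) :
    simpleVersion μ = μ.withDensity fun x => (μ {x})⁻¹ := by
  have : Countable {x : Plane // μ {x} ≠ 0} := h.countable_atoms.to_subtype
  ext B hB
  rw [withDensity_apply _ hB, ← lintegral_indicator hB, tsum_atoms_eq h, simpleVersion,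
    Measure.sum_apply _ hB]
  refine tsum_congr fun x => ?_
  rw [Measure.dirac_apply' _ hB]
  by_cases hx : x.1 ∈ B
  · rw [indicator_of_mem hx, indicator_of_mem hx, ENNReal.inv_mul_cancel x.2
      (h.measure_lt_top Bornology.isBounded_singleton).ne]
    rfl
  · rw [indicator_of_notMem hx, indicator_of_notMem hx, zero_mul]

lemma simpleVersion_le (h : IsDiscrete μ) : simpleVersion μ ≤ μ := by
  rw [h.simpleVersion_eq_withDensity]
  refine (withDensity_mono ?_).trans_eq withDensity_one
  filter_upwards [h.ae_one_le] with x hx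
  exact ENNReal.inv_le_one.2 hx

lemma atoms_simpleVersion (h : IsDiscrete μ) : atoms (simpleVersion μ) = atoms μ := by
  have : Countable {x : Plane // μ {x} ≠ 0} := h.countable_atoms.to_subtype
  ext x
  refine ⟨fun hx h0 => hx (le_antisymm ((h.simpleVersion_le _).trans_eq h0) zero_le), fun hx => ?_⟩
  rw [mem_atoms, simpleVersion, Measure.sum_apply _ (measurableSet_singleton _)]
  refine fun h0 => ?_
  have := ENNReal.tsum_eq_zero.1 h0 ⟨x, hx⟩
  simp at this

lemma isDiscrete_simpleVersion (h : IsDiscrete μ) : IsDiscrete (simpleVersion μ) := by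
  have : Countable {x : Plane // μ {x} ≠ 0} := h.countable_atoms.to_subtype
  exact isDiscrete_sum_dirac _ fun n => (h.simpleVersion_le _).trans_lt (h.ball_lt_top n)

lemma hasFiniteComponents_simpleVersion (h : IsDiscrete μ) (hf : HasFiniteComponents μ) :
    HasFiniteComponents (simpleVersion μ) := by
  rw [HasFiniteComponents, linked_congr h.atoms_simpleVersion]
  exact hf

end IsDiscrete

/-! ### Measurability of the dynamics -/
open ProbabilityTheory

/-- The concentric annuli of width one around the origin. -/
def annulus (n : ℕ) : Set Plane := {x | n ≤ ‖x‖ ∧ ‖x‖ < n + 1}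

lemma measurableSet_annulus (n : ℕ) : MeasurableSet (annulus n) :=
  (measurableSet_le measurable_const measurable_norm).inter
    (measurableSet_lt measurable_norm measurable_const)

lemma measurableSet_mass_annulus (q : ℕ × ℕ) : MeasurableSet {μ : Measure Plane |
    (q.2 : ℝ≥0∞) ≤ μ (annulus q.1) ∧ μ (annulus q.1) < q.2 + 1} :=
  (measurableSet_le measurable_const (Measure.measurable_coe (measurableSet_annulus _))).inter
    (measurableSet_lt (Measure.measurable_coe (measurableSet_annulus _)) measurable_const)

/-- The part of a measure in an annulus, provided that its mass there is in `[m, m + 1)`. -/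
def annulusKernel (q : ℕ × ℕ) : Kernel (Measure Plane) Plane :=
  open Classical in
  Kernel.piecewise (measurableSet_mass_annulus q)
    (Kernel.restrict ⟨id, measurable_id⟩ (measurableSet_annulus q.1)) 0

lemma annulusKernel_apply (q : ℕ × ℕ) (μ : Measure Plane) [Decidable ((q.2 : ℝ≥0∞) ≤
    μ (annulus q.1) ∧ μ (annulus q.1) < q.2 + 1)] : annulusKernel q μ =
      if (q.2 : ℝ≥0∞) ≤ μ (annulus q.1) ∧ μ (annulus q.1) < q.2 + 1 then
        μ.restrict (annulus q.1) else 0 := by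
  rw [annulusKernel, Kernel.piecewise_apply, Kernel.restrict_apply]
  simp only [mem_ofPred_eq]
  split_ifs <;> rfl

instance (q : ℕ × ℕ) : IsFiniteKernel (annulusKernel q) where
  exists_univ_le := by
    classical
    refine ⟨q.2 + 1, by finiteness, fun μ => ?_⟩
    rw [annulusKernel_apply]
    split_ifs with h
    · rw [Measure.restrict_apply_univ]
      exact h.2.le
    · simp

/-- An s-finite kernel that sends every locally finite measure to itself. It turns questions of
measurability in a varying measure into questions about kernels. -/
def selfKernel : Kernel (Measure Plane) Plane := Kernel.sum annulusKernel

instance : IsSFiniteKernel selfKernel := Kernel.isSFiniteKernel_sum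

lemma selfKernel_eq {μ : Measure Plane} (h : ∀ n : ℕ, μ (Metric.ball 0 n) < ∞) :
    selfKernel μ = μ := by
  classical
  have hA : ⋃ n, annulus n = univ := by
    refine eq_univ_of_forall fun x => mem_iUnion.2 ⟨⌊‖x‖⌋₊, Nat.floor_le (norm_nonneg x),
      Nat.lt_floor_add_one _⟩
  have hd : Pairwise (Function.onFun Disjoint annulus) := by
    intro m n hmn
    refine Set.disjoint_left.2 fun x hm hn => hmn ?_
    rw [← (Nat.floor_eq_iff (norm_nonneg x)).2 hm, ← (Nat.floor_eq_iff (norm_nonneg x)).2 hn]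
  have hfin : ∀ n, μ (annulus n) ≠ ∞ := fun n =>
    ((measure_mono fun x hx => by
      rw [mem_ball_zero_iff]; push_cast; exact hx.2).trans_lt (h (n + 1))).ne
  conv_rhs => rw [← Measure.restrict_univ (μ := μ), ← hA,
    Measure.restrict_iUnion hd measurableSet_annulus]
  ext B hB
  rw [selfKernel, Kernel.sum_apply, Measure.sum_apply _ hB, Measure.sum_apply _ hB,
    ENNReal.tsum_prod']
  refine tsum_congr fun n => ?_
  -- The mass of the annulus lies in `[m, m + 1)` for exactly one `m`.
  have hm : ∀ m : ℕ, ((m : ℝ≥0∞) ≤ μ (annulus n) ∧ μ (annulus n) < m + 1) ↔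
      m = ⌊(μ (annulus n)).toReal⌋₊ := fun m => by
    rw [eq_comm, Nat.floor_eq_iff ENNReal.toReal_nonneg, ← ENNReal.ofReal_le_iff_le_toReal (hfin n),
      ← ENNReal.toReal_lt_toReal (hfin n) (by finiteness)]
    simp [ENNReal.toReal_add]
  rw [tsum_eq_single ⌊(μ (annulus n)).toReal⌋₊]
  · rw [annulusKernel_apply, if_pos ((hm _).2 rfl)]
  · intro m hne
    rw [annulusKernel_apply, if_neg fun h' => hne ((hm m).1 h')]
    simp

lemma IsDiscrete.selfKernel_eq {μ : Measure Plane} (h : IsDiscrete μ) : selfKernel μ = μ :=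
  FollowerModel.selfKernel_eq h.ball_lt_top

lemma IsDiscrete.sFinite {μ : Measure Plane} (h : IsDiscrete μ) : SFinite μ := by
  rw [← h.selfKernel_eq]
  infer_instance

/-- Masses of sets that depend measurably on the measure and on a parameter are measurable. -/
lemma measurable_selfKernel_section {α : Type*} [MeasurableSpace α]
    {t : Set ((Measure Plane × α) × Plane)} (ht : MeasurableSet t) :
    Measurable fun p : Measure Plane × α => selfKernel p.1 {y | (p, y) ∈ t} :=
  Kernel.measurable_kernel_prodMk_left (κ := selfKernel.comap Prod.fst measurable_fst) ht

lemma measurable_selfKernel_singleton :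
    Measurable fun p : Measure Plane × Plane => selfKernel p.1 {p.2} := by
  have := measurable_selfKernel_section (α := Plane) (t := {q | q.2 = q.1.2})
    (measurableSet_eq_fun measurable_snd (measurable_snd.comp measurable_fst))
  exact this

/-- The pairs of distinct points `x`, `y` with no location of `μ` other than `x` closer to `x`
than `y`. -/
def emptyBallPairs (μ : Measure Plane) : Set (Plane × Plane) :=
  {p | p.1 ≠ p.2 ∧ selfKernel μ {w | w ≠ p.1 ∧ dist p.1 w < dist p.1 p.2} = 0}

lemma measurableSet_emptyBallPairs :
    MeasurableSet {q : Measure Plane × Plane × Plane | q.2 ∈ emptyBallPairs q.1} := by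
  refine MeasurableSet.inter (s₁ := {q : Measure Plane × Plane × Plane | q.2.1 ≠ q.2.2})
    (s₂ := {q | selfKernel q.1 {w | w ≠ q.2.1 ∧ dist q.2.1 w < dist q.2.1 q.2.2} = 0}) ?_ ?_
  · exact (measurableSet_eq_fun measurable_snd.fst measurable_snd.snd).compl
  · refine (measurable_selfKernel_section (α := Plane × Plane)
      (t := {r | r.2 ≠ r.1.2.1 ∧ dist r.1.2.1 r.2 < dist r.1.2.1 r.1.2.2}) ?_)
      (measurableSet_singleton 0)
    exact (measurableSet_eq_fun measurable_snd measurable_fst.snd.fst).compl.inter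
      (measurableSet_lt (measurable_fst.snd.fst.dist measurable_snd)
        (measurable_fst.snd.fst.dist measurable_fst.snd.snd))

lemma IsDiscrete.nearest_iff {μ : Measure Plane} (h : IsDiscrete μ) {x y : Plane}
    (hx : x ∈ atoms μ) (hy : y ∈ atoms μ) : Nearest μ x y ↔ (x, y) ∈ emptyBallPairs μ := by
  simp only [emptyBallPairs, mem_ofPred_eq, h.selfKernel_eq]
  constructor
  · intro hn
    refine ⟨hn.ne, ?_⟩
    by_contra hne
    obtain ⟨w, hw, hwa⟩ := h.exists_atom hne
    exact (hn.dist_le w hwa hw.1).not_gt hw.2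
  · rintro ⟨hne, h0⟩
    refine ⟨hx, hy, hne, fun w hw hwx => ?_⟩
    by_contra! hlt
    exact ne_zero_of_mem hw (B := {w | w ≠ x ∧ dist x w < dist x y}) ⟨hwx, hlt⟩ h0

/-- The step of the dynamics, written in terms of pairs of locations so that it is visibly
measurable. -/
def pairStep (μ : Measure Plane) : Measure Plane :=
  (((selfKernel ×ₖ selfKernel) μ).restrict (emptyBallPairs μ)).map fun p => midpoint ℝ p.1 p.2

lemma pairStep_apply (μ : Measure Plane) {B : Set Plane} (hB : MeasurableSet B) :
    pairStep μ B = (selfKernel ×ₖ selfKernel) μ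
      (Prod.mk μ ⁻¹' {q | midpoint ℝ q.2.1 q.2.2 ∈ B ∧ q.2 ∈ emptyBallPairs q.1}) := by
  have hm : Measurable fun p : Plane × Plane => midpoint ℝ p.1 p.2 := by
    simp_rw [midpoint_eq_smul_add]
    fun_prop
  rw [pairStep, Measure.map_apply hm hB, Measure.restrict_apply (hm hB)]
  rfl

lemma measurableSet_midpoint_emptyBallPairs {B : Set Plane} (hB : MeasurableSet B) :
    MeasurableSet {q : Measure Plane × Plane × Plane |
      midpoint ℝ q.2.1 q.2.2 ∈ B ∧ q.2 ∈ emptyBallPairs q.1} := by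
  refine MeasurableSet.inter (s₁ := {q : Measure Plane × Plane × Plane |
    midpoint ℝ q.2.1 q.2.2 ∈ B}) ?_ measurableSet_emptyBallPairs
  have hm : Measurable fun q : Measure Plane × Plane × Plane => midpoint ℝ q.2.1 q.2.2 := by
    simp_rw [midpoint_eq_smul_add]
    fun_prop
  exact hm hB

lemma measurable_pairStep : Measurable pairStep := by
  refine Measure.measurable_of_measurable_coe _ fun B hB => ?_
  simp_rw [pairStep_apply _ hB]
  exact Kernel.measurable_kernel_prodMk_left (measurableSet_midpoint_emptyBallPairs hB)

lemma IsGeneric.step_eq_pairStep {μ : Measure Plane} (h : IsGeneric μ) :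
    step μ = pairStep μ := by
  have := h.isDiscrete.sFinite
  ext B hB
  have hM := measurable_prodMk_left (x := μ) (measurableSet_midpoint_emptyBallPairs hB)
  rw [pairStep_apply _ hB, Kernel.prod_apply, h.isDiscrete.selfKernel_eq, Measure.prod_apply hM,
    ← h.tsum_agent_eq, step_apply _ hB]
  refine tsum_congr fun a => ?_
  have hn := h.nearest_leader a
  set y₀ := (leader a).pos
  have hae : ∀ᵐ y ∂μ, ((a.pos, y) ∈ emptyBallPairs μ ↔ y = y₀) := by
    filter_upwards [h.isDiscrete.ae_mem_atoms] with y hy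
    rw [← h.isDiscrete.nearest_iff a.pos_mem hy]
    exact ⟨fun hy => h.nearest_unique hy hn, fun e => e ▸ hn⟩
  by_cases hB0 : midpoint ℝ a.pos y₀ ∈ B
  · rw [indicator_of_mem hB0, Pi.one_apply, ← h.measure_eq_one hn.right_mem]
    refine measure_congr ?_
    filter_upwards [hae] with y hy
    refine propext ⟨?_, ?_⟩
    · rintro rfl
      exact ⟨hB0, hy.2 rfl⟩
    · rintro ⟨-, h'⟩
      exact hy.1 h'
  · rw [indicator_of_notMem hB0, eq_comm, ← nonpos_iff_eq_zero, ← measure_empty (μ := μ)]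
    refine measure_mono_ae ?_
    filter_upwards [hae] with y hy
    rintro ⟨h1, h2⟩
    rw [hy.1 h2] at h1
    exact hB0 h1

/-- The simple version of a measure, in a visibly measurable form. -/
def simpleKernel : Kernel (Measure Plane) Plane :=
  selfKernel.withDensity fun μ x => (selfKernel μ {x})⁻¹

lemma IsDiscrete.simpleVersion_eq_simpleKernel {μ : Measure Plane} (h : IsDiscrete μ) :
    simpleVersion μ = simpleKernel μ := by
  rw [simpleKernel, Kernel.withDensity_apply _ measurable_selfKernel_singleton.inv,
    h.selfKernel_eq, h.simpleVersion_eq_withDensity]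

/-! ### The Palm law -/

lemma measurableSet_unitSquare : MeasurableSet unitSquare := by
  have : unitSquare = ⋂ i : Fin 2, {x : Plane | x i ∈ Ico (0 : ℝ) 1} := by
    ext x; simp [unitSquare]
  rw [this]
  exact MeasurableSet.iInter fun i => (by fun_prop : Measurable fun x : Plane => x i)
    measurableSet_Ico

/-- The contribution of one realisation to the Palm law. -/
def palmMap (μ : Measure Plane) : Measure (Measure Plane) :=
  (μ.restrict unitSquare).map fun x => μ.map fun y => y - x

lemma measurable_selfKernel_translate :
    Measurable fun p : Measure Plane × Plane => (selfKernel p.1).map fun y => y - p.2 := by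
  refine Measure.measurable_of_measurable_coe _ fun B hB => ?_
  have hm : ∀ x : Plane, Measurable fun y : Plane => y - x := fun x => by fun_prop
  simp_rw [Measure.map_apply (hm _) hB]
  refine measurable_selfKernel_section (α := Plane) (t := {q | q.2 - q.1.2 ∈ B}) ?_
  exact (by fun_prop : Measurable fun q : (Measure Plane × Plane) × Plane => q.2 - q.1.2) hB

lemma IsDiscrete.measurable_translate {μ : Measure Plane} (h : IsDiscrete μ) :
    Measurable fun x : Plane => μ.map fun y => y - x := by
  have := measurable_selfKernel_translate.comp (measurable_prodMk_left (x := μ))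
  simpa only [Function.comp_def, h.selfKernel_eq] using this

lemma IsDiscrete.palmMap_apply {μ : Measure Plane} (h : IsDiscrete μ) {A : Set (Measure Plane)}
    (hA : MeasurableSet A) :
    palmMap μ A = μ {x | (μ.map fun y => y - x) ∈ A ∧ x ∈ unitSquare} := by
  rw [palmMap, Measure.map_apply h.measurable_translate hA,
    Measure.restrict_apply (h.measurable_translate hA)]
  rfl

/-- The map `palmMap` agrees with a measurable map on discrete measures. -/
lemma exists_measurable_eq_palmMap :
    ∃ T : Measure Plane → Measure (Measure Plane), Measurable T ∧
      ∀ μ, IsDiscrete μ → T μ = palmMap μ := by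
  refine ⟨fun μ => ((selfKernel μ).restrict unitSquare).map fun x =>
    (selfKernel μ).map fun y => y - x, ?_, fun μ h => by simp only [h.selfKernel_eq]; rfl⟩
  refine Measure.measurable_of_measurable_coe _ fun A hA => ?_
  have h1 : ∀ μ : Measure Plane, Measurable fun x : Plane => (selfKernel μ).map fun y => y - x :=
    fun μ => measurable_selfKernel_translate.comp (measurable_prodMk_left (x := μ))
  simp_rw [Measure.map_apply (h1 _) hA, Measure.restrict_apply (h1 _ hA)]
  exact Kernel.measurable_kernel_prodMk_left
    ((measurable_selfKernel_translate hA).inter (measurable_snd measurableSet_unitSquare))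

lemma measurableSet_isDiscrete : MeasurableSet {μ : Measure Plane | IsDiscrete μ} := by
  have : {μ : Measure Plane | IsDiscrete μ} = (⋂ n : ℕ, {μ | μ (Metric.ball 0 n) < ∞}) ∩
      {μ | selfKernel μ (Prod.mk μ ⁻¹' {p | selfKernel p.1 {p.2} < 1}) = 0} := by
    ext μ
    simp only [mem_ofPred_eq, mem_inter_iff, mem_iInter]
    constructor
    · refine fun h => ⟨h.ball_lt_top, ?_⟩
      rw [h.selfKernel_eq]
      simpa [ae_iff, h.selfKernel_eq] using h.ae_one_le
    · rintro ⟨h1, h2⟩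
      refine ⟨h1, ?_⟩
      simpa [ae_iff, selfKernel_eq h1] using h2
  rw [this]
  refine (MeasurableSet.iInter fun n => measurableSet_lt
    (Measure.measurable_coe Metric.isOpen_ball.measurableSet) measurable_const).inter ?_
  exact Kernel.measurable_kernel_prodMk_left
    (measurableSet_lt measurable_selfKernel_singleton measurable_const) (measurableSet_singleton 0)

/-- A union of finitely many squares of side `1 / (n + 1)`. Such sets form a countable family that
separates finite sets of locations from the other locations of a discrete measure. -/
def cellUnion (q : ℕ × Finset (Fin 2 → ℤ)) : Set Plane := ⋃ k ∈ q.2, cell (1 / (q.1 + 1 : ℝ)) k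

lemma measurableSet_cellUnion (q : ℕ × Finset (Fin 2 → ℤ)) : MeasurableSet (cellUnion q) :=
  Finset.measurableSet_biUnion _ fun _ _ => measurableSet_cell _ _

lemma isBounded_cellUnion (q : ℕ × Finset (Fin 2 → ℤ)) : Bornology.IsBounded (cellUnion q) :=
  (Bornology.isBounded_biUnion_finset _).2 fun _ _ => isBounded_cell (by positivity) _

lemma IsDiscrete.exists_cellUnion {μ : Measure Plane} (h : IsDiscrete μ) {C : Set Plane}
    (hC : C.Finite) : ∃ q, C ⊆ cellUnion q ∧ ∀ w ∈ atoms μ, w ∈ cellUnion q → w ∈ C := by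
  have ht : Filter.Tendsto (fun n : ℕ => 2 * (1 / (n + 1 : ℝ))) Filter.atTop (nhds 0) := by
    simpa using tendsto_one_div_add_atTop_nhds_zero_nat.const_mul (2 : ℝ)
  have h1 : ∀ c ∈ C, ∀ᶠ n : ℕ in Filter.atTop, ∀ w ∈ atoms μ ∩ Metric.closedBall c 2, w ∉ C →
      2 * (1 / (n + 1 : ℝ)) < dist w c := by
    intro c hc
    rw [(h.finite_atoms Metric.isBounded_closedBall).eventually_all]
    intro w _
    by_cases hw : w ∈ C
    · exact Filter.Eventually.of_forall fun _ h => absurd hw h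
    · filter_upwards [ht.eventually_lt_const (dist_pos.2 fun e : w = c => hw (e ▸ hc))] with n hn _
      exact hn
  obtain ⟨n, hn⟩ := (hC.eventually_all.2 h1).exists
  have hs : 0 < 1 / (n + 1 : ℝ) := by positivity
  refine ⟨(n, hC.toFinset.image (idx (1 / (n + 1 : ℝ)))), fun c hc => ?_, fun w hw hwq => ?_⟩
  · exact mem_iUnion₂.2 ⟨_, Finset.mem_image_of_mem _ (hC.mem_toFinset.2 hc), rfl⟩
  · obtain ⟨k, hk, hwk⟩ := mem_iUnion₂.1 hwq
    obtain ⟨c, hc, rfl⟩ := Finset.mem_image.1 hk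
    rw [hC.mem_toFinset] at hc
    by_contra hwC
    have h2 := dist_le_of_mem_cell hs hwk rfl
    have h3 : 1 / (n + 1 : ℝ) ≤ 1 := by
      rw [div_le_one (by positivity)]
      linarith [(Nat.cast_nonneg n : (0 : ℝ) ≤ n)]
    have h4 := hn c hc w ⟨hw, Metric.mem_closedBall.2 (by linarith)⟩ hwC
    linarith

/-- The measures for which no edge of the nearest-location graph joins `W` to its complement. -/
def Isolates (μ : Measure Plane) (W : Set Plane) : Prop :=
  (selfKernel ×ₖ selfKernel) μ (emptyBallPairs μ ∩ (W ×ˢ Wᶜ ∪ Wᶜ ×ˢ W)) = 0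

lemma measurableSet_isolates {W : Set Plane} (hW : MeasurableSet W) :
    MeasurableSet {μ | Isolates μ W} := by
  refine (Kernel.measurable_kernel_prodMk_left (κ := selfKernel ×ₖ selfKernel)
    (t := {q | q.2 ∈ emptyBallPairs q.1 ∧ q.2 ∈ W ×ˢ Wᶜ ∪ Wᶜ ×ˢ W}) ?_) (measurableSet_singleton 0)
  exact measurableSet_emptyBallPairs.inter (measurable_snd
    ((hW.prod hW.compl).union (hW.compl.prod hW)))

lemma IsDiscrete.isolates_iff {μ : Measure Plane} (h : IsDiscrete μ) {W : Set Plane} :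
    Isolates μ W ↔ ∀ x y, Nearest μ x y → (x ∈ W ↔ y ∈ W) := by
  have := h.sFinite
  rw [Isolates, Kernel.prod_apply, h.selfKernel_eq]
  constructor
  · intro h0 x y hxy
    by_contra hne
    have h1 : (μ.prod μ) {(x, y)} = 0 := by
      refine measure_mono_null (t := emptyBallPairs μ ∩ (W ×ˢ Wᶜ ∪ Wᶜ ×ˢ W))
        (singleton_subset_iff.2 ⟨?_, ?_⟩) h0
      · exact (h.nearest_iff hxy.left_mem hxy.right_mem).1 hxy
      · simp only [mem_union, mem_prod, mem_compl_iff]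
        tauto
    rw [← singleton_prod_singleton, Measure.prod_prod] at h1
    exact (mul_ne_zero hxy.left_mem hxy.right_mem) h1
  · intro hW
    have h1 : ∀ᵐ p ∂(μ.prod μ), p.1 ∈ atoms μ ∧ p.2 ∈ atoms μ :=
      (Measure.quasiMeasurePreserving_fst.ae h.ae_mem_atoms).and
        (Measure.quasiMeasurePreserving_snd.ae h.ae_mem_atoms)
    rw [measure_eq_zero_iff_ae_notMem]
    filter_upwards [h1] with p hp hmem
    have h2 := hW p.1 p.2 ((h.nearest_iff hp.1 hp.2).2 hmem.1)
    have h3 := hmem.2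
    simp only [mem_union, mem_prod, mem_compl_iff] at h3
    tauto

/-- The discrete measures with a location at the origin whose component is isolated from the other
locations by a union of small squares. -/
def originIsolated : Set (Measure Plane) :=
  {μ | IsDiscrete μ ∧ μ {0} ≠ 0 ∧ ∃ q, (0 : Plane) ∈ cellUnion q ∧ Isolates μ (cellUnion q)}

lemma measurableSet_originIsolated : MeasurableSet originIsolated := by
  have : originIsolated = {μ | IsDiscrete μ} ∩ ({μ : Measure Plane | μ {0} ≠ 0} ∩
      ⋃ q ∈ {q | (0 : Plane) ∈ cellUnion q}, {μ | Isolates μ (cellUnion q)}) := by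
    ext μ
    simp [originIsolated]
  rw [this]
  refine measurableSet_isDiscrete.inter (MeasurableSet.inter ?_ ?_)
  · exact (Measure.measurable_coe (measurableSet_singleton 0) (measurableSet_singleton 0)).compl
  · exact MeasurableSet.biUnion (Set.to_countable _) fun q _ =>
      measurableSet_isolates (measurableSet_cellUnion q)

lemma finite_of_mem_originIsolated {μ : Measure Plane} (h : μ ∈ originIsolated) :
    {v | Relation.ReflTransGen (Linked μ) 0 v}.Finite := by
  obtain ⟨hd, h0, q, hq, hiso⟩ := h
  rw [hd.isolates_iff] at hiso
  refine (hd.finite_atoms (isBounded_cellUnion q)).subset fun v hv => ?_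
  rw [mem_ofPred_eq] at hv
  induction hv with
  | refl => exact ⟨h0, hq⟩
  | tail _ hbc ih =>
    rcases hbc with hn | hn
    · exact ⟨hn.right_mem, (hiso _ _ hn).1 ih.2⟩
    · exact ⟨hn.left_mem, (hiso _ _ hn).2 ih.2⟩

lemma mem_originIsolated {μ : Measure Plane} (hd : IsDiscrete μ) (h0 : (0 : Plane) ∈ atoms μ)
    (hf : {v | Relation.ReflTransGen (Linked μ) 0 v}.Finite) : μ ∈ originIsolated := by
  obtain ⟨q, hq, hq'⟩ := hd.exists_cellUnion hf
  refine ⟨hd, h0, q, hq .refl, hd.isolates_iff.2 fun x y hxy => ⟨fun hx => ?_, fun hy => ?_⟩⟩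
  · exact hq (Relation.ReflTransGen.tail (hq' x hxy.left_mem hx) (Or.inl hxy))
  · exact hq (Relation.ReflTransGen.tail (hq' y hxy.right_mem hy) (Or.inr hxy))

section Translate
variable {μ : Measure Plane} (x : Plane)

lemma map_sub_singleton (u : Plane) : (μ.map fun y => y - x) {u} = μ {u + x} := by
  rw [Measure.map_apply (by fun_prop) (measurableSet_singleton _)]
  congr 1
  ext y
  simp [sub_eq_iff_eq_add]

lemma IsDiscrete.map_sub (h : IsDiscrete μ) : IsDiscrete (μ.map fun y => y - x) := by
  refine ⟨fun n => ?_, ?_⟩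
  · rw [Measure.map_apply (by fun_prop) Metric.isOpen_ball.measurableSet]
    refine (measure_mono (t := Metric.ball x n) fun y hy => ?_).trans_lt
      (h.measure_lt_top Metric.isBounded_ball)
    simpa [dist_eq_norm] using hy
  · have he : MeasurableEmbedding fun y : Plane => y - x :=
      (MeasurableEquiv.subRight x).measurableEmbedding
    rw [he.ae_map_iff]
    filter_upwards [h.ae_one_le] with y hy
    rw [map_sub_singleton, sub_add_cancel]
    exact hy

lemma Linked.of_map_sub {u v : Plane} (h : Linked (μ.map fun y => y - x) u v) :
    Linked μ (u + x) (v + x) := by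
  have hmem : ∀ w, w ∈ atoms (μ.map fun y => y - x) ↔ w + x ∈ atoms μ := fun w => by
    rw [mem_atoms, map_sub_singleton, mem_atoms]
  have key : ∀ u v, Nearest (μ.map fun y => y - x) u v → Nearest μ (u + x) (v + x) := by
    intro u v hn
    refine ⟨(hmem _).1 hn.left_mem, (hmem _).1 hn.right_mem, fun e => hn.ne (add_right_cancel e),
      fun w hw hne => ?_⟩
    have := hn.dist_le (w - x) ((hmem _).2 (by rwa [sub_add_cancel])) fun e =>
      hne (sub_eq_iff_eq_add.1 e)
    rw [dist_add_right]
    convert this using 1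
    rw [dist_eq_norm, dist_eq_norm]
    congr 1
    abel
  exact h.imp (key u v) (key v u)

lemma HasFiniteComponents.map_sub (h : HasFiniteComponents μ) :
    HasFiniteComponents (μ.map fun y => y - x) := fun u => by
  refine ((h (u + x)).preimage (add_left_injective x).injOn).subset fun v hv => ?_
  exact Relation.ReflTransGen.lift (fun w => w + x) (fun _ _ => Linked.of_map_sub x) _ _ hv

end Translate

/-- A point process with finite positive intensity whose components are finite has a Palm law that
is a probability measure, and the component of the origin is finite under the Palm law. -/
lemma palmForwardBackwardFinite {Ω : Type*} [MeasurableSpace Ω] {P : Measure Ω}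
    {Ψ : Ω → Measure Plane} (hm : AEMeasurable Ψ P) (hd : ∀ᵐ ω ∂P, IsDiscrete (Ψ ω))
    (hf : ∀ᵐ ω ∂P, HasFiniteComponents (Ψ ω)) (h0 : intensity P Ψ ≠ 0)
    (htop : intensity P Ψ ≠ ∞) : PalmForwardBackwardFinite P Ψ := by
  obtain ⟨T, hT, hTe⟩ := exists_measurable_eq_palmMap
  have hpm : AEMeasurable (fun ω => palmMap (Ψ ω)) P :=
    (hT.comp_aemeasurable hm).congr (by filter_upwards [hd] with ω hω using hTe _ hω)
  have happly : ∀ A, MeasurableSet A →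
      palm P Ψ A = (intensity P Ψ)⁻¹ * ∫⁻ ω, palmMap (Ψ ω) A ∂P := by
    intro A hA
    rw [palm, Measure.smul_apply, smul_eq_mul, ← Measure.bind_apply hA hpm]
    rfl
  refine ⟨⟨?_⟩, ?_⟩
  · rw [happly _ MeasurableSet.univ]
    have : ∫⁻ ω, palmMap (Ψ ω) univ ∂P = intensity P Ψ := by
      refine lintegral_congr_ae ?_
      filter_upwards [hd] with ω hω
      simp [hω.palmMap_apply]
    rw [this, ENNReal.inv_mul_cancel h0 htop]
  · have hG : ∀ᵐ μ ∂(palm P Ψ), μ ∈ originIsolated := by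
      rw [ae_iff]
      show palm P Ψ originIsolatedᶜ = 0
      rw [happly _ measurableSet_originIsolated.compl]
      have : ∫⁻ ω, palmMap (Ψ ω) originIsolatedᶜ ∂P = 0 := by
        rw [← lintegral_zero (μ := P)]
        refine lintegral_congr_ae ?_
        filter_upwards [hd, hf] with ω hω hfω
        rw [hω.palmMap_apply measurableSet_originIsolated.compl]
        refine measure_mono_null (fun x hx => ?_) (ae_iff.1 hω.ae_mem_atoms)
        intro hxa
        refine hx.1 (mem_originIsolated (hω.map_sub x) ?_ (hfω.map_sub x 0))
        rw [mem_atoms, map_sub_singleton, zero_add]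
        exact hxa
      rw [this, mul_zero]
    filter_upwards [hG] with μ hμ
    refine ⟨⟨Agent.mk hμ.2.1, rfl⟩, fun a ha => ?_⟩
    have hfin := finite_of_mem_originIsolated hμ
    rw [← ha] at hfin
    exact ⟨hμ.1.finite_forwardSet hfin, hμ.1.finite_backwardSet hfin⟩

/-! ### The intensity after one step -/

lemma unitSquare_eq_cell : unitSquare = cell 1 0 := by
  ext x
  rw [mem_cell_iff one_pos]
  simp [unitSquare]

lemma isBounded_unitSquare : Bornology.IsBounded unitSquare := by
  rw [unitSquare_eq_cell]
  exact isBounded_cell one_pos _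

lemma norm_le_of_mem_unitSquare {x : Plane} (hx : x ∈ unitSquare) : ‖x‖ ≤ 2 := by
  rw [unitSquare_eq_cell] at hx
  have h0 : (0 : Plane) ∈ cell 1 0 := by rw [mem_cell_iff one_pos]; simp
  have := dist_le_of_mem_cell one_pos hx h0
  rw [dist_zero_right] at this
  linarith

lemma midpoint_mem_unitSquare {x y : Plane} (hx : x ∈ unitSquare) (hy : y ∈ unitSquare) :
    midpoint ℝ x y ∈ unitSquare := by
  intro i
  have h1 := hx i
  have h2 := hy i
  have : (midpoint ℝ x y) i = 2⁻¹ * (x i + y i) := by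
    rw [midpoint_eq_smul_add]
    simp [mul_add]
  rw [this]
  constructor <;> linarith [h1.1, h1.2, h2.1, h2.2]

lemma volume_real_ball (r : ℝ) (hr : 0 ≤ r) :
    volume.real (Metric.ball (0 : Plane) r) = r ^ 2 * Real.pi := by
  rw [Measure.real, EuclideanSpace.volume_ball_fin_two, ENNReal.toReal_mul, ENNReal.toReal_pow,
    ENNReal.toReal_ofReal hr, ENNReal.toReal_ofReal Real.pi_nonneg]

namespace IsPoissonProcess
variable {Ω : Type*} [MeasurableSpace Ω] {P : Measure Ω} {lam : ℝ} {Φ : Ω → Measure Plane}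

lemma aemeasurable_step (hΦ : IsPoissonProcess P lam Φ) [IsProbabilityMeasure P]
    (hlam : 0 < lam) : AEMeasurable (fun ω => step (Φ ω)) P := by
  refine ((measurable_pairStep.comp hΦ.measurable).aemeasurable).congr ?_
  filter_upwards [hΦ.ae_isGeneric hlam] with ω hω
  exact hω.step_eq_pairStep.symm

lemma aemeasurable_simpleVersion_step (hΦ : IsPoissonProcess P lam Φ) [IsProbabilityMeasure P]
    (hlam : 0 < lam) : AEMeasurable (fun ω => simpleVersion (step (Φ ω))) P := by
  refine (simpleKernel.measurable.comp_aemeasurable (hΦ.aemeasurable_step hlam)).congr ?_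
  filter_upwards [hΦ.ae_isGeneric hlam] with ω hω
  exact hω.isDiscrete_step.simpleVersion_eq_simpleKernel.symm

/-- The mean number of points of `B` on the event that there are none in `C`, by independence of the
process in `C` and in `B \ C`. -/
lemma lintegral_indicator_le (hΦ : IsPoissonProcess P lam Φ) [IsProbabilityMeasure P]
    (hlam : 0 ≤ lam) {B C : Set Plane} (hB : MeasurableSet B) (hC : MeasurableSet C)
    (hB' : Bornology.IsBounded B) (hC' : Bornology.IsBounded C) :
    ∫⁻ ω, {ω | Φ ω C = 0}.indicator (fun ω => Φ ω B) ω ∂P ≤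
      ENNReal.ofReal (Real.exp (-(lam * volume.real C))) *
        ENNReal.ofReal (lam * volume.real B) := by
  have hBC : Bornology.IsBounded (B \ C) := hB'.subset sdiff_subset
  have hind : IndepFun (cnt Φ C) (cnt Φ (B \ C)) P := by
    have := hΦ.iIndepFun_cnt' (S := Bool) (fun b => bif b then C else B \ C)
      (by rintro (_ | _); exacts [hB.diff hC, hC]) (by rintro (_ | _); exacts [hBC, hC'])
      (by
        rintro (_ | _) (_ | _) h
        · exact absurd rfl h
        · exact disjoint_sdiff_left
        · exact disjoint_sdiff_right
        · exact absurd rfl h)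
    exact this.indepFun (i := true) (j := false) (by simp)
  have hmC := hΦ.measurable_cnt hC
  have hmB := hΦ.measurable_cnt (hB.diff hC)
  let f : ℕ → ℝ≥0∞ := fun k => ({0} : Set ℕ).indicator 1 k
  calc ∫⁻ ω, {ω | Φ ω C = 0}.indicator (fun ω => Φ ω B) ω ∂P
      ≤ ∫⁻ ω, f (cnt Φ C ω) * (cnt Φ (B \ C) ω : ℝ≥0∞) ∂P := by
        refine lintegral_mono fun ω => ?_
        by_cases h0 : Φ ω C = 0
        · have h1 : cnt Φ C ω = 0 := by
            have := hΦ.coe_cnt hC hC' ω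
            rw [h0] at this
            exact_mod_cast this
          rw [indicator_of_mem (by exact h0), h1, hΦ.coe_cnt (hB.diff hC) hBC,
            measure_sdiff_null h0]
          simp [f]
        · rw [indicator_of_notMem (by exact h0)]
          exact zero_le
    _ = (∫⁻ ω, f (cnt Φ C ω) ∂P) * ∫⁻ ω, (cnt Φ (B \ C) ω : ℝ≥0∞) ∂P :=
        lintegral_mul_eq_lintegral_mul_lintegral_of_indepFun
          ((measurable_of_countable f).comp hmC)
          ((measurable_of_countable fun n : ℕ => (n : ℝ≥0∞)).comp hmB)
          (hind.comp (measurable_of_countable f)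
            (measurable_of_countable fun n : ℕ => (n : ℝ≥0∞)))
    _ ≤ _ := by
        refine mul_le_mul' (le_of_eq ?_) ?_
        · have h1 : ∀ ω, f (cnt Φ C ω) = {ω | Φ ω C = 0}.indicator 1 ω := fun ω => by
            have := hΦ.coe_cnt hC hC' ω
            simp only [f, indicator_apply, mem_singleton_iff, mem_ofPred_eq, ← this,
              Nat.cast_eq_zero]
            rfl
          simp_rw [h1]
          rw [lintegral_indicator_one, hΦ.prob_eq_zero hC hC']
          exact (Measure.measurable_coe hC).comp hΦ.measurable (measurableSet_singleton 0)
        · rw [hΦ.lintegral_eq hlam (hB.diff hC) hBC]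
          gcongr
          · exact hB'.measure_lt_top.ne
          · exact sdiff_subset

/-- The mean number of points in a unit square after one step is finite: if the square of side `n`
contains a point, only points within distance of order `n` can move into the unit square, and
the probability that it contains no point decays exponentially. -/
lemma intensity_step_ne_top (hΦ : IsPoissonProcess P lam Φ) [IsProbabilityMeasure P]
    (hlam : 0 < lam) : intensity P (fun ω => step (Φ ω)) ≠ ∞ := by
  set B : ℕ → Set Plane := fun n => Metric.ball 0 (2 * n + 5) with hB
  let g : ℕ → Ω → ℝ≥0∞ := fun n =>
    {ω | n = 0 ∨ Φ ω (cell n 0) = 0}.indicator fun ω => Φ ω (B n)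
  have hmeas : ∀ n, Measurable (g n) := fun n => by
    refine Measurable.indicator ((Measure.measurable_coe Metric.isOpen_ball.measurableSet).comp
      hΦ.measurable) ?_
    exact (MeasurableSet.const (n = 0)).union ((Measure.measurable_coe
      (measurableSet_cell _ _)).comp hΦ.measurable (measurableSet_singleton 0))
  have h1 : intensity P (fun ω => step (Φ ω)) ≤ ∑' n, ∫⁻ ω, g n ω ∂P := by
    rw [← lintegral_tsum fun n => (hmeas n).aemeasurable]
    refine lintegral_mono_ae ?_
    filter_upwards [hΦ.ae_isGeneric hlam, hΦ.ae_exists_cell_ne_zero hlam 0] with ω hg hex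
    have hex' : ∃ n : ℕ, Φ ω (cell ((n + 1 : ℕ) : ℝ) 0) ≠ 0 := by
      obtain ⟨n, hn, hn'⟩ := hex
      exact ⟨n - 1, by rwa [Nat.sub_add_cancel hn]⟩
    classical
    -- The square of side `n + 1` is the first one to contain a point.
    set n := Nat.find hex' with hn
    have hn0 : n = 0 ∨ Φ ω (cell n 0) = 0 := by
      rcases Nat.eq_zero_or_pos n with h0 | h0
      · exact Or.inl h0
      · have := Nat.find_min hex' (m := n - 1) (by omega)
        rw [not_not, Nat.sub_add_cancel h0] at this
        exact Or.inr this
    refine le_trans ?_ (ENNReal.le_tsum n)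
    rw [show g n ω = Φ ω (B n) from indicator_of_mem (by exact hn0) _]
    obtain ⟨p, hp, hpa⟩ := hg.isDiscrete.exists_atom (Nat.find_spec hex')
    refine hg.step_le measurableSet_unitSquare Metric.isOpen_ball.measurableSet
      fun x y hxy hm => ?_
    have hs : (0 : ℝ) < ((n + 1 : ℕ) : ℝ) := by positivity
    have hmc : midpoint ℝ x y ∈ cell ((n + 1 : ℕ) : ℝ) 0 := by
      rw [mem_cell_iff hs]
      intro i
      have := hm i
      have hn1 : (0 : ℝ) ≤ n := Nat.cast_nonneg n
      push_cast
      simp only [Pi.zero_apply, Int.cast_zero, mul_zero, zero_add, mul_one]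
      exact ⟨this.1, by linarith [this.2]⟩
    have h1 := hxy.dist_midpoint_le hpa
    have h2 := dist_le_of_mem_cell hs hp hmc
    have h3 := norm_le_of_mem_unitSquare hm
    have h4 := dist_triangle x (midpoint ℝ x y) 0
    rw [dist_zero_right (midpoint ℝ x y)] at h4
    push_cast at h2
    rw [hB, Metric.mem_ball]
    linarith
  refine ne_top_of_le_ne_top ?_ h1
  -- The term `n = 0`, where no square is required to be empty, is treated separately.
  rw [tsum_eq_zero_add' ENNReal.summable]
  refine ENNReal.add_ne_top.2 ⟨?_, ?_⟩
  · refine ne_top_of_le_ne_top ?_ (lintegral_mono fun ω => indicator_le_self _ _ ω)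
    have := hΦ.lintegral_eq hlam.le (B := B 0) Metric.isOpen_ball.measurableSet
      Metric.isBounded_ball
    simp_rw [hΦ.coe_cnt (B := B 0) Metric.isOpen_ball.measurableSet Metric.isBounded_ball] at this
    rw [this]
    exact ENNReal.ofReal_ne_top
  · have h2 : ∀ n : ℕ, ∫⁻ ω, g (n + 1) ω ∂P ≤ ENNReal.ofReal
        (lam * Real.pi * (49 * ((n + 1 : ℕ) ^ 2 * Real.exp (-lam * (n + 1 : ℕ))))) := by
      intro n
      have hs : (0 : ℝ) < ((n + 1 : ℕ) : ℝ) := by positivity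
      have h3 := hΦ.lintegral_indicator_le hlam.le (B := B (n + 1))
        (C := cell ((n + 1 : ℕ) : ℝ) 0) Metric.isOpen_ball.measurableSet (measurableSet_cell _ _)
        Metric.isBounded_ball (isBounded_cell hs _)
      have h4 : ∀ ω, g (n + 1) ω = {ω | Φ ω (cell ((n + 1 : ℕ) : ℝ) 0) = 0}.indicator
          (fun ω => Φ ω (B (n + 1))) ω := fun ω => by
        simp [g]
      simp_rw [h4]
      refine h3.trans ?_
      rw [← ENNReal.ofReal_mul (Real.exp_nonneg _), volume_real_cell hs, hB,
        volume_real_ball _ (by positivity)]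
      refine ENNReal.ofReal_le_ofReal ?_
      have h5 : (1 : ℝ) ≤ ((n + 1 : ℕ) : ℝ) := by exact_mod_cast Nat.le_add_left 1 n
      set t : ℝ := ((n + 1 : ℕ) : ℝ)
      have h6 : Real.exp (-(lam * t ^ 2)) ≤ Real.exp (-lam * t) :=
        Real.exp_le_exp.2 (by
          have := mul_le_mul_of_nonneg_left (le_self_pow₀ h5 two_ne_zero) hlam.le
          linarith)
      have h7 : (2 * t + 5) ^ 2 ≤ 49 * t ^ 2 := by nlinarith
      calc Real.exp (-(lam * t ^ 2)) * (lam * ((2 * t + 5) ^ 2 * Real.pi))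
          ≤ Real.exp (-lam * t) * (lam * ((49 * t ^ 2) * Real.pi)) := by gcongr
        _ = _ := by ring
    refine ne_top_of_le_ne_top ?_ (ENNReal.tsum_le_tsum h2)
    have hsum := ((Real.summable_pow_mul_exp_neg_nat_mul 2 hlam).mul_left 49).mul_left
      (lam * Real.pi)
    exact ((summable_nat_add_iff 1).2 hsum).tsum_ofReal_ne_top

/-- With positive probability some location of the next step is in the unit square: this happens
when the square contains two points and no other point is near. -/
lemma exists_step_unitSquare_ne_zero (hΦ : IsPoissonProcess P lam Φ) [IsProbabilityMeasure P]
    (hlam : 0 < lam) : ∃ E : Set Ω, P E ≠ 0 ∧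
      ∀ᵐ ω ∂P, ω ∈ E → ∃ m ∈ unitSquare, m ∈ atoms (step (Φ ω)) := by
  have hbb : Bornology.IsBounded (Metric.ball (0 : Plane) 10 \ unitSquare) :=
    Metric.isBounded_ball.subset sdiff_subset
  have hmb : MeasurableSet (Metric.ball (0 : Plane) 10 \ unitSquare) :=
    Metric.isOpen_ball.measurableSet.diff measurableSet_unitSquare
  have hP := hΦ.prob_cnt_eq
    (fun b : Bool => bif b then unitSquare else Metric.ball (0 : Plane) 10 \ unitSquare)
    (by rintro (_ | _); exacts [hmb, measurableSet_unitSquare])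
    (by rintro (_ | _); exacts [hbb, isBounded_unitSquare])
    (by
      rintro (_ | _) (_ | _) h
      · exact absurd rfl h
      · exact disjoint_sdiff_left
      · exact disjoint_sdiff_right
      · exact absurd rfl h) (fun b => bif b then 2 else 0)
  refine ⟨{ω | ∀ b : Bool,
    cnt Φ (bif b then unitSquare else Metric.ball (0 : Plane) 10 \ unitSquare) ω =
      bif b then 2 else 0}, ?_, ?_⟩
  · rw [hP, Fintype.prod_bool]
    have hvol : volume.real unitSquare = 1 := by
      rw [unitSquare_eq_cell, volume_real_cell one_pos, one_pow]
    simp only [pois, cond_true, cond_false, hvol]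
    refine mul_ne_zero ?_ ?_ <;> refine (ENNReal.ofReal_pos.2 (by positivity)).ne'
  · filter_upwards [hΦ.ae_isGeneric hlam] with ω hg hω
    have h2 : Φ ω unitSquare = 2 := by
      rw [← hΦ.coe_cnt measurableSet_unitSquare isBounded_unitSquare]
      exact_mod_cast hω true
    have h0 : Φ ω (Metric.ball (0 : Plane) 10 \ unitSquare) = 0 := by
      rw [← hΦ.coe_cnt hmb hbb]
      exact_mod_cast hω false
    obtain ⟨x, hx, hxa⟩ := hg.isDiscrete.exists_atom (B := unitSquare) (by simp [h2])
    have h3 : Φ ω (unitSquare \ {x}) ≠ 0 := by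
      intro h3
      have h4 := measure_union_le (μ := Φ ω) (unitSquare \ {x}) {x}
      rw [h3, hg.measure_eq_one hxa, zero_add] at h4
      have h5 := (measure_mono (fun y hy => by
        by_cases h : y = x
        · exact Or.inr h
        · exact Or.inl ⟨hy, h⟩)).trans h4
      rw [h2] at h5
      norm_num at h5
    obtain ⟨y, hy, hya⟩ := hg.isDiscrete.exists_atom h3
    obtain ⟨z, hz⟩ := hg.exists_nearest hxa
    refine ⟨midpoint ℝ x z, midpoint_mem_unitSquare hx ?_, hg.mem_atoms_step.2 ⟨x, z, hz, rfl⟩⟩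
    by_contra hzs
    refine ne_zero_of_mem hz.right_mem (B := Metric.ball (0 : Plane) 10 \ unitSquare)
      ⟨?_, hzs⟩ h0
    have h4 := hz.dist_le y hya hy.2
    have h5 := norm_le_of_mem_unitSquare hx
    have h6 := norm_le_of_mem_unitSquare hy.1
    have h7 := dist_triangle_left z 0 x
    have h8 := dist_le_norm_add_norm x y
    rw [dist_zero_right] at h7
    rw [mem_ball_zero_iff]
    rw [dist_zero_right] at h7
    linarith

end IsPoissonProcess

lemma intensity_ne_zero {Ω : Type*} [MeasurableSpace Ω] {P : Measure Ω} {Ψ : Ω → Measure Plane}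
    (hm : AEMeasurable Ψ P) {E : Set Ω} (hE : P E ≠ 0)
    (h : ∀ᵐ ω ∂P, ω ∈ E → ∃ m ∈ unitSquare, m ∈ atoms (Ψ ω)) : intensity P Ψ ≠ 0 := by
  intro h0
  have hm' : AEMeasurable (fun ω => Ψ ω unitSquare) P :=
    (Measure.measurable_coe measurableSet_unitSquare).comp_aemeasurable hm
  rw [intensity, lintegral_eq_zero_iff' hm'] at h0
  refine hE (measure_mono_null (fun ω hω => ?_) (ae_iff.1 (h.and h0)))
  rintro ⟨h1, h2⟩
  obtain ⟨m, hm, hma⟩ := h1 hω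
  exact ne_zero_of_mem hma hm h2

end FollowerModel

end

theorem mainTheorem2 {Ω : Type*} [MeasurableSpace Ω] (P : Measure Ω) [IsProbabilityMeasure P]
    (lam : ℝ) (hlam : 0 < lam) (Φ : Ω → Measure FollowerModel.Plane)
    (hΦ : FollowerModel.IsPoissonProcess P lam Φ) :
    (FollowerModel.DoesNotPercolate P (fun ω => FollowerModel.step (Φ ω)) ∧
      FollowerModel.PalmForwardBackwardFinite P (fun ω => FollowerModel.step (Φ ω))) ∧
    (FollowerModel.DoesNotPercolate P
        (fun ω => FollowerModel.simpleVersion (FollowerModel.step (Φ ω))) ∧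
      FollowerModel.PalmForwardBackwardFinite P
        (fun ω => FollowerModel.simpleVersion (FollowerModel.step (Φ ω)))) := by
  have hd : ∀ᵐ ω ∂P, FollowerModel.IsDiscrete (FollowerModel.step (Φ ω)) := by
    filter_upwards [hΦ.ae_isGeneric hlam] with ω hω using hω.isDiscrete_step
  have hf : ∀ᵐ ω ∂P, FollowerModel.HasFiniteComponents (FollowerModel.step (Φ ω)) :=
    hΦ.ae_finite_linked hlam
  have hd' : ∀ᵐ ω ∂P,
      FollowerModel.IsDiscrete (FollowerModel.simpleVersion (FollowerModel.step (Φ ω))) := by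
    filter_upwards [hd] with ω hω using hω.isDiscrete_simpleVersion
  have hf' : ∀ᵐ ω ∂P, FollowerModel.HasFiniteComponents
      (FollowerModel.simpleVersion (FollowerModel.step (Φ ω))) := by
    filter_upwards [hd, hf] with ω hω hfω using hω.hasFiniteComponents_simpleVersion hfω
  have hm := hΦ.aemeasurable_step hlam
  have hm' := hΦ.aemeasurable_simpleVersion_step hlam
  obtain ⟨E, hE, hEs⟩ := hΦ.exists_step_unitSquare_ne_zero hlam
  have htop := hΦ.intensity_step_ne_top hlam
  refine ⟨⟨?_, FollowerModel.palmForwardBackwardFinite hm hd hf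
    (FollowerModel.intensity_ne_zero hm hE hEs) htop⟩, ?_,
    FollowerModel.palmForwardBackwardFinite hm' hd' hf' (FollowerModel.intensity_ne_zero hm' hE ?_)
      (ne_top_of_le_ne_top htop ?_)⟩
  · filter_upwards [hd, hf] with ω hω hfω a using hω.finite_reachable (hfω _)
  · filter_upwards [hd', hf'] with ω hω hfω a using hω.finite_reachable (hfω _)
  · filter_upwards [hEs, hd] with ω hω hdω hωE
    rw [hdω.atoms_simpleVersion]
    exact hω hωE
  · refine lintegral_mono_ae ?_
    filter_upwards [hd] with ω hω using hω.simpleVersion_le _
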